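/- Let $G=(V,E)$ be a finite simple graph with a fixed total order on $V$. **Symmetric functions.** Work with symmetric formal power series over $\mathbb{Q}$, possibly of unbounded degree, in countably many variables $x_1,x_2,\dots$, with infinite sums taken coefficientwise. Let $p_k=\sum_i x_i^k$ and $1+\overline{p}_k=\prod_{i}(1+x_i^k)$, and for an integer partition $\lambda=(\lambda_1,\dots,\lambda_\ell)$ put $p_\lambda=\prod_i p_{\lambda_i}$ and $\overline{p}_\lambda=\prod_i\overline{p}_{\lambda_i}$. Let $\omega$ be the involution $\omega\bigl(\sum_\lambda c_\lambda p_\lambda\bigr)=\sum_\lambda(-1)^{|\lambda|-\ell(\lambda)}c_\lambda p_\lambda$. Let $$\overline{X}_G=\sum_\kappa\prod_{v\in V}\prod_{i\in\kappa(v)}x_i$$ be the Kromatic symmetric function, where $\kappa$ runs over the proper set colorings of $G$: maps assigning to each vertex a nonempty finite set of positive integers such that adjacent vertices get disjoint sets. **Lyndon heaps.** A heap on $G$ is an equivalence class of words over $V$ under exchanging neighboring letters that are not adjacent in $G$ (equal letters count as joined); heaps multiply by concatenation. The letter occurrences of a heap are its pieces, their number is its size $|H|$, and there is an edge directed from each piece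 to every later piece whose letter is equal or adjacent in $G$ to its own. A pyramid is a heap with a unique source, i.e. exactly one piece with no edge directed towards it. A heap is periodic if it equals $K^k$ for a heap $K$ and some $k>1$, and aperiodic otherwise. For a piece $p$ of $H$, write $H=U\circ P$ where $P$ consists of the pieces reachable from $p$, and put $A_p(H)=P\circ U$; the rotations of a pyramid $H$ are the eventual values $A_p^\infty(H)$ of the sequences $A_p^n(H)$, for the pieces $p$ of $H$. The standard word of a heap is its lexicographically largest word. A Lyndon heap is an aperiodic pyramid whose standard word is lexicographically minimal among those of its rotations. **Theorem.** There are unique coefficients $[\overline{p}_\lambda]\omega(\overline{X}_G)\in\mathbb{Q}$ such that $$\omega(\overline{X}_G)=\sum_\lambda [\overline{p}_\lambda]\omega(\overline{X}_G)\;\overline{p}_\lambda .$$ For every partition $\lambda=(\lambda_1,\dots,\lambda_\ell)$, the coefficient $[\overline{p}_\lambda]\omega(\overline{X}_G)$ is the (finite) number of multisets $\{(\lambda_1,L_1),\dots,(\lambda_\ell,L_\ell)\}$ in which a Lyndon heap $L_i$ on $G$ is attached to each part $\lambda_i$, such that 1. every vertex of $G$ is used by at least one $L_i$; 2. for each $i$,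 $|L_i|=\lambda_i/2^j$ for some integer $j\ge 0$; 3. the Lyndon heaps attached to equal parts of $\lambda$ are distinct from each other (the same heap may be attached to parts of different sizes). In particular, $\omega(\overline{X}_G)$ is $\overline{p}$-positive: all of its $\overline{p}$-coefficients are nonnegative. -/

import Mathlib

noncomputable section

namespace Kromatic

/-! ## Symmetric power series in countably many variables

The variables are indexed by `ℕ`, and formal power series carry the topology of coefficientwise
convergence. -/

open scoped MvPowerSeries.WithPiTopology

/-- Integer partitions `λ` of arbitrary size: `λ.1` is the size and `λ.2.parts` the multiset of
(positive) parts. -/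
abbrev IntPartition : Type := Σ n : ℕ, n.Partition

/-- The power sum `p_k = ∑ᵢ xᵢ ^ k`. -/
def psum (k : ℕ) : MvPowerSeries ℕ ℚ := ∑' i : ℕ, (MvPowerSeries.X i) ^ k

/-- `p_λ = ∏ⱼ p_{λⱼ}`. -/
def psumPart (lam : IntPartition) : MvPowerSeries ℕ ℚ := (lam.2.parts.map psum).prod

/-- `p̄_k`, defined by `1 + p̄_k = ∏ᵢ (1 + xᵢ ^ k)`. -/
def pbar (k : ℕ) : MvPowerSeries ℕ ℚ := (∏' i : ℕ, (1 + (MvPowerSeries.X i) ^ k)) - 1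

/-- `p̄_λ = ∏ⱼ p̄_{λⱼ}`. -/
def pbarPart (lam : IntPartition) : MvPowerSeries ℕ ℚ := (lam.2.parts.map pbar).prod

/-- `f = ∑_λ c_λ p_λ`. -/
def HasPsumExpansion (f : MvPowerSeries ℕ ℚ) (c : IntPartition → ℚ) : Prop :=
  HasSum (fun lam => c lam • psumPart lam) f

/-- `f = ∑_λ c_λ p̄_λ`. -/
def HasPbarExpansion (f : MvPowerSeries ℕ ℚ) (c : IntPartition → ℚ) : Prop :=
  HasSum (fun lam => c lam • pbarPart lam) f

/-- All coefficients of the `p̄`-expansion are nonnegative. -/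
def IsPbarPositive (f : MvPowerSeries ℕ ℚ) : Prop :=
  ∃ c : IntPartition → ℚ, HasPbarExpansion f c ∧ ∀ lam, 0 ≤ c lam

open Classical in
/-- The involution `ω` on symmetric power series (possibly of unbounded degree):
`∑ c_λ p_λ ↦ ∑ (-1)^(|λ| - ℓ(λ)) c_λ p_λ`. Every symmetric power series over `ℚ` has exactly one
expansion `∑ c_λ p_λ`; on series without one (the non-symmetric ones) the value is `0`. -/
def omega (f : MvPowerSeries ℕ ℚ) : MvPowerSeries ℕ ℚ :=
  if h : ∃ c : IntPartition → ℚ, HasPsumExpansion f c then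
    ∑' lam : IntPartition,
      ((-1) ^ (lam.1 - Multiset.card lam.2.parts) * h.choose lam) • psumPart lam
  else 0

/-! ## The Kromatic symmetric function -/

section Kromatic

variable {V : Type*} (G : SimpleGraph V)

/-- A proper set coloring: every vertex gets a nonempty set of colors, and adjacent vertices get
disjoint sets. (An infinite color set would contribute no monomial, so color sets are finite.) -/
def IsProperSetColoring (κ : V → Finset ℕ) : Prop :=
  (∀ v, (κ v).Nonempty) ∧ ∀ u v, G.Adj u v → Disjoint (κ u) (κ v)

/-- The exponent vector of the monomial `∏_v ∏_{i ∈ κ v} xᵢ`. -/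
def colorWeight [Fintype V] (κ : V → Finset ℕ) : ℕ →₀ ℕ :=
  ∑ v, ∑ i ∈ κ v, Finsupp.single i 1

/-- The Kromatic symmetric function `X̄_G = ∑_κ ∏_v ∏_{i ∈ κ v} xᵢ`: the coefficient of `x ^ d` is
the number of proper set colorings `κ` whose monomial is `x ^ d`. (There are finitely many: all
color sets lie in the support of `d`.) -/
def kromatic [Fintype V] : MvPowerSeries ℕ ℚ := fun d =>
  ((({κ : V → Finset ℕ | IsProperSetColoring G κ ∧ colorWeight κ = d}.ncard : ℕ)) : ℚ)

end Kromatic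

/-! ## Heaps -/

section Heaps

variable {V : Type*} (G : SimpleGraph V)

/-- The congruence on words over `V` generated by `u v = v u` for `u`, `v` not adjacent in `G`. -/
def heapCon : Con (FreeMonoid V) :=
  conGen fun a b => ∃ u v : V, ¬ G.Adj u v ∧
    a = FreeMonoid.of u * FreeMonoid.of v ∧ b = FreeMonoid.of v * FreeMonoid.of u

/-- Heaps on `G`: the elements of the free partially commutative monoid, that is, classes of words
up to exchanging neighboring letters that are not adjacent in `G`. The product is composition. -/
abbrev Heap : Type _ := (heapCon G).Quotient

/-- The heap `[w]` of a word `w`. -/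
def Heap.ofWord (w : List V) : Heap G := (heapCon G).mk' (FreeMonoid.ofList w)

variable {G}

/-- The multiset of vertices of the pieces of a heap, as a monoid homomorphism. -/
def Heap.piecesHom : Heap G →* Multiplicative (Multiset V) :=
  (heapCon G).lift (FreeMonoid.lift fun v => Multiplicative.ofAdd ({v} : Multiset V)) <| by
    refine Con.conGen_le.2 ?_
    rintro _ _ ⟨u, v, -, rfl, rfl⟩
    simp [Con.ker_rel, mul_comm]

/-- The multiset of vertices of the pieces of a heap (`v` occurs `α_v` times in type `α`). -/
def Heap.pieces (H : Heap G) : Multiset V := Multiplicative.toAdd (Heap.piecesHom H)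

/-- The number of pieces. -/
def Heap.size (H : Heap G) : ℕ := Multiset.card H.pieces

variable (G)

/-- The acyclic orientation carried by a word `w`. The pieces are the positions of `w`; two pieces
are joined if their vertices are equal or adjacent in `G` (the clan graph), and the edge is directed
from the earlier to the later position. -/
def Arrow (w : List V) (i j : ℕ) : Prop :=
  i < j ∧ ∃ a b : V, w[i]? = some a ∧ w[j]? = some b ∧ (a = b ∨ G.Adj a b)

/-- There is a directed path (possibly of length `0`) from the piece `i` to the piece `j`. -/
def Reach (w : List V) : ℕ → ℕ → Prop := Relation.ReflTransGen (Arrow G w)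

/-- The piece `i` has no edge directed towards it. -/
def IsSource (w : List V) (i : ℕ) : Prop := i < w.length ∧ ∀ j, ¬ Arrow G w j i

variable {G}

/-- A pyramid is a heap with a unique source. -/
def Heap.IsPyramid (H : Heap G) : Prop :=
  ∃ w : List V, Heap.ofWord G w = H ∧ ∃! i, IsSource G w i

/-- A heap is periodic if it is a `k`-fold power, `k > 1`. -/
def Heap.IsPeriodic (H : Heap G) : Prop := ∃ (K : Heap G) (k : ℕ), 1 < k ∧ H = K ^ k

variable (G)

open Classical in
/-- The subword of `w` on the pieces reachable from `p`: the pyramid determined by `p`. -/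
def upperWord (w : List V) (p : ℕ) : List V :=
  (w.zipIdx.filter fun x => decide (Reach G w p x.2)).map Prod.fst

open Classical in
/-- The subword of `w` on the pieces not reachable from `p`. -/
def lowerWord (w : List V) (p : ℕ) : List V :=
  (w.zipIdx.filter fun x => decide (¬ Reach G w p x.2)).map Prod.fst

/-- The operation `A_p` on a word with a marked piece `p`. The heap of `w` is `U ∘ P` with `P` the
pyramid of `p`, and it is replaced by `P ∘ U`; the piece `p` is the first letter of the new word. -/
def rotStep (x : List V × ℕ) : List V × ℕ := (upperWord G x.1 x.2 ++ lowerWord G x.1 x.2, 0)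

variable {G}

/-- `Q = A_p^∞(P)` for some piece `p` of `P`: the sequence `A_p^n(P)` is eventually equal to `Q`. -/
def Heap.IsRotation (P Q : Heap G) : Prop :=
  ∃ (w : List V) (p : ℕ), Heap.ofWord G w = P ∧ p < w.length ∧
    ∀ᶠ n in Filter.atTop, Heap.ofWord G ((rotStep G)^[n] (w, p)).1 = Q

/-- `w` is the standard word of `H`: the lexicographically largest word of `H`. -/
def Heap.IsStandardWord [LinearOrder V] (H : Heap G) (w : List V) : Prop :=
  Heap.ofWord G w = H ∧ ∀ w' : List V, Heap.ofWord G w' = H → w' ≤ w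

/-- The order on heaps: lexicographic comparison of the standard words. -/
def Heap.StdLE [LinearOrder V] (H₁ H₂ : Heap G) : Prop :=
  ∃ w₁ w₂ : List V, H₁.IsStandardWord w₁ ∧ H₂.IsStandardWord w₂ ∧ w₁ ≤ w₂

/-- A Lyndon heap is an aperiodic pyramid that is minimal among its rotations. -/
def Heap.IsLyndon [LinearOrder V] (L : Heap G) : Prop :=
  L.IsPyramid ∧ ¬ L.IsPeriodic ∧ ∀ Q : Heap G, Q.IsPyramid → L.IsRotation Q → L.StdLE Q

variable (G)

/-- Multisets of Lyndon heaps `L_1, …, L_ℓ`, where `L_i` is attached to the part `λ_i` of `λ`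
(written as pairs `(λ_i, L_i)`), such that `|L_i| = λ_i / 2 ^ j` for some `j ≥ 0`, every vertex of
`G` is used by some `L_i`, and heaps attached to equal parts are distinct. -/
def lyndonCoverings [LinearOrder V] (lam : IntPartition) : Set (Multiset (ℕ × Heap G)) :=
  {M | M.map Prod.fst = lam.2.parts ∧
    (∀ x ∈ M, x.2.IsLyndon ∧ ∃ j : ℕ, x.2.size * 2 ^ j = x.1) ∧
    (∀ v : V, ∃ x ∈ M, v ∈ x.2.pieces) ∧
    ∀ k : ℕ, ((M.filter fun x => x.1 = k).map Prod.snd).Nodup}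

end Heaps

end Kromatic

end

/-! For W ⊆ V let S_W(t) count the stable sets in W by size, H_W(t) the heaps with all pieces in W,
and P_W(t) the pyramids among them.

A set coloring is the same as a stable set for each color, so inclusion and exclusion over the set W
of vertices allowed to be colored gives X̄_G = ∑_W (-1)^{|V∖W|} ∏ᵢ S_W(xᵢ) (`kromatic_eq_sum`). A
product ∏ᵢ F(xᵢ) equals exp(∑ b_k p_k / k), where ∑ b_k t^k = t F'(t)/F(t)
(`hasPsumExpansion_prodSeries`). Since ω multiplies p_k by (-1)^(k-1), it turns ∏ᵢ F(xᵢ) into ∏ᵢ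
1/F(-xᵢ). By the Cartier–Foata inversion (`sum_stableOn_mul_heapsOn`), 1/S_W(-t) = H_W(t), so
ω(X̄_G) = ∑_W (-1)^{|V∖W|} ∏ᵢ H_W(xᵢ) (`omega_kromatic`).

It remains to factor H_W. Marking a piece of a heap cuts off the pyramid above it, so t H_W' = H_W
P_W (`mul_card_heapsOn`). A pyramid is a power of a unique aperiodic pyramid (`root_unique`), and an
aperiodic pyramid with n pieces has exactly n rotations (`encard_conj`), precisely one of which is
Lyndon. Hence P_W(t) = ∑_L |L| ∑_{j ≥ 1} t^(j|L|) over the Lyndon heaps L on W, and integration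
gives H_W(t) = ∏_L 1/(1 - t^|L|) = ∏_L ∏_{j ≥ 0} (1 + t^(|L| 2^j)).

Substituting t = xᵢ and multiplying over i turns each factor 1 + t^k into 1 + p̄_k. Expanding yields
one term p̄_λ for each finite set of pairs (|L| 2^j, L), and the alternating sum over W keeps the
sets that use all vertices. Uniqueness of the coefficients holds because the lowest term of p̄_λ is
p_λ and the p_λ are linearly independent (`hasSum_unique`).

The hardest step is the count of rotations. It treats heaps as elements of a cancellative monoid
with Levi's lemma (`levi`): rotation of pyramids becomes conjugacy, and pyramids with a common
source behave like words. -/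

noncomputable section

/-! ### The monoid of heaps: cancellation, Levi's lemma, pyramids. -/

namespace Kromatic

section Heaps

variable {V : Type*} {G : SimpleGraph V}

namespace Heap

/-! ### Words, letters and pieces of a heap -/

variable (G) in
/-- The heap with the single piece `a`. -/
def letter (a : V) : Heap G := ofWord G [a]

@[simp] lemma ofWord_nil : ofWord G [] = 1 := rfl

lemma ofWord_append (w w' : List V) : ofWord G (w ++ w') = ofWord G w * ofWord G w' := rfl

lemma ofWord_cons (a : V) (w : List V) : ofWord G (a :: w) = letter G a * ofWord G w := rfl

lemma ofWord_surjective (H : Heap G) : ∃ w, ofWord G w = H := by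
  obtain ⟨w, hw⟩ := Con.mk'_surjective (c := heapCon G) H
  exact ⟨FreeMonoid.toList w, hw⟩

@[elab_as_elim]
lemma induction_letter {p : Heap G → Prop} (one : p 1)
    (letter_mul : ∀ a H, p H → p (letter G a * H)) (H : Heap G) : p H := by
  obtain ⟨w, rfl⟩ := ofWord_surjective H
  induction w with
  | nil => exact one
  | cons a w ih => exact letter_mul a _ ih

lemma eq_one_or_letter_mul (H : Heap G) : H = 1 ∨ ∃ a H', H = letter G a * H' := by
  induction H using induction_letter with
  | one => exact Or.inl rfl
  | letter_mul a H _ => exact Or.inr ⟨a, H, rfl⟩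

@[simp] lemma pieces_one : (1 : Heap G).pieces = 0 := by simp [pieces]

@[simp] lemma pieces_mul (H K : Heap G) : (H * K).pieces = H.pieces + K.pieces := by simp [pieces]

@[simp] lemma pieces_letter (a : V) : (letter G a).pieces = {a} := rfl

lemma pieces_ofWord (w : List V) : (ofWord G w).pieces = (w : Multiset V) := by
  induction w with
  | nil => simp
  | cons a w ih => simp [ofWord_cons, ih]

lemma pieces_pow (H : Heap G) (k : ℕ) : (H ^ k).pieces = k • H.pieces := by
  induction k with
  | zero => simp
  | succ k ih => simp [pow_succ, ih, succ_nsmul]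

@[simp] lemma size_one : (1 : Heap G).size = 0 := by simp [size]

@[simp] lemma size_mul (H K : Heap G) : (H * K).size = H.size + K.size := by simp [size]

@[simp] lemma size_letter (a : V) : (letter G a).size = 1 := rfl

@[simp] lemma size_pow (H : Heap G) (k : ℕ) : (H ^ k).size = k * H.size := by
  simp [size, pieces_pow]

lemma size_ofWord (w : List V) : (ofWord G w).size = w.length := by
  simp [size, pieces_ofWord]

lemma pieces_eq_zero {H : Heap G} : H.pieces = 0 ↔ H = 1 := by
  refine ⟨fun h => ?_, fun h => h ▸ pieces_one⟩
  rcases eq_one_or_letter_mul H with h' | ⟨a, H', rfl⟩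
  · exact h'
  · simp at h

lemma size_eq_zero {H : Heap G} : H.size = 0 ↔ H = 1 := by
  rw [size, Multiset.card_eq_zero, pieces_eq_zero]

lemma size_pos {H : Heap G} (h : H ≠ 1) : 0 < H.size :=
  Nat.pos_of_ne_zero fun h' => h (size_eq_zero.1 h')

lemma eq_one_of_mul_eq_one {x y : Heap G} (h : x * y = 1) : x = 1 ∧ y = 1 := by
  have := congrArg size h
  simp only [size_mul, size_one] at this
  exact ⟨size_eq_zero.1 (by omega), size_eq_zero.1 (by omega)⟩

/-! ### Independence -/

/-- No piece of `x` is joined to a piece of `y`. -/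
def Indep (x y : Heap G) : Prop := ∀ a ∈ x.pieces, ∀ b ∈ y.pieces, a ≠ b ∧ ¬ G.Adj a b

lemma Indep.symm {x y : Heap G} (h : Indep x y) : Indep y x :=
  fun a ha b hb => ⟨(h b hb a ha).1.symm, fun h' => (h b hb a ha).2 h'.symm⟩

@[simp] lemma indep_one_left (x : Heap G) : Indep 1 x := by simp [Indep]

@[simp] lemma indep_one_right (x : Heap G) : Indep x 1 := by simp [Indep]

@[simp] lemma indep_mul_left {x y z : Heap G} : Indep (x * y) z ↔ Indep x z ∧ Indep y z := by
  simp only [Indep, pieces_mul, Multiset.mem_add]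
  grind

@[simp] lemma indep_mul_right {x y z : Heap G} : Indep x (y * z) ↔ Indep x y ∧ Indep x z := by
  simp only [Indep, pieces_mul, Multiset.mem_add]
  grind

lemma indep_letter_left {a : V} {x : Heap G} :
    Indep (letter G a) x ↔ ∀ b ∈ x.pieces, a ≠ b ∧ ¬ G.Adj a b := by
  simp [Indep]

lemma letter_mul_comm {a b : V} (h : ¬ G.Adj a b) :
    letter G a * letter G b = letter G b * letter G a :=
  (Con.eq (heapCon G)).2 (ConGen.Rel.of _ _ ⟨a, b, h, rfl, rfl⟩)

lemma Indep.mul_comm {x y : Heap G} (h : Indep x y) : x * y = y * x := by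
  have key : ∀ (a : V) (y : Heap G), Indep (letter G a) y → letter G a * y = y * letter G a := by
    intro a y
    induction y using induction_letter with
    | one => simp
    | letter_mul b y ih =>
      intro h
      rw [indep_mul_right] at h
      rw [← mul_assoc, letter_mul_comm (h.1 a (by simp) b (by simp)).2, mul_assoc, ih h.2, mul_assoc]
  induction x using induction_letter with
  | one => simp
  | letter_mul a x ih =>
    rw [indep_mul_left] at h
    rw [mul_assoc, ih h.2, ← mul_assoc, key a y h.1, mul_assoc]

lemma Indep.self_eq_one {x y z : Heap G} (h : Indep x y) (hx : ∀ a ∈ z.pieces, a ∈ x.pieces)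
    (hy : ∀ a ∈ z.pieces, a ∈ y.pieces) : z = 1 := by
  rw [← pieces_eq_zero]
  refine Multiset.eq_zero_of_forall_notMem fun a ha => ?_
  exact (h a (hx a ha) a (hy a ha)).1 rfl

/-! ### Removing a first letter -/

open Classical in
/-- Remove the letter `a` from the front of a word, if it can be moved there. -/
def popWord (a : V) : List V → Option (Heap G)
  | [] => none
  | b :: w =>
    if a = b then some (ofWord G w)
    else if G.Adj a b then none else (popWord a w).map (letter G b * ·)

-- The outcome depends on `w` only through its own outcome, its heap and its set of letters. This is
-- what makes `popCon` compatible with concatenation.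
open Classical in
lemma popWord_append (a : V) (w w' : List V) :
    popWord (G := G) a (w ++ w') = match popWord (G := G) a w with
      | some h => some (h * ofWord G w')
      | none => if ∀ b ∈ w, a ≠ b ∧ ¬ G.Adj a b then
          (popWord a w').map (ofWord G w * ·) else none := by
  induction w with
  | nil => simp [popWord]
  | cons b w ih =>
    simp only [List.cons_append, popWord]
    by_cases hab : a = b
    · simp [hab, ofWord_append]
    · by_cases hadj : G.Adj a b
      · simp [hab, hadj]
      · simp only [hab, hadj, if_false, ih]
        cases h : popWord (G := G) a w with
        | some k => simp [mul_assoc]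
        | none =>
          simp only [Option.map_none, List.forall_mem_cons]
          by_cases hw : ∀ b ∈ w, a ≠ b ∧ ¬ G.Adj a b
          · rw [if_pos hw, if_pos ⟨⟨hab, hadj⟩, hw⟩, Option.map_map]
            congr 1
            funext x
            simp [ofWord_cons, mul_assoc]
          · rw [if_neg hw, if_neg (fun h => hw h.2)]; rfl

lemma mem_iff_of_ofWord_eq {w w' : List V} (h : ofWord G w = ofWord G w') (b : V) :
    b ∈ w ↔ b ∈ w' := by
  have := congrArg pieces h
  rw [pieces_ofWord, pieces_ofWord] at this
  rw [← Multiset.mem_coe, this, Multiset.mem_coe]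

variable (G) in
/-- Words with the same heap and the same results under removal of first letters. -/
def popCon : Con (FreeMonoid V) where
  r w w' := ofWord G w.toList = ofWord G w'.toList ∧
    ∀ a, popWord (G := G) a w.toList = popWord a w'.toList
  iseqv := ⟨fun _ => ⟨rfl, fun _ => rfl⟩, fun h => ⟨h.1.symm, fun a => (h.2 a).symm⟩,
    fun h h' => ⟨h.1.trans h'.1, fun a => (h.2 a).trans (h'.2 a)⟩⟩
  mul' := by
    rintro w x y z ⟨h1, h2⟩ ⟨h3, h4⟩
    refine ⟨?_, fun a => ?_⟩
    · rw [FreeMonoid.toList_mul, FreeMonoid.toList_mul, ofWord_append, ofWord_append, h1, h3]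
    · rw [FreeMonoid.toList_mul, FreeMonoid.toList_mul, popWord_append, popWord_append, h2, h1, h3,
        h4]
      have hm : (∀ b ∈ w.toList, a ≠ b ∧ ¬ G.Adj a b) ↔ ∀ b ∈ x.toList, a ≠ b ∧ ¬ G.Adj a b :=
        forall_congr' fun b => by rw [mem_iff_of_ofWord_eq h1]
      cases popWord (G := G) a x.toList with
      | some k => rfl
      | none => dsimp only; split_ifs <;> tauto

/-- Because `popCon` is a congruence, checking the generating exchanges is enough for removal of a
first letter to descend from words to heaps. Cancellation rests on this. -/
lemma heapCon_le_popCon : heapCon G ≤ popCon G := by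
  refine Con.conGen_le.2 ?_
  rintro _ _ ⟨u, v, huv, rfl, rfl⟩
  refine ⟨letter_mul_comm huv, fun a => ?_⟩
  have hvu : ¬ G.Adj v u := fun h => huv h.symm
  simp only [FreeMonoid.toList_mul, FreeMonoid.toList_of, List.singleton_append, popWord]
  by_cases h1 : a = u
  · subst h1
    by_cases h2 : a = v
    · simp [h2]
    · simp only [if_true, if_neg h2, if_neg huv, Option.map_some, ofWord_nil, mul_one]; rfl
  · by_cases h2 : a = v
    · subst h2
      simp only [if_neg h1, if_true, if_neg hvu, Option.map_some, ofWord_nil, mul_one]; rfl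
    · simp only [if_neg h1, if_neg h2]
      split_ifs <;> simp

lemma popWord_congr {w w' : List V} (h : ofWord G w = ofWord G w') (a : V) :
    popWord (G := G) a w = popWord a w' :=
  (heapCon_le_popCon ((Con.eq (heapCon G)).1 h)).2 a

lemma popWord_cons_self (a : V) (w : List V) : popWord (G := G) a (a :: w) = some (ofWord G w) := by
  simp [popWord]

lemma eq_letter_mul_of_popWord {a : V} {w : List V} {h : Heap G} (hw : popWord a w = some h) :
    ofWord G w = letter G a * h := by
  induction w generalizing h with
  | nil => simp [popWord] at hw
  | cons b w ih =>
    simp only [popWord] at hw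
    split_ifs at hw with h1 h2
    · simp at hw; rw [ofWord_cons, h1, hw]
    · obtain ⟨k, hk, rfl⟩ := Option.map_eq_some_iff.1 hw
      rw [ofWord_cons, ih hk, ← mul_assoc, ← mul_assoc, letter_mul_comm h2]

lemma letter_mul_cancel {a : V} {x y : Heap G} (h : letter G a * x = letter G a * y) : x = y := by
  obtain ⟨w, rfl⟩ := ofWord_surjective x
  obtain ⟨w', rfl⟩ := ofWord_surjective y
  have := popWord_congr (w := a :: w) (w' := a :: w') h a
  simpa [popWord_cons_self] using this

/-- Levi's lemma for a single letter: the first piece `a` lies either in `y`, or in `z` after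
passing all of `y`. -/
lemma letter_mul_eq_mul {a : V} {x y z : Heap G} (h : letter G a * x = y * z) :
    (∃ y', y = letter G a * y' ∧ x = y' * z) ∨
      (Indep (letter G a) y ∧ ∃ z', z = letter G a * z' ∧ x = y * z') := by
  obtain ⟨w, rfl⟩ := ofWord_surjective x
  obtain ⟨u, rfl⟩ := ofWord_surjective y
  obtain ⟨v, rfl⟩ := ofWord_surjective z
  have := popWord_congr (w := a :: w) (w' := u ++ v) h a
  rw [popWord_cons_self, popWord_append] at this
  cases hu : popWord (G := G) a u with
  | some k =>
    rw [hu] at this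
    exact Or.inl ⟨k, eq_letter_mul_of_popWord hu, Option.some_injective _ this⟩
  | none =>
    rw [hu] at this
    dsimp only at this
    split_ifs at this with hind
    obtain ⟨k, hk, hk'⟩ := Option.map_eq_some_iff.1 this.symm
    refine Or.inr ⟨?_, k, eq_letter_mul_of_popWord hk, hk'.symm⟩
    rw [indep_letter_left, pieces_ofWord]
    exact hind

/-! ### Cancellation and Levi's lemma -/

lemma mul_left_cancel' {x y z : Heap G} (h : x * y = x * z) : y = z := by
  induction x using induction_letter with
  | one => simpa using h
  | letter_mul a x ih => exact ih (letter_mul_cancel (by simpa [mul_assoc] using h))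

/-- The pieces fall into four classes according to the factor containing them in each factorization.
The classes `u` and `v` appear in opposite orders in the two factorizations, so no piece of one can
be joined to a piece of the other. -/
theorem levi {x x' y y' : Heap G} (h : x * x' = y * y') :
    ∃ r u v s, x = r * u ∧ x' = v * s ∧ y = r * v ∧ y' = u * s ∧ Indep u v := by
  induction x using induction_letter generalizing y y' with
  | one => exact ⟨1, 1, y, y', by simp, by simpa using h, by simp, by simp, by simp⟩
  | letter_mul a x ih =>
    rw [mul_assoc] at h
    rcases letter_mul_eq_mul h with ⟨z, rfl, hz⟩ | ⟨hi, z, rfl, hz⟩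
    · obtain ⟨r, u, v, s, rfl, rfl, rfl, rfl, huv⟩ := ih hz
      exact ⟨letter G a * r, u, v, s, by simp [mul_assoc], rfl, by simp [mul_assoc], rfl, huv⟩
    · obtain ⟨r, u, v, s, rfl, rfl, rfl, rfl, huv⟩ := ih hz
      rw [indep_mul_right] at hi
      refine ⟨r, letter G a * u, v, s, ?_, rfl, rfl, by simp [mul_assoc], ?_⟩
      · rw [← mul_assoc, hi.1.mul_comm, mul_assoc]
      · rw [indep_mul_left]; exact ⟨hi.2, huv⟩

/-- In Levi's refinement the two middle factors have the same pieces and are independent, hence both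
are trivial. -/
lemma mul_right_cancel' {x y z : Heap G} (h : x * z = y * z) : x = y := by
  obtain ⟨r, u, v, s, rfl, h1, rfl, h2, huv⟩ := levi h
  have := congrArg pieces (h1.symm.trans h2)
  simp only [pieces_mul, add_left_inj] at this
  rw [huv.self_eq_one (z := u) (fun _ => id) (by simp [this]),
    huv.self_eq_one (z := v) (by simp [this]) (fun _ => id)]

/-! ### First letters -/

/-- `a` can be moved to the front of `x`. -/
def IsFirst (a : V) (x : Heap G) : Prop := ∃ y, x = letter G a * y

lemma IsFirst.mem_pieces {a : V} {x : Heap G} (h : IsFirst a x) : a ∈ x.pieces := by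
  obtain ⟨y, rfl⟩ := h; simp

lemma IsFirst.mul {a : V} {x : Heap G} (h : IsFirst a x) (y : Heap G) : IsFirst a (x * y) := by
  obtain ⟨z, rfl⟩ := h; exact ⟨z * y, by simp [mul_assoc]⟩

lemma not_isFirst_one (a : V) : ¬ IsFirst a (1 : Heap G) := fun h => by simpa using h.mem_pieces

lemma exists_isFirst {x : Heap G} (h : x ≠ 1) : ∃ a, IsFirst a x := by
  rcases eq_one_or_letter_mul x with h' | ⟨a, y, rfl⟩
  · exact (h h').elim
  · exact ⟨a, y, rfl⟩

lemma isFirst_mul {a : V} {x y : Heap G} :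
    IsFirst a (x * y) ↔ IsFirst a x ∨ (Indep (letter G a) x ∧ IsFirst a y) := by
  constructor
  · rintro ⟨z, hz⟩
    rcases letter_mul_eq_mul hz.symm with ⟨y', h, -⟩ | ⟨hi, z', h, -⟩
    · exact Or.inl ⟨y', h⟩
    · exact Or.inr ⟨hi, z', h⟩
  · rintro (h | ⟨hi, z, rfl⟩)
    · exact h.mul y
    · exact ⟨x * z, by rw [← mul_assoc, ← hi.mul_comm, mul_assoc]⟩

lemma isFirst_letter {a b : V} : IsFirst a (letter G b) ↔ a = b := by
  constructor
  · intro h; simpa using h.mem_pieces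
  · rintro rfl; exact ⟨1, by simp⟩

/-- All first letters of `x` equal `v`: the heap is empty or a pyramid with source `v`. -/
def FirstLE (v : V) (x : Heap G) : Prop := ∀ a, IsFirst a x → a = v

lemma firstLE_one (v : V) : FirstLE v (1 : Heap G) := fun a h => (not_isFirst_one a h).elim

lemma FirstLE.mul {v : V} {x y : Heap G} (hx : FirstLE v x) (hy : FirstLE v y) :
    FirstLE v (x * y) := fun a h => by
  rcases isFirst_mul.1 h with h | ⟨-, h⟩
  · exact hx a h
  · exact hy a h

lemma FirstLE.of_mul {v : V} {x y : Heap G} (h : FirstLE v (x * y)) : FirstLE v x :=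
  fun a ha => h a (ha.mul y)

lemma FirstLE.pow {v : V} {x : Heap G} (hx : FirstLE v x) (k : ℕ) : FirstLE v (x ^ k) := by
  induction k with
  | zero => simpa using firstLE_one v
  | succ k ih => rw [pow_succ]; exact ih.mul hx

lemma FirstLE.isFirst {v : V} {x : Heap G} (hx : FirstLE v x) (h : x ≠ 1) : IsFirst v x := by
  obtain ⟨a, ha⟩ := exists_isFirst h
  exact hx a ha ▸ ha

/-! ### Sources and pyramids -/

/-- Translates sources, which are positions in a word, into left divisibility by a letter. The
induction appends letters on the right because a new last letter creates no arrow into an earlier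
position. -/
lemma isFirst_ofWord {a : V} {w : List V} :
    IsFirst a (ofWord G w) ↔ ∃ i, IsSource G w i ∧ w[i]? = some a := by
  induction w using List.reverseRecOn with
  | nil => simp [not_isFirst_one, IsSource]
  | append_singleton w b ih =>
    have hold : ∀ i, i < w.length → (IsSource G (w ++ [b]) i ↔ IsSource G w i) := by
      intro i hi
      have harr : ∀ j, Arrow G (w ++ [b]) j i ↔ Arrow G w j i := by
        intro j
        refine and_congr_right fun hj => ?_
        rw [List.getElem?_append_left (by omega), List.getElem?_append_left hi]
      simp only [IsSource, harr, hi, List.length_append, true_and]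
      exact ⟨fun h => h.2, fun h => ⟨by simp; omega, h⟩⟩
    have hnew : IsSource G (w ++ [b]) w.length ↔ Indep (letter G b) (ofWord G w) := by
      rw [indep_letter_left, pieces_ofWord]
      simp only [IsSource, Arrow, List.length_append, List.length_singleton, Nat.lt_succ_self,
        true_and, not_and, not_exists]
      constructor
      · intro h c hc
        obtain ⟨j, hj, rfl⟩ := List.getElem_of_mem (Multiset.mem_coe.1 hc)
        have := h j hj (w[j]) b (by rw [List.getElem?_append_left hj]; simp) (by simp)
        grind [SimpleGraph.adj_comm]
      · intro h j hj c d hc hd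
        rw [List.getElem?_append_left hj] at hc
        have hcw : c ∈ w := List.mem_of_getElem? hc
        have := h c (by simpa using hcw)
        have hd' : b = d := by simpa using hd
        subst hd'
        grind [SimpleGraph.adj_comm]
    rw [ofWord_append, isFirst_mul, ih]
    change _ ∨ _ ∧ IsFirst a (letter G b) ↔ _
    rw [isFirst_letter]
    constructor
    · rintro (⟨i, hi, ha⟩ | ⟨hi, rfl⟩)
      · exact ⟨i, (hold i hi.1).2 hi, by rw [List.getElem?_append_left hi.1, ha]⟩
      · exact ⟨w.length, hnew.2 hi, by simp⟩
    · rintro ⟨i, hi, ha⟩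
      have hlt : i < w.length + 1 := by simpa using hi.1
      rcases Nat.lt_succ_iff_lt_or_eq.1 hlt with h | rfl
      · exact Or.inl ⟨i, (hold i h).1 hi, by rwa [List.getElem?_append_left h] at ha⟩
      · have : a = b := by simpa [eq_comm] using ha
        subst this
        exact Or.inr ⟨hnew.1 hi, rfl⟩

lemma source_unique {w : List V} {i j : ℕ} {a : V} (hi : IsSource G w i) (hj : IsSource G w j)
    (ha : w[i]? = some a) (hb : w[j]? = some a) : i = j := by
  rcases lt_trichotomy i j with h | h | h
  · exact (hj.2 i ⟨h, a, a, ha, hb, Or.inl rfl⟩).elim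
  · exact h
  · exact (hi.2 j ⟨h, a, a, hb, ha, Or.inl rfl⟩).elim

/-- The algebraic form of being a pyramid, free of words. Equal letters are joined, so distinct
sources carry distinct letters and one possible first letter means one source. -/
theorem isPyramid_iff {H : Heap G} : H.IsPyramid ↔ H ≠ 1 ∧ ∃ v, FirstLE v H := by
  constructor
  · rintro ⟨w, rfl, i, hi, huniq⟩
    have hw : w ≠ [] := fun h => by simp [h, IsSource] at hi
    refine ⟨fun h => ?_, w[i]'hi.1, fun a ha => ?_⟩
    · have := congrArg size h
      rw [size_ofWord] at this
      simp [hw] at this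
    · obtain ⟨j, hj, hja⟩ := isFirst_ofWord.1 ha
      obtain rfl := huniq j hj
      rw [List.getElem?_eq_getElem hi.1] at hja
      exact (Option.some_injective _ hja).symm
  · rintro ⟨h, v, hv⟩
    obtain ⟨w, rfl⟩ := ofWord_surjective H
    obtain ⟨i, hi, hiv⟩ := isFirst_ofWord.1 (hv.isFirst h)
    refine ⟨w, rfl, i, hi, fun j hj => ?_⟩
    have hja := List.getElem?_eq_getElem hj.1
    have := hv _ (isFirst_ofWord.2 ⟨j, hj, hja⟩)
    exact source_unique hj hi (by rw [hja, this]) hiv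

lemma IsPyramid.ne_one {H : Heap G} (h : H.IsPyramid) : H ≠ 1 := (isPyramid_iff.1 h).1

lemma IsPyramid.of_mul {x y : Heap G} (h : (x * y).IsPyramid) (hx : x ≠ 1) : x.IsPyramid := by
  obtain ⟨-, v, hv⟩ := isPyramid_iff.1 h
  exact isPyramid_iff.2 ⟨hx, v, hv.of_mul⟩

lemma IsPyramid.eq_of_isFirst {H : Heap G} (h : H.IsPyramid) {a b : V} (ha : IsFirst a H)
    (hb : IsFirst b H) : a = b := by
  obtain ⟨-, v, hv⟩ := isPyramid_iff.1 h
  rw [hv a ha, hv b hb]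

lemma isPyramid_letter (a : V) : (letter G a).IsPyramid :=
  isPyramid_iff.2 ⟨fun h => by simpa using congrArg size h, a, fun _ hb => isFirst_letter.1 hb⟩

end Heap

end Heaps

end Kromatic

end

/-! ### Pieces as pyramidal right factors, and the effect of `A_p` on words. -/

noncomputable section

namespace Kromatic

section Heaps

variable {V : Type*} {G : SimpleGraph V}

namespace Heap

/-! ### Splitting off a pyramid -/

@[elab_as_elim]
lemma induction_mul_letter {p : Heap G → Prop} (one : p 1)
    (mul_letter : ∀ a H, p H → p (H * letter G a)) (H : Heap G) : p H := by
  obtain ⟨w, rfl⟩ := ofWord_surjective H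
  induction w using List.reverseRecOn with
  | nil => exact one
  | append_singleton w a ih => exact mul_letter a _ ih

lemma IsPyramid.mul_letter {x : Heap G} (hx : x.IsPyramid) {b : V} (hb : ¬ Indep (letter G b) x) :
    (x * letter G b).IsPyramid := by
  obtain ⟨h1, v, hv⟩ := isPyramid_iff.1 hx
  refine isPyramid_iff.2 ⟨fun h => h1 (eq_one_of_mul_eq_one h).1, v, fun a ha => ?_⟩
  rcases isFirst_mul.1 ha with h | ⟨hi, h⟩
  · exact hv a h
  · rw [isFirst_letter] at h
    exact (hb (h ▸ hi)).elim

/-- In `u ∘ r`, the pieces of `r` reachable from the source of `u` form `d`, and the others can be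
moved in front. A new last letter joins `d` if it touches `u ∘ d`; otherwise it commutes past `d`
into `r'`. -/
lemma exists_split {u : Heap G} (hu : u.IsPyramid) (r : Heap G) :
    ∃ r' d, r = r' * d ∧ Indep r' u ∧ (u * d).IsPyramid := by
  induction r using induction_mul_letter with
  | one => exact ⟨1, 1, by simp, by simp, by simpa using hu⟩
  | mul_letter b r ih =>
    obtain ⟨r', d, rfl, hi, hp⟩ := ih
    by_cases hb : Indep (letter G b) (u * d)
    · refine ⟨r' * letter G b, d, ?_, ?_, hp⟩
      · rw [indep_mul_right] at hb
        rw [mul_assoc, mul_assoc, hb.2.mul_comm]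
      · rw [indep_mul_left]; exact ⟨hi, (indep_mul_right.1 hb).1⟩
    · exact ⟨r', d * letter G b, by simp [mul_assoc], hi, by
        rw [← mul_assoc]; exact hp.mul_letter hb⟩

/-- A nontrivial `y` could be moved to the front past `u`, and would supply a second source. -/
lemma eq_one_of_indep_of_isPyramid {u y s : Heap G} (hu : u ≠ 1) (hy : Indep y u)
    (hp : (u * (y * s)).IsPyramid) : y = 1 := by
  by_contra h
  obtain ⟨a, ha⟩ := exists_isFirst h
  obtain ⟨b, hb⟩ := exists_isFirst hu
  have hab : a = b := by
    refine hp.eq_of_isFirst ?_ (hb.mul _)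
    rw [← mul_assoc, ← hy.mul_comm, mul_assoc]
    exact ha.mul _
  exact (hy a ha.mem_pieces b hb.mem_pieces).1 hab

lemma split_unique {u r d r' d' : Heap G} (hu : u ≠ 1) (h : r * d = r' * d') (hr : Indep r u)
    (hr' : Indep r' u) (hd : (u * d).IsPyramid) (hd' : (u * d').IsPyramid) : r = r' ∧ d = d' := by
  obtain ⟨x, y, y', s, rfl, rfl, rfl, rfl, -⟩ := levi h
  rw [indep_mul_left] at hr hr'
  obtain rfl := eq_one_of_indep_of_isPyramid hu hr.2 hd'
  obtain rfl := eq_one_of_indep_of_isPyramid hu hr'.2 hd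
  simp

variable (G) in
/-- The factorizations of a heap whose second factor is a pyramid; they correspond to its pieces. -/
def markings (H : Heap G) : Set (Heap G × Heap G) := {x | x.1 * x.2 = H ∧ x.2.IsPyramid}

/-- Adding a piece `a` in front of `H` keeps the pyramids of the old pieces, since none of them lies
below `a`. It creates exactly one new factorization, whose pyramid is the one generated by `a`. -/
lemma encard_markings (H : Heap G) : (markings G H).encard = H.size := by
  induction H using induction_letter with
  | one =>
    have : markings G 1 = ∅ := by
      ext ⟨U, P⟩
      simp only [markings, Set.mem_ofPred_eq, Set.mem_empty_iff_false, iff_false]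
      rintro ⟨h, hP⟩
      exact hP.ne_one (eq_one_of_mul_eq_one h).2
    simp [this]
  | letter_mul a H ih =>
    have ha : letter G a ≠ 1 := (isPyramid_letter a).ne_one
    obtain ⟨r, d, rfl, hr, hd⟩ := exists_split (isPyramid_letter a) H
    have key : markings G (letter G a * (r * d)) = insert (r, letter G a * d)
        ((fun x : Heap G × Heap G => (letter G a * x.1, x.2)) '' markings G (r * d)) := by
      ext ⟨U, P⟩
      simp only [markings, Set.mem_ofPred_eq, Set.mem_insert_iff, Prod.mk.injEq, Set.mem_image,
        Prod.exists]
      constructor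
      · rintro ⟨h, hP⟩
        rcases letter_mul_eq_mul h.symm with ⟨U', rfl, h'⟩ | ⟨hi, P', rfl, h'⟩
        · exact Or.inr ⟨U', P, ⟨h'.symm, hP⟩, rfl, rfl⟩
        · obtain ⟨rfl, rfl⟩ := split_unique ha h' hr hi.symm hd hP
          exact Or.inl ⟨rfl, rfl⟩
      · rintro (⟨rfl, rfl⟩ | ⟨U', P', ⟨h, hP⟩, rfl, rfl⟩)
        · exact ⟨by rw [← mul_assoc, hr.mul_comm, mul_assoc], hd⟩
        · exact ⟨by rw [mul_assoc, h], hP⟩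
    rw [key, Set.encard_insert_of_notMem, Function.Injective.encard_image, ih]
    · simp [add_comm]
    · rintro ⟨U, P⟩ ⟨U', P'⟩ h
      simp only [Prod.mk.injEq] at h
      simp [letter_mul_cancel h.1, h.2]
    · rintro ⟨⟨U, P⟩, -, h⟩
      simp only [Prod.mk.injEq] at h
      rw [← h.1] at hr
      exact (hr a (by simp) a (by simp)).1 rfl

/-! ### The operation `A_p` on words -/

lemma le_of_reach {w : List V} {p j : ℕ} (h : Reach G w p j) : p ≤ j := by
  induction h with
  | refl => exact le_rfl
  | tail _ h ih => exact ih.trans h.1.le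

lemma arrow_append {w : List V} {b : V} {i j : ℕ} (hj : j < w.length) :
    Arrow G (w ++ [b]) i j ↔ Arrow G w i j := by
  refine and_congr_right fun hi => ?_
  rw [List.getElem?_append_left (by omega), List.getElem?_append_left hj]

lemma reach_append {w : List V} {b : V} {p j : ℕ} (hj : j < w.length) :
    Reach G (w ++ [b]) p j ↔ Reach G w p j := by
  constructor
  · intro h
    induction h with
    | refl => exact Relation.ReflTransGen.refl
    | tail _ h ih => exact (ih (h.1.trans hj)).tail ((arrow_append hj).1 h)
  · intro h
    induction h with
    | refl => exact Relation.ReflTransGen.refl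
    | tail _ h ih => exact (ih (h.1.trans hj)).tail ((arrow_append hj).2 h)

lemma mem_upperWord {w : List V} {p : ℕ} {c : V} :
    c ∈ upperWord G w p ↔ ∃ i, w[i]? = some c ∧ Reach G w p i := by
  simp [upperWord, List.mem_zipIdx_iff_getElem?]

lemma reach_length_append {w : List V} {b : V} {p : ℕ} (hp : p < w.length) :
    Reach G (w ++ [b]) p w.length ↔ ∃ c ∈ upperWord G w p, c = b ∨ G.Adj c b := by
  constructor
  · intro h
    rcases Relation.ReflTransGen.cases_tail h with h | ⟨k, hk, hkl⟩
    · omega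
    · obtain ⟨hlt, c, d, hc, hd, hcd⟩ := hkl
      have : b = d := by simpa using hd
      subst this
      rw [List.getElem?_append_left hlt] at hc
      exact ⟨c, mem_upperWord.2 ⟨k, hc, (reach_append hlt).1 hk⟩, hcd⟩
  · rintro ⟨c, hc, hcb⟩
    obtain ⟨i, hi, hr⟩ := mem_upperWord.1 hc
    have hlt : i < w.length := (List.getElem?_eq_some_iff.1 hi).1
    refine ((reach_append hlt).2 hr).tail ⟨hlt, c, b, ?_, by simp, hcb⟩
    rw [List.getElem?_append_left hlt, hi]

lemma filter_zipIdx_append (w : List V) (b : V) (P Q : ℕ → Bool)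
    (h : ∀ i < w.length, P i = Q i) :
    (((w ++ [b]).zipIdx.filter fun x => P x.2).map Prod.fst) =
      ((w.zipIdx.filter fun x => Q x.2).map Prod.fst) ++ if P w.length then [b] else [] := by
  rw [List.zipIdx_append, List.filter_append, List.map_append]
  congr 1
  · congr 1
    refine List.filter_congr fun x hx => h _ ?_
    have := List.mem_zipIdx_iff_getElem?.1 hx
    exact (List.getElem?_eq_some_iff.1 this).1
  · by_cases hP : P w.length <;> simp [hP]

open Classical in
lemma upperWord_append {w : List V} {b : V} {p : ℕ} (hp : p < w.length) :
    upperWord G (w ++ [b]) p = upperWord G w p ++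
      if ∃ c ∈ upperWord G w p, c = b ∨ G.Adj c b then [b] else [] := by
  have := filter_zipIdx_append w b (fun i => decide (Reach G (w ++ [b]) p i))
    (fun i => decide (Reach G w p i)) (fun i hi => by simp only [reach_append hi])
  rw [upperWord, this, ← upperWord]
  simp only [decide_eq_true_eq, reach_length_append hp]

open Classical in
lemma lowerWord_append {w : List V} {b : V} {p : ℕ} (hp : p < w.length) :
    lowerWord G (w ++ [b]) p = lowerWord G w p ++
      if ∃ c ∈ upperWord G w p, c = b ∨ G.Adj c b then [] else [b] := by
  have := filter_zipIdx_append w b (fun i => decide (¬ Reach G (w ++ [b]) p i))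
    (fun i => decide (¬ Reach G w p i)) (fun i hi => by simp only [reach_append hi])
  rw [lowerWord, this, ← lowerWord]
  simp only [decide_eq_true_eq, reach_length_append hp, ite_not]

lemma upperWord_last (w : List V) (a : V) : upperWord G (w ++ [a]) w.length = [a] := by
  classical
  have := filter_zipIdx_append w a (fun i => decide (Reach G (w ++ [a]) w.length i))
    (fun _ => false) (fun i hi => by
      simp only [decide_eq_false_iff_not]; exact fun h => by have := le_of_reach h; omega)
  rw [upperWord, this]
  have h : Reach G (w ++ [a]) w.length w.length := Relation.ReflTransGen.refl
  simp [h]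

lemma lowerWord_last (w : List V) (a : V) : lowerWord G (w ++ [a]) w.length = w := by
  classical
  have := filter_zipIdx_append w a (fun i => decide (¬ Reach G (w ++ [a]) w.length i))
    (fun _ => true) (fun i hi => by
      simp only [decide_eq_true_eq]; exact fun h => by have := le_of_reach h; omega)
  rw [lowerWord, this]
  have h : Reach G (w ++ [a]) w.length w.length := Relation.ReflTransGen.refl
  simp [h]

/-- The words of the two parts into which a marked piece divides a heap. -/
theorem exists_lowerWord_upperWord (pre : List V) (a : V) (t : List V) :
    ∃ lo R, lowerWord G (pre ++ a :: t) pre.length = pre ++ lo ∧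
      upperWord G (pre ++ a :: t) pre.length = a :: R ∧
      ofWord G (a :: t) = ofWord G lo * ofWord G (a :: R) ∧
      Indep (ofWord G lo) (letter G a) ∧ (ofWord G (a :: R)).IsPyramid := by
  classical
  induction t using List.reverseRecOn with
  | nil => exact ⟨[], [], by simp [lowerWord_last], by simp [upperWord_last], by simp, by simp,
      isPyramid_letter a⟩
  | append_singleton t b ih =>
    obtain ⟨lo, R, h1, h2, h3, h4, h5⟩ := ih
    have hlen : pre.length < (pre ++ a :: t).length := by simp
    have hw : pre ++ a :: (t ++ [b]) = (pre ++ a :: t) ++ [b] := by simp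
    have hdep : (∃ c ∈ a :: R, c = b ∨ G.Adj c b) ↔ ¬ Indep (letter G b) (ofWord G (a :: R)) := by
      rw [indep_letter_left, pieces_ofWord]
      simp only [Multiset.mem_coe]
      push Not
      refine exists_congr fun c => and_congr_right fun _ => ?_
      rw [SimpleGraph.adj_comm]
      tauto
    have h3' : ofWord G (a :: (t ++ [b])) = ofWord G lo * ofWord G (a :: R) * letter G b := by
      rw [← h3, ← List.cons_append, ofWord_append]; rfl
    rw [hw, lowerWord_append hlen, upperWord_append hlen, h1, h2]
    by_cases h : Indep (letter G b) (ofWord G (a :: R))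
    · rw [if_neg (by rw [hdep]; exact not_not.2 h), if_neg (by rw [hdep]; exact not_not.2 h)]
      refine ⟨lo ++ [b], R, by simp, by simp, ?_, ?_, h5⟩
      · rw [h3', ofWord_append, mul_assoc, ← h.mul_comm, mul_assoc]; rfl
      · rw [ofWord_append, indep_mul_left]
        refine ⟨h4, ?_⟩
        rw [ofWord_cons, indep_mul_right] at h
        exact h.1
    · rw [if_pos (hdep.2 h), if_pos (hdep.2 h)]
      refine ⟨lo, R ++ [b], by simp, by simp, ?_, h4, ?_⟩
      · rw [h3', ← List.cons_append, ofWord_append, mul_assoc]; rfl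
      · rw [← List.cons_append, ofWord_append]
        exact h5.mul_letter h

end Heap

end Heaps

end Kromatic

end

/-! ### Roots, conjugacy and rotations of pyramids. -/

noncomputable section

namespace Kromatic

section Heaps

variable {V : Type*} {G : SimpleGraph V}

namespace Heap

/-! ### Pyramids with a common source -/

/-- If both middle factors of Levi's lemma were nontrivial, both would contain the letter `v`,
against their independence. So one is trivial, and `x`, `y` are comparable as prefixes of a word
are. -/
lemma levi_of_firstLE {v : V} {x x' y y' : Heap G} (h : x * x' = y * y') (hx : FirstLE v x')
    (hy : FirstLE v y') :
    (∃ w, FirstLE v w ∧ y = x * w ∧ x' = w * y') ∨ (∃ w, FirstLE v w ∧ x = y * w ∧ y' = w * x') := by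
  obtain ⟨r, s, t, q, rfl, rfl, rfl, rfl, hi⟩ := levi h
  by_cases hs : s = 1
  · subst hs
    exact Or.inl ⟨t, hx.of_mul, by simp, by simp⟩
  by_cases ht : t = 1
  · subst ht
    exact Or.inr ⟨s, hy.of_mul, by simp, by simp⟩
  have h1 := (hy.of_mul.isFirst hs).mem_pieces
  have h2 := (hx.of_mul.isFirst ht).mem_pieces
  exact ((hi v h1 v h2).1 rfl).elim

/-- As for commuting words: the shorter heap is a left factor of the longer one, and cancelling it
runs the Euclidean algorithm on sizes. -/
lemma exists_pow_of_commute {v : V} {x y : Heap G} (hx : FirstLE v x) (hy : FirstLE v y)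
    (h : x * y = y * x) : ∃ (t : Heap G) (i j : ℕ), x = t ^ i ∧ y = t ^ j := by
  induction hn : x.size + y.size using Nat.strong_induction_on generalizing x y with
  | _ n ih =>
    by_cases hx1 : x = 1
    · exact ⟨y, 0, 1, by simp [hx1], by simp⟩
    by_cases hy1 : y = 1
    · exact ⟨x, 1, 0, by simp, by simp [hy1]⟩
    have hxs := size_pos hx1
    have hys := size_pos hy1
    rcases levi_of_firstLE h hy hx with ⟨w, hw, rfl, -⟩ | ⟨w, hw, rfl, -⟩
    · have h' : x * w = w * x := mul_left_cancel' (x := x) (by simpa [mul_assoc] using h)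
      obtain ⟨t, i, j, rfl, rfl⟩ := ih _ (by rw [size_mul] at hn; omega) hx hw h' rfl
      exact ⟨t, i, i + j, rfl, by rw [pow_add]⟩
    · have h' : w * y = y * w := mul_left_cancel' (x := y) (by simpa [mul_assoc] using h)
      obtain ⟨t, i, j, rfl, rfl⟩ := ih _ (by rw [size_mul] at hn; omega) hw hy h' rfl
      exact ⟨t, j + i, j, by rw [pow_add], rfl⟩

lemma eq_pow_of_commute {v : V} {K x : Heap G} (hK1 : K ≠ 1) (hK : FirstLE v K)
    (hper : ¬ K.IsPeriodic) (hx : FirstLE v x) (h : x * K = K * x) : ∃ j : ℕ, x = K ^ j := by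
  obtain ⟨t, j, i, rfl, rfl⟩ := exists_pow_of_commute hx hK h
  rcases i with _ | _ | i
  · simp at hK1
  · exact ⟨j, by simp⟩
  · exact (hper ⟨t, i + 2, by omega, rfl⟩).elim

/-- Both `x` and `x * K` are left factors of a high power of `K`. Then `x * K` and `K * x` are left
factors of the next power; they are comparable and of equal size, hence equal. -/
lemma commute_of_commute_pow {v : V} {K x : Heap G} (hK1 : K ≠ 1) (hK : FirstLE v K)
    (hx : FirstLE v x) {a : ℕ} (ha : 0 < a) (h : x * K ^ a = K ^ a * x) : x * K = K * x := by
  obtain ⟨m, hm, hcomm⟩ : ∃ m, x.size < m ∧ x * K ^ m = K ^ m * x := by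
    -- A multiple of `a` keeps the commutation; the factor `x.size + 1` makes the power of `K`
    -- larger than `x`.
    refine ⟨a * (x.size + 1), by nlinarith, ?_⟩
    rw [pow_mul]
    exact Commute.pow_right (M := Heap G) h _
  have hKs := size_pos hK1
  obtain ⟨y, hy, hxy⟩ : ∃ y, FirstLE v y ∧ K ^ m = x * y := by
    rcases levi_of_firstLE hcomm (hK.pow m) hx with ⟨w, hw, h1, -⟩ | ⟨w, hw, h1, -⟩
    · exact ⟨w, hw, h1⟩
    · have := congrArg size h1
      simp only [size_pow, size_mul] at this
      nlinarith
  obtain ⟨y', hy', hxy'⟩ : ∃ y, FirstLE v y ∧ K ^ m = x * K * y := by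
    obtain ⟨m, rfl⟩ : ∃ m', m = m' + 1 := ⟨m - 1, by omega⟩
    have h1 : (x * K) * K ^ m = K ^ (m + 1) * x := by rw [mul_assoc, ← pow_succ', hcomm]
    rcases levi_of_firstLE h1 (hK.pow m) hx with ⟨w, hw, h1, -⟩ | ⟨w, hw, h1, -⟩
    · exact ⟨w, hw, h1⟩
    · have h2 := congrArg size h1
      simp only [size_pow, size_mul] at h2
      have hw : w = 1 := size_eq_zero.1 (by nlinarith)
      exact ⟨1, firstLE_one v, by rw [h1, hw]; simp⟩
  have h1 : (x * K) * (y' * K) = (K * x) * y := by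
    rw [← mul_assoc, ← hxy', ← pow_succ, pow_succ', hxy, mul_assoc]
  rcases levi_of_firstLE h1 (hy'.mul hK) hy with ⟨w, -, h2, -⟩ | ⟨w, -, h2, -⟩ <;>
  · have h3 := congrArg size h2
    simp only [size_mul] at h3
    obtain rfl : w = 1 := size_eq_zero.1 (by omega)
    simpa [eq_comm] using h2

/-- A pyramid has only one aperiodic root. -/
theorem root_unique {v : V} {K K' : Heap G} (hK1 : K ≠ 1) (hK1' : K' ≠ 1) (hK : FirstLE v K)
    (hK' : FirstLE v K') (hper : ¬ K.IsPeriodic) (hper' : ¬ K'.IsPeriodic) {a b : ℕ} (ha : 0 < a)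
    (h : K ^ a = K' ^ b) : K = K' := by
  have h1 : K' * K = K * K' := by
    refine commute_of_commute_pow hK1 hK hK' ha ?_
    rw [h, pow_mul_comm']
  obtain ⟨j, hj⟩ := eq_pow_of_commute hK1 hK hper hK' h1
  rcases j with _ | _ | j
  · exact (hK1' (by simpa using hj)).elim
  · simpa using hj.symm
  · exact (hper' ⟨K, j + 2, by omega, hj⟩).elim

lemma exists_root {P : Heap G} (hP : P.IsPyramid) :
    ∃ (K : Heap G) (k : ℕ), K.IsPyramid ∧ ¬ K.IsPeriodic ∧ 0 < k ∧ P = K ^ k := by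
  induction hn : P.size using Nat.strong_induction_on generalizing P with
  | _ n ih =>
    by_cases hper : P.IsPeriodic
    · obtain ⟨K, k, hk, rfl⟩ := hper
      have hK1 : K ≠ 1 := by rintro rfl; exact hP.ne_one (by simp)
      have hKs := size_pos hK1
      have hK : K.IsPyramid := by
        obtain ⟨k, rfl⟩ : ∃ k', k = k' + 1 := ⟨k - 1, by omega⟩
        rw [pow_succ'] at hP
        exact hP.of_mul hK1
      obtain ⟨K', k', h1, h2, h3, rfl⟩ := ih K.size (by rw [← hn, size_pow]; nlinarith) hK rfl
      exact ⟨K', k' * k, h1, h2, by positivity, by rw [pow_mul]⟩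
    · exact ⟨P, 1, hP, hper, one_pos, by simp⟩

lemma IsPyramid.pow {K : Heap G} (hK : K.IsPyramid) {k : ℕ} (hk : 0 < k) : (K ^ k).IsPyramid := by
  obtain ⟨h1, v, hv⟩ := isPyramid_iff.1 hK
  refine isPyramid_iff.2 ⟨fun h => ?_, v, hv.pow k⟩
  have := congrArg size h
  have := size_pos h1
  simp only [size_pow, size_one, mul_eq_zero] at *
  omega

/-! ### Conjugacy -/

/-- Conjugacy of heaps, by factors of a common power. -/
def Conj (P Q : Heap G) : Prop :=
  ∃ (z y : Heap G) (k : ℕ), z * y = P ^ k ∧ y * z = Q ^ k ∧ P * z = z * Q ∧ Q * y = y * P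

lemma Conj.refl (P : Heap G) : Conj P P := ⟨1, 1, 0, by simp, by simp, by simp, by simp⟩

lemma Conj.symm {P Q : Heap G} : Conj P Q → Conj Q P := by
  rintro ⟨z, y, k, h1, h2, h3, h4⟩; exact ⟨y, z, k, h2, h1, h4, h3⟩

lemma mul_pow_eq_of_mul_eq {P Q z : Heap G} (h : P * z = z * Q) (k : ℕ) :
    z * Q ^ k = P ^ k * z := by
  have h' : SemiconjBy (M := Heap G) z Q P := h.symm
  exact h'.pow_right k

lemma Conj.trans {P Q R : Heap G} : Conj P Q → Conj Q R → Conj P R := by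
  rintro ⟨z, y, k, h1, h2, h3, h4⟩ ⟨z', y', k', h1', h2', h3', h4'⟩
  refine ⟨z * z', y' * y, k + k', ?_, ?_, ?_, ?_⟩
  · rw [mul_assoc, ← mul_assoc z', h1', ← mul_assoc, mul_pow_eq_of_mul_eq h3, mul_assoc, h1, add_comm,
      pow_add]
  · rw [mul_assoc, ← mul_assoc y, h2, ← mul_assoc, mul_pow_eq_of_mul_eq h4', mul_assoc, h2', pow_add]
  · rw [← mul_assoc, h3, mul_assoc, h3', mul_assoc]
  · rw [← mul_assoc, h4', mul_assoc, h4, mul_assoc]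

lemma Conj.mul_comm (x y : Heap G) : Conj (x * y) (y * x) :=
  ⟨x, y, 1, by simp, by simp, by simp [mul_assoc], by simp [mul_assoc]⟩

lemma Conj.pieces_eq {P Q : Heap G} : Conj P Q → P.pieces = Q.pieces := by
  rintro ⟨z, y, k, -, -, h, -⟩
  have := congrArg pieces h
  rw [pieces_mul, pieces_mul, add_comm] at this
  exact add_left_cancel this

lemma Conj.size_eq {P Q : Heap G} (h : Conj P Q) : P.size = Q.size := by
  rw [size, size, h.pieces_eq]

/-- If `Q = R ^ k` with `k > 1`, conjugating `R` back gives `z * R * y`, which commutes with the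
aperiodic `P` and so is a power of it. Its size is `j * |P| + |R|` with `0 < |R| < |P|`, which is
not a multiple of `|P|`. -/
lemma Conj.not_isPeriodic {P Q : Heap G} (hP : P.IsPyramid) (hper : ¬ P.IsPeriodic)
    (h : Conj P Q) : ¬ Q.IsPeriodic := by
  rintro ⟨R, k, hk, rfl⟩
  have hsize := h.size_eq
  obtain ⟨z, y, j, h1, h2, h3, h4⟩ := h
  obtain ⟨hP1, v, hv⟩ := isPyramid_iff.1 hP
  have hz : FirstLE v z := FirstLE.of_mul (y := y) (h1 ▸ hv.pow j)
  have hcomm : (z * R * y) * P = P * (z * R * y) := by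
    rw [mul_assoc, ← h4, ← mul_assoc, mul_assoc z, ← pow_succ', pow_succ, ← mul_assoc z, ← h3]
    simp only [mul_assoc]
  have hfirst : FirstLE v (z * R * y) := by
    -- Exhibits `z * R * y` as a left factor of a heap whose only possible source is `v`.
    have h5 : z * R * y * (z * R ^ (k - 1)) = P ^ (j + 1) * z := by
      rw [← mul_pow_eq_of_mul_eq h3, mul_assoc _ y, ← mul_assoc y, h2]
      simp only [mul_assoc, ← pow_mul, ← pow_add, ← pow_succ']
      congr 2
      obtain ⟨k, rfl⟩ : ∃ k', k = k' + 1 := ⟨k - 1, by omega⟩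
      simp; ring
    exact FirstLE.of_mul (h5 ▸ (hv.pow (j + 1)).mul hz)
  obtain ⟨i, hi⟩ := eq_pow_of_commute hP1 hv hper hfirst hcomm
  have s1 := congrArg size h1
  have s2 := congrArg size hi
  have s3 := size_pos hP1
  simp only [size_mul, size_pow] at s1 s2 hsize
  have s4 : R.size + j * P.size = i * P.size := by omega
  have s5 : R.size < P.size := by nlinarith [Nat.pos_of_ne_zero (n := R.size) (by
    rintro h; rw [h] at hsize; omega)]
  have s6 : j < i := by by_contra! hh; nlinarith [Nat.mul_le_mul_right P.size hh]
  nlinarith [Nat.mul_le_mul_right P.size (Nat.succ_le_of_lt s6)]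

/-! ### Connectedness of pyramids -/

variable (G) in
/-- The multiset of vertices is not a union of two nonempty independent parts. -/
def Connected (m : Multiset V) : Prop :=
  ∀ s t : Multiset V, m = s + t → (∀ a ∈ s, ∀ b ∈ t, a ≠ b ∧ ¬ G.Adj a b) → s = 0 ∨ t = 0

lemma exists_mul_of_pieces_eq_add {H : Heap G} {s t : Multiset V} (h : H.pieces = s + t)
    (hi : ∀ a ∈ s, ∀ b ∈ t, a ≠ b ∧ ¬ G.Adj a b) :
    ∃ x y, H = x * y ∧ x.pieces = s ∧ y.pieces = t := by
  induction H using induction_letter generalizing s t with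
  | one =>
    obtain ⟨rfl, rfl⟩ := add_eq_zero.1 (pieces_one.symm.trans h).symm
    exact ⟨1, 1, by simp, by simp, by simp⟩
  | letter_mul a H ih =>
    rw [pieces_mul, pieces_letter, Multiset.singleton_add] at h
    have ha : a ∈ s + t := h ▸ Multiset.mem_cons_self a _
    rcases Multiset.mem_add.1 ha with ha | ha
    · obtain ⟨s, rfl⟩ := Multiset.exists_cons_of_mem ha
      rw [Multiset.cons_add, Multiset.cons_inj_right] at h
      obtain ⟨x, y, rfl, rfl, rfl⟩ := ih h fun a ha => hi a (Multiset.mem_cons_of_mem ha)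
      exact ⟨letter G a * x, y, by simp [mul_assoc], by simp, rfl⟩
    · obtain ⟨t, rfl⟩ := Multiset.exists_cons_of_mem ha
      rw [Multiset.add_cons, Multiset.cons_inj_right] at h
      obtain ⟨x, y, rfl, rfl, rfl⟩ := ih h fun a ha b hb => hi a ha b (Multiset.mem_cons_of_mem hb)
      refine ⟨x, letter G a * y, ?_, rfl, by simp⟩
      have : Indep x (letter G a) := fun b hb c hc => hi b hb c (by
        rw [pieces_letter, Multiset.mem_singleton] at hc; simp [hc])
      rw [← mul_assoc, ← mul_assoc, this.mul_comm]

/-- Two nonempty independent parts would each contribute a source. -/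
lemma IsPyramid.connected {H : Heap G} (hH : H.IsPyramid) : Connected G H.pieces := by
  intro s t h hi
  obtain ⟨x, y, rfl, rfl, rfl⟩ := exists_mul_of_pieces_eq_add h hi
  by_cases hx : x = 1
  · simp [hx]
  right
  have := eq_one_of_indep_of_isPyramid (u := x) (y := y) (s := 1) hx (Indep.symm hi) (by simpa)
  simp [this]

/-! ### Rotations of pyramids -/

/-- One step of `A_p` once the marked piece is in front: the pyramid above it is `u ∘ d`, and the
unreachable part `r` moves to the end. Uniqueness of the splitting identifies these heaps with the
subwords used by `rotStep`. -/
lemma rotStep_cons {a : V} {t : List V} {u r d : Heap G} (hu : IsFirst a u)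
    (h : ofWord G (a :: t) = u * (r * d)) (hi : Indep r u) (hp : (u * d).IsPyramid) :
    ∃ t', rotStep G (a :: t, 0) = (a :: t', 0) ∧ ofWord G (a :: t') = u * d * r := by
  obtain ⟨lo, R, h1, h2, h3, h4, h5⟩ := exists_lowerWord_upperWord (G := G) [] a t
  obtain ⟨u, rfl⟩ := hu
  refine ⟨R ++ lo, ?_, ?_⟩
  · have h1' : lowerWord G (a :: t) 0 = lo := h1
    have h2' : upperWord G (a :: t) 0 = a :: R := h2
    simp [rotStep, h1', h2']
  rw [indep_mul_right] at hi
  have e1 : ofWord G lo * ofWord G R = r * (u * d) := by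
    apply letter_mul_cancel (a := a)
    rw [← mul_assoc, ← h4.mul_comm, mul_assoc, ← ofWord_cons, ← h3, h, mul_assoc, ← mul_assoc u,
      ← hi.2.mul_comm, mul_assoc]
  rw [mul_assoc] at hp
  obtain ⟨e2, e3⟩ := split_unique (isPyramid_letter a).ne_one e1 h4 hi.1 h5 hp
  rw [← List.cons_append, ofWord_append, ofWord_cons, e3, e2, mul_assoc]
  simp only [mul_assoc]

lemma rotStep_conj {w : List V} {p : ℕ} (hp : p < w.length) :
    Conj (ofWord G w) (ofWord G (rotStep G (w, p)).1) ∧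
      (rotStep G (w, p)).2 < (rotStep G (w, p)).1.length := by
  obtain ⟨pre, a, t, rfl, rfl⟩ : ∃ pre a t, w = pre ++ a :: t ∧ p = pre.length :=
    ⟨w.take p, w[p], w.drop (p + 1), by simp, by simp [hp.le]⟩
  obtain ⟨lo, R, h1, h2, h3, -, -⟩ := exists_lowerWord_upperWord (G := G) pre a t
  simp only [rotStep, h1, h2]
  refine ⟨?_, by simp⟩
  rw [ofWord_append, h3, ← mul_assoc, ← ofWord_append, ofWord_append (a :: R)]
  exact Conj.mul_comm _ _

lemma IsRotation.conj {P Q : Heap G} (h : P.IsRotation Q) : Conj P Q := by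
  obtain ⟨w, p, rfl, hp, hev⟩ := h
  obtain ⟨n, hn⟩ := hev.exists
  have key : ∀ n, Conj (ofWord G w) (ofWord G ((rotStep G)^[n] (w, p)).1) ∧
      ((rotStep G)^[n] (w, p)).2 < ((rotStep G)^[n] (w, p)).1.length := by
    intro n
    induction n with
    | zero => exact ⟨Conj.refl _, hp⟩
    | succ n ih =>
      rw [Function.iterate_succ_apply']
      obtain ⟨h1, h2⟩ := rotStep_conj (G := G) ih.2
      exact ⟨ih.1.trans h1, h2⟩
  exact hn ▸ (key n).1

lemma eventually_iterate_rotStep {x : List V × ℕ} {Q : Heap G}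
    (h : ∀ᶠ n in Filter.atTop, ofWord G ((rotStep G)^[n] (rotStep G x)).1 = Q) :
    ∀ᶠ n in Filter.atTop, ofWord G ((rotStep G)^[n] x).1 = Q := by
  obtain ⟨N, hN⟩ := Filter.eventually_atTop.1 h
  refine Filter.eventually_atTop.2 ⟨N + 1, fun n hn => ?_⟩
  obtain ⟨m, rfl⟩ : ∃ m, n = m + 1 := ⟨n - 1, by omega⟩
  rw [Function.iterate_succ_apply]
  exact hN m (by omega)

/-- The iteration of `A_p` started from `r ∘ u`, where `u` is the pyramid of `p`, ends in a
pyramid `u ∘ s` with `r ∘ v = v ∘ s` and `v` independent of `u`; this determines `u ∘ s`. -/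
theorem exists_limit {r u : Heap G} (hu : u.IsPyramid) (hc : Connected G (r.pieces + u.pieces)) :
    ∃ Q : Heap G, Q.IsPyramid ∧
      (∃ v s, r * v = v * s ∧ Indep u v ∧ (∀ a ∈ v.pieces, a ∈ r.pieces) ∧ Q = u * s) ∧
      (∀ v s, r * v = v * s → Indep u v → (u * s).IsPyramid → u * s = Q) ∧
      ∀ a t, IsFirst a u → ofWord G (a :: t) = u * r →
        ∀ᶠ n in Filter.atTop, ofWord G ((rotStep G)^[n] (a :: t, 0)).1 = Q := by
  induction hn : r.size using Nat.strong_induction_on generalizing r u with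
  | _ n ih =>
    by_cases hr : r = 1
    · subst hr
      refine ⟨u, hu, ⟨1, 1, by simp, by simp, by simp, by simp⟩, ?_, ?_⟩
      · intro v s h _ _
        obtain rfl : s = 1 := mul_left_cancel' (x := v) (by simpa using h.symm)
        simp
      · intro a t ha ht
        refine Filter.Eventually.of_forall fun n => ?_
        induction n generalizing t with
        | zero => simpa using ht
        | succ n ihn =>
          obtain ⟨t', e1, e2⟩ := rotStep_cons (r := 1) (d := 1) ha (by simpa using ht) (by simp)
            (by simpa using hu)
          rw [Function.iterate_succ_apply, e1]
          exact ihn t' (by simpa using e2)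
    · obtain ⟨r', d, rfl, hi, hp⟩ := exists_split hu r
      -- Connectedness forces progress: as long as `r` is nontrivial, each step absorbs a piece of
      -- it into the pyramid.
      have hd : d ≠ 1 := by
        rintro rfl
        rw [mul_one] at hr hc
        rcases hc _ _ rfl hi with h | h
        · exact hr (pieces_eq_zero.1 h)
        · exact hu.ne_one (pieces_eq_zero.1 h)
      have hds := size_pos hd
      obtain ⟨Q, hQ, ⟨v, s, h1, h2, h3, rfl⟩, h4, h5⟩ := ih r'.size (by rw [← hn, size_mul]; omega) hp
        (by convert hc using 1; simp only [pieces_mul]; abel) rfl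
      rw [indep_mul_left] at h2
      refine ⟨u * d * s, hQ, ⟨r' * v, d * s, ?_, ?_, ?_, by rw [mul_assoc]⟩, ?_, ?_⟩
      · rw [h1]
        simp only [mul_assoc]
        rw [← mul_assoc d v, h2.2.mul_comm]
        simp only [← mul_assoc]
        rw [h1]
      · rw [indep_mul_right]; exact ⟨hi.symm, h2.1⟩
      · intro a ha
        simp only [pieces_mul, Multiset.mem_add] at ha ⊢
        rcases ha with ha | ha
        · exact Or.inl ha
        · exact Or.inl (h3 a ha)
      · intro v s hv huv hus
        have e : (u * (r' * d)) * v = v * (u * s) := by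
          rw [mul_assoc, hv, ← mul_assoc, huv.mul_comm, mul_assoc]
        -- Refining `(u ∘ r' ∘ d) ∘ v = v ∘ (u ∘ s)` twice and using uniqueness of the splitting
        -- gives `ρ = r'` and `μ = u ∘ d`. So `u ∘ s` also arises from the pair `r'`, `u ∘ d`, to
        -- which the induction applies.
        obtain ⟨ρ, μ, ν, σ, e1, e2, e3, e4, e5⟩ := levi e
        have hρ : Indep ρ u := Indep.symm (indep_mul_right.1 (e3 ▸ huv)).1
        obtain ⟨α, β, γ, δ, f1, f2, f3, f4, f5⟩ := levi e1
        obtain rfl : α = 1 := hρ.self_eq_one (by simp [f3]; tauto) (by simp [f1]; tauto)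
        rw [one_mul] at f1 f3
        subst f1 f3
        have hμ : μ.IsPyramid := by
          refine IsPyramid.of_mul (y := σ) (e4 ▸ hus) ?_
          rintro rfl
          exact hu.ne_one (eq_one_of_mul_eq_one f4.symm).1
        obtain ⟨rfl, rfl⟩ := split_unique hu.ne_one f2 hi hρ hp (f4 ▸ hμ)
        subst f4
        rw [e4]
        exact h4 ν σ (e3.symm.trans e2) e5 (e4 ▸ hus)
      · intro a t ha ht
        obtain ⟨t', e1, e2⟩ := rotStep_cons ha ht hi hp
        exact eventually_iterate_rotStep (e1 ▸ h5 a t' (ha.mul d) e2)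

/-- Left factors `P` are stripped from the conjugator `z`; the equation with `P ^ k` bounds their
number. When `P` no longer divides `z`, Levi's lemma applied to `P * z = z * Q` has a nontrivial
factor `u` of `P`, which is the pyramid of the marked piece. -/
lemma exists_marking_of_mul_eq {P Q z y : Heap G} {k : ℕ} (hP : P.IsPyramid) (hQ : Q.IsPyramid)
    (h : P * z = z * Q) (hk : z * y = P ^ k) :
    ∃ r u v s, P = r * u ∧ u.IsPyramid ∧ r * v = v * s ∧ Indep u v ∧ Q = u * s := by
  induction k generalizing z with
  | zero =>
    obtain ⟨rfl, -⟩ := eq_one_of_mul_eq_one (by simpa using hk)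
    obtain rfl : P = Q := by simpa using h
    exact ⟨1, P, 1, 1, by simp, hP, by simp, by simp, by simp⟩
  | succ k ih =>
    by_cases hz : ∃ z', z = P * z'
    · obtain ⟨z, rfl⟩ := hz
      rw [mul_assoc] at h hk
      exact ih (mul_left_cancel' h) (mul_left_cancel' (x := P) (by rw [hk, pow_succ']))
    · obtain ⟨r, u, v, s, rfl, e1, e2, rfl, e3⟩ := levi h
      have hu : u ≠ 1 := by
        rintro rfl
        exact hz ⟨v, by rw [e2, mul_one]⟩
      exact ⟨r, u, v, s, rfl, hQ.of_mul hu, e2.symm.trans e1, e3, rfl⟩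

lemma isRotation_of_eventually {r u Q : Heap G} (hu : u.IsPyramid)
    (h : ∀ a t, IsFirst a u → ofWord G (a :: t) = u * r →
      ∀ᶠ n in Filter.atTop, ofWord G ((rotStep G)^[n] (a :: t, 0)).1 = Q) :
    (r * u).IsRotation Q := by
  obtain ⟨wr, rfl⟩ := ofWord_surjective r
  obtain ⟨a, ha⟩ := exists_isFirst hu.ne_one
  obtain ⟨u', rfl⟩ := ha
  obtain ⟨wu, rfl⟩ := ofWord_surjective u'
  obtain ⟨lo, R, h1, h2, h3, h4, h5⟩ := exists_lowerWord_upperWord (G := G) wr a wu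
  rw [← ofWord_cons] at *
  -- The pyramid `u` has source `a`, so none of its pieces is left unreached, and the first step
  -- sends `r ∘ u` to `u ∘ r`.
  have hlo : ofWord G lo = 1 := by
    by_contra hne
    obtain ⟨b, hb⟩ := exists_isFirst hne
    have hab : b = a := by
      refine hu.eq_of_isFirst ?_ ⟨_, ofWord_cons a wu⟩
      rw [h3]; exact hb.mul _
    exact (h4 b hb.mem_pieces a (by simp)).1 hab
  have hlo' : lo = [] := by
    have := size_ofWord (G := G) lo
    rw [hlo, size_one] at this
    exact List.length_eq_zero_iff.1 this.symm
  subst hlo'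
  refine ⟨wr ++ a :: wu, wr.length, by rw [ofWord_append], by simp, ?_⟩
  have hstep : rotStep G (wr ++ a :: wu, wr.length) = (a :: (R ++ wr), 0) := by
    simp [rotStep, h1, h2]
  refine eventually_iterate_rotStep (hstep ▸ h a (R ++ wr) ⟨_, ofWord_cons a wu⟩ ?_)
  rw [← List.cons_append, ofWord_append, h3]
  simp

/-- Each factorization `r ∘ u` of a pyramid with a pyramid `u` leads to a rotation. -/
theorem exists_rotation {r u : Heap G} (hP : (r * u).IsPyramid) (hu : u.IsPyramid) :
    ∃ Q : Heap G, Q.IsPyramid ∧ (r * u).IsRotation Q ∧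
      (∃ v s, r * v = v * s ∧ Indep u v ∧ (∀ a ∈ v.pieces, a ∈ r.pieces) ∧ Q = u * s) ∧
      (∀ v s, r * v = v * s → Indep u v → (u * s).IsPyramid → u * s = Q) := by
  obtain ⟨Q, h1, h2, h3, h4⟩ := exists_limit (r := r) hu (by
    rw [← pieces_mul]; exact hP.connected)
  exact ⟨Q, h1, isRotation_of_eventually hu h4, h2, h3⟩

/-- With `IsRotation.conj`, this identifies rotation of pyramids with conjugacy, an equivalence
relation. The conjugator yields a marked piece, and the limit attached to that piece is
characterized by the same equations that `Q` satisfies. -/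
theorem isRotation_of_conj {P Q : Heap G} (hP : P.IsPyramid) (hQ : Q.IsPyramid) (h : Conj P Q) :
    P.IsRotation Q := by
  obtain ⟨z, y, k, h1, -, h3, -⟩ := h
  obtain ⟨r, u, v, s, rfl, hu, hv, hi, rfl⟩ := exists_marking_of_mul_eq hP hQ h3 h1
  obtain ⟨Q, -, hrot, -, h⟩ := exists_rotation hP hu
  rw [h v s hv hi hQ]
  exact hrot

/-- The conjugator `r * v` remembers the marking: a nontrivial discrepancy between `r` and `r'`
would have its first letter among pieces of which it is independent. -/
lemma marking_unique {r u v r' u' v' : Heap G} (h : r * u = r' * u') (hv : r * v = r' * v')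
    (hi : Indep u v) (hi' : Indep u' v') : r = r' ∧ u = u' := by
  obtain ⟨ρ, α, β, σ, rfl, rfl, rfl, rfl, hαβ⟩ := levi h
  rw [mul_assoc, mul_assoc] at hv
  have hv := mul_left_cancel' hv
  rw [indep_mul_left] at hi hi'
  have key : ∀ {α β v v' : Heap G}, α * v = β * v' → Indep α β → Indep β v → β = 1 := by
    intro α β v v' hv h1 h2
    by_contra hβ
    obtain ⟨b, hb⟩ := exists_isFirst hβ
    have hb' : b ∈ (α * v).pieces := (hv ▸ hb.mul v' : IsFirst b (α * v)).mem_pieces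
    rw [pieces_mul, Multiset.mem_add] at hb'
    rcases hb' with hb' | hb'
    · exact (h1 b hb' b hb.mem_pieces).1 rfl
    · exact (h2 b hb.mem_pieces b hb').1 rfl
  obtain rfl := key hv hαβ hi.1
  obtain rfl := key hv.symm hαβ.symm hi'.1
  simp

/-- An aperiodic pyramid has as many rotations as pieces. -/
theorem encard_conj {P : Heap G} (hP : P.IsPyramid) (hper : ¬ P.IsPeriodic) :
    {Q : Heap G | Q.IsPyramid ∧ Conj P Q}.encard = P.size := by
  have hex : ∀ x : Heap G × Heap G, ∃ Q : Heap G, x ∈ markings G P → Q.IsPyramid ∧ P.IsRotation Q ∧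
      (∃ v s, x.1 * v = v * s ∧ Indep x.2 v ∧ (∀ a ∈ v.pieces, a ∈ x.1.pieces) ∧ Q = x.2 * s) ∧
      (∀ v s, x.1 * v = v * s → Indep x.2 v → (x.2 * s).IsPyramid → x.2 * s = Q) := by
    rintro ⟨r, u⟩
    by_cases h : (r, u) ∈ markings G P
    · obtain ⟨rfl, hu⟩ := h
      obtain ⟨Q, hQ⟩ := exists_rotation hP hu
      exact ⟨Q, fun _ => hQ⟩
    · exact ⟨1, fun h' => (h h').elim⟩
  choose f hf using hex
  have himage : {Q : Heap G | Q.IsPyramid ∧ Conj P Q} = f '' markings G P := by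
    ext Q
    constructor
    · rintro ⟨hQ, z, y, k, h1, -, h3, -⟩
      obtain ⟨r, u, v, s, rfl, hu, hv, hi, rfl⟩ := exists_marking_of_mul_eq hP hQ h3 h1
      have hmem : (r, u) ∈ markings G (r * u) := ⟨rfl, hu⟩
      exact ⟨(r, u), hmem, ((hf _ hmem).2.2.2 v s hv hi hQ).symm⟩
    · rintro ⟨x, hx, rfl⟩
      exact ⟨(hf x hx).1, (hf x hx).2.1.conj⟩
  rw [himage, Set.InjOn.encard_image, encard_markings]
  obtain ⟨hP1, v₀, hv₀⟩ := isPyramid_iff.1 hP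
  -- For injectivity: each marking with limit `Q` provides the conjugator `r * v` from `P` to `Q`,
  -- beginning at the source of `P`. Two markings with the same limit are shown to have the same
  -- conjugator.
  have key : ∀ {r u v s Q : Heap G}, P = r * u → r * v = v * s → Indep u v →
      (∀ a ∈ v.pieces, a ∈ r.pieces) → Q = u * s → P * (r * v) = (r * v) * Q ∧ FirstLE v₀ (r * v) := by
    intro r u v s Q h1 h2 h3 h4 h5
    constructor
    · calc P * (r * v) = r * (u * v * s) := by rw [h1, mul_assoc, h2, mul_assoc u v s]
        _ = r * v * Q := by rw [h3.mul_comm, h5]; simp only [mul_assoc]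
    · intro a ha
      rcases isFirst_mul.1 ha with h | ⟨h, h'⟩
      · exact hv₀ a (h1 ▸ h.mul u)
      · exact ((h a (by simp) a (h4 a h'.mem_pieces)).1 rfl).elim
  rintro ⟨r, u⟩ hx ⟨r', u'⟩ hx' heq
  obtain ⟨hQ, hrot, ⟨v, s, e1, e2, e3, e4⟩, -⟩ := hf _ hx
  obtain ⟨-, -, ⟨v', s', e1', e2', e3', e4'⟩, -⟩ := hf _ hx'
  rw [← heq] at e4'
  obtain ⟨z₀, y, k, -, c2, c3, c4⟩ := hrot.conj
  obtain ⟨hu, hup⟩ := hx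
  obtain ⟨hu', hup'⟩ := hx'
  dsimp only at *
  obtain ⟨k1, k2⟩ := key hu.symm e1 e2 e3 e4
  obtain ⟨k1', k2'⟩ := key hu'.symm e1' e2' e3' e4'
  -- Following a conjugator by the fixed return `y` gives a heap commuting with the aperiodic `P`.
  -- Hence conjugators differ only by powers of `P` on the left, and `hnot` excludes a left factor
  -- `P`.
  have hpow : ∀ {z : Heap G}, P * z = z * f (r, u) → FirstLE v₀ z → ∃ j : ℕ, z * y = P ^ j := by
    intro z hz hz'
    refine eq_pow_of_commute hP1 hv₀ hper ?_ ?_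
    · refine FirstLE.of_mul (y := z₀) ?_
      rw [mul_assoc, c2, mul_pow_eq_of_mul_eq hz]
      exact (hv₀.pow k).mul hz'
    · rw [mul_assoc, ← c4, ← mul_assoc, ← hz, mul_assoc]
  have hnot : ∀ {r u v w : Heap G}, P = r * u → u.IsPyramid → Indep u v → r * v ≠ P * w := by
    intro r u v w h1 h2 h3 h4
    rw [h1, mul_assoc] at h4
    have h4 := mul_left_cancel' h4
    refine h2.ne_one (h3.self_eq_one (z := u) (fun _ => id) fun a ha => ?_)
    rw [h4]; simp [ha]
  have hfinish : ∀ {i j : ℕ} {r u v r' u' v' : Heap G}, i ≤ j → r * v * y = P ^ i → r' * v' * y = P ^ j →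
      P = r' * u' → u'.IsPyramid → Indep u' v' → r * v = r' * v' := by
    intro i j r u v r' u' v' hij h1 h2 h3 h4 h5
    obtain ⟨l, rfl⟩ := Nat.exists_eq_add_of_le hij
    rw [add_comm, pow_add, ← h1, ← mul_assoc] at h2
    have h2 := mul_right_cancel' h2
    rcases l with _ | l
    · simpa using h2.symm
    · rw [pow_succ', mul_assoc P] at h2
      exact (hnot h3 h4 h5 h2).elim
  obtain ⟨i, hi⟩ := hpow k1 k2
  obtain ⟨j, hj⟩ := hpow k1' k2'
  have hz : r * v = r' * v' := by
    rcases le_total i j with hij | hij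
    · exact hfinish (u := u) hij hi hj hu'.symm hup' e2'
    · exact (hfinish (u := u') hij hj hi hu.symm hup e2).symm
  obtain ⟨rfl, rfl⟩ := marking_unique (hu.trans hu'.symm) hz e2 e2'
  rfl

end Heap

end Heaps

end Kromatic

end

/-! ### Lyndon representatives and the enumeration of heaps, pyramids and stable sets. -/

noncomputable section

namespace Kromatic

section Heaps

variable {V : Type*} {G : SimpleGraph V}

namespace Heap

/-! ### First letters and stable sets -/

/-- Any set of first letters can be extracted simultaneously, since removing one leaves the others
first. This inverts the product of a stable set with a heap. -/
lemma exists_eq_ofWord_mul {H : Heap G} {l : List V} (hl : l.Nodup) (h : ∀ a ∈ l, IsFirst a H) :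
    ∃ H', H = ofWord G l * H' := by
  induction l generalizing H with
  | nil => exact ⟨H, by simp⟩
  | cons b l ih =>
    obtain ⟨H, rfl⟩ := h b (by simp)
    rw [List.nodup_cons] at hl
    obtain ⟨H', rfl⟩ := ih (H := H) hl.2 fun a ha => by
      rcases isFirst_mul.1 (h a (by simp [ha])) with h' | h'
      · exact (hl.1 (isFirst_letter.1 h' ▸ ha)).elim
      · exact h'.2
    exact ⟨H', by rw [ofWord_cons, mul_assoc]⟩

lemma isFirst_of_pairwise {l : List V} (hl : l.Nodup) (h : ∀ a ∈ l, ∀ b ∈ l, ¬ G.Adj a b) {a : V}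
    (ha : a ∈ l) : IsFirst a (ofWord G l) := by
  induction l with
  | nil => simp at ha
  | cons b l ih =>
    rw [List.nodup_cons] at hl
    rw [ofWord_cons, isFirst_mul, isFirst_letter]
    rcases List.mem_cons.1 ha with rfl | ha'
    · exact Or.inl rfl
    · refine Or.inr ⟨indep_letter_left.2 fun c hc => ?_, ih hl.2 (fun c hc d hd =>
        h c (by simp [hc]) d (by simp [hd])) ha'⟩
      obtain rfl : c = b := by simpa using hc
      exact ⟨fun h' => hl.1 (h' ▸ ha'), h a ha c (by simp)⟩

lemma not_adj_of_isFirst {H : Heap G} {a b : V} (ha : IsFirst a H) (hb : IsFirst b H) :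
    ¬ G.Adj a b := by
  obtain ⟨H, rfl⟩ := hb
  rcases isFirst_mul.1 ha with h | h
  · rw [isFirst_letter.1 h]; exact G.irrefl
  · exact (h.1 a (by simp) b (by simp)).2

/-! ### Lyndon heaps -/

lemma IsStandardWord.unique [LinearOrder V] {H : Heap G} {w w' : List V} (h : H.IsStandardWord w)
    (h' : H.IsStandardWord w') : w = w' :=
  le_antisymm (h'.2 w h.1) (h.2 w' h'.1)

/-- Each is minimal among the rotations of the other, so the standard words coincide, and a word
determines its heap. -/
lemma IsLyndon.eq_of_conj [LinearOrder V] {L L' : Heap G} (hL : L.IsLyndon) (hL' : L'.IsLyndon) (h : Conj L L') :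
    L = L' := by
  obtain ⟨w₁, w₂, h1, h2, h12⟩ := hL.2.2 L' hL'.1 (isRotation_of_conj hL.1 hL'.1 h)
  obtain ⟨w₂', w₁', h2', h1', h21⟩ := hL'.2.2 L hL.1 (isRotation_of_conj hL'.1 hL.1 h.symm)
  obtain rfl := h1.unique h1'
  obtain rfl := h2.unique h2'
  rw [← h1.1, ← h2.1, le_antisymm h12 h21]

section Lyndon

variable [Fintype V]

lemma finite_size_eq (n : ℕ) : {H : Heap G | H.size = n}.Finite := by
  refine ((List.finite_length_eq V n).image (ofWord G)).subset ?_
  rintro H rfl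
  obtain ⟨w, rfl⟩ := ofWord_surjective H
  exact ⟨w, (size_ofWord w).symm, rfl⟩

lemma exists_isStandardWord [LinearOrder V] (H : Heap G) : ∃ w, H.IsStandardWord w := by
  have hfin : {w : List V | ofWord G w = H}.Finite := by
    refine (List.finite_length_eq V H.size).subset ?_
    rintro w rfl
    exact (size_ofWord w).symm
  obtain ⟨w, hw, hmax⟩ := Set.exists_max_image _ id hfin (ofWord_surjective H)
  exact ⟨w, hw, fun w' hw' => hmax w' hw'⟩

lemma exists_isLyndon_conj [LinearOrder V] {P : Heap G} (hP : P.IsPyramid) (hper : ¬ P.IsPeriodic) :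
    ∃ L : Heap G, L.IsLyndon ∧ Conj P L := by
  choose std hstd using exists_isStandardWord (G := G)
  have hfin : {Q : Heap G | Q.IsPyramid ∧ Conj P Q}.Finite :=
    (finite_size_eq P.size).subset fun Q hQ => hQ.2.size_eq.symm
  obtain ⟨L, ⟨hL, hPL⟩, hmin⟩ := Set.exists_min_image _ std hfin ⟨P, hP, Conj.refl P⟩
  exact ⟨L, ⟨hL, hPL.not_isPeriodic hP hper, fun Q hQ hrot =>
    ⟨std L, std Q, hstd L, hstd Q, hmin Q ⟨hQ, hPL.trans hrot.conj⟩⟩⟩, hPL⟩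

/-! ### Counting heaps -/

variable (G) (W : Finset V)

/-- The heaps with `n` pieces, all in `W`. -/
def heapsOn (n : ℕ) : Finset (Heap G) :=
  (Set.Finite.subset (t := {H : Heap G | H.size = n ∧ ∀ a ∈ H.pieces, a ∈ W})
    (finite_size_eq n) fun _ h => h.1).toFinset

open Classical in
/-- The pyramids with `n` pieces, all in `W`. -/
def pyramidsOn (n : ℕ) : Finset (Heap G) := {H ∈ heapsOn G W n | H.IsPyramid}

open Classical in
/-- The aperiodic pyramids with `n` pieces, all in `W`. -/
def aperiodicOn (n : ℕ) : Finset (Heap G) := {H ∈ pyramidsOn G W n | ¬ H.IsPeriodic}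

open Classical in
/-- The Lyndon heaps with `n` pieces, all in `W`. -/
def lyndonOn [LinearOrder V] (n : ℕ) : Finset (Heap G) := {H ∈ heapsOn G W n | H.IsLyndon}

variable {G W}

lemma mem_heapsOn {n : ℕ} {H : Heap G} :
    H ∈ heapsOn G W n ↔ H.size = n ∧ ∀ a ∈ H.pieces, a ∈ W := by simp [heapsOn]

lemma mem_pyramidsOn {n : ℕ} {H : Heap G} :
    H ∈ pyramidsOn G W n ↔ (H.size = n ∧ ∀ a ∈ H.pieces, a ∈ W) ∧ H.IsPyramid := by
  simp [pyramidsOn, mem_heapsOn]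

lemma mem_aperiodicOn {n : ℕ} {H : Heap G} : H ∈ aperiodicOn G W n ↔
    ((H.size = n ∧ ∀ a ∈ H.pieces, a ∈ W) ∧ H.IsPyramid) ∧ ¬ H.IsPeriodic := by
  simp [aperiodicOn, mem_pyramidsOn]

lemma mem_lyndonOn [LinearOrder V] {n : ℕ} {H : Heap G} :
    H ∈ lyndonOn G W n ↔ (H.size = n ∧ ∀ a ∈ H.pieces, a ∈ W) ∧ H.IsLyndon := by
  simp [lyndonOn, mem_heapsOn]

/-- The map to the Lyndon representative has whole conjugacy classes of pyramids as fibres, each of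
size `n` by `encard_conj`. Conjugacy preserves the pieces, so the restriction to `W` is harmless. -/
lemma card_aperiodicOn [LinearOrder V] (n : ℕ) : (aperiodicOn G W n).card = n * (lyndonOn G W n).card := by
  classical
  have hex : ∀ P : Heap G, ∃ L : Heap G, P ∈ aperiodicOn G W n → L.IsLyndon ∧ Conj P L := by
    intro P
    by_cases h : P ∈ aperiodicOn G W n
    · have h' := mem_aperiodicOn.1 h
      obtain ⟨L, hL⟩ := exists_isLyndon_conj h'.1.2 h'.2
      exact ⟨L, fun _ => hL⟩
    · exact ⟨1, fun h' => (h h').elim⟩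
  choose f hf using hex
  have hmaps : ∀ P ∈ aperiodicOn G W n, f P ∈ lyndonOn G W n := by
    intro P hP
    have h := (mem_aperiodicOn.1 hP).1.1
    obtain ⟨h1, h2⟩ := hf P hP
    exact mem_lyndonOn.2 ⟨⟨h2.size_eq ▸ h.1, h2.pieces_eq ▸ h.2⟩, h1⟩
  rw [Finset.card_eq_sum_card_fiberwise hmaps, Finset.sum_const_nat (m := n), mul_comm]
  intro L hL
  obtain ⟨⟨hs, hW⟩, hLy⟩ := mem_lyndonOn.1 hL
  have hset : (({P ∈ aperiodicOn G W n | f P = L} : Finset (Heap G)) : Set (Heap G)) =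
      {Q : Heap G | Q.IsPyramid ∧ Conj L Q} := by
    ext Q
    simp only [Finset.coe_filter, Set.mem_ofPred_eq]
    constructor
    · rintro ⟨hQ, rfl⟩
      exact ⟨(mem_aperiodicOn.1 hQ).1.2, (hf Q hQ).2.symm⟩
    · rintro ⟨hQ, hc⟩
      have hmem : Q ∈ aperiodicOn G W n := mem_aperiodicOn.2
        ⟨⟨⟨hc.size_eq ▸ hs, hc.pieces_eq ▸ hW⟩, hQ⟩, hc.not_isPeriodic hLy.1 hLy.2.1⟩
      obtain ⟨h1, h2⟩ := hf Q hmem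
      exact ⟨hmem, h1.eq_of_conj hLy (hc.trans h2).symm⟩
  have := encard_conj hLy.1 hLy.2.1
  rw [← hset, Set.encard_coe_eq_coe_finsetCard, hs] at this
  exact_mod_cast this

/-- Pyramids are grouped by the size `m` of their aperiodic root. The power `n / m` is a bijection
from the aperiodic pyramids of size `m` onto such a group. -/
lemma card_pyramidsOn [LinearOrder V] {n : ℕ} (hn : 0 < n) :
    (pyramidsOn G W n).card = ∑ m ∈ n.divisors, m * (lyndonOn G W m).card := by
  classical
  have hex : ∀ P : Heap G, ∃ (K : Heap G) (k : ℕ), P.IsPyramid →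
      K.IsPyramid ∧ ¬ K.IsPeriodic ∧ 0 < k ∧ P = K ^ k := by
    intro P
    by_cases h : P.IsPyramid
    · obtain ⟨K, k, hK⟩ := exists_root h
      exact ⟨K, k, fun _ => hK⟩
    · exact ⟨1, 0, fun h' => (h h').elim⟩
  choose root k hroot using hex
  have hmaps : ∀ P ∈ pyramidsOn G W n, (root P).size ∈ n.divisors := by
    intro P hP
    obtain ⟨⟨hs, -⟩, hP⟩ := mem_pyramidsOn.1 hP
    obtain ⟨-, -, -, h⟩ := hroot P hP
    rw [Nat.mem_divisors]
    exact ⟨⟨k P, by rw [← hs, mul_comm, ← size_pow, ← h]⟩, hn.ne'⟩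
  rw [Finset.card_eq_sum_card_fiberwise hmaps]
  refine Finset.sum_congr rfl fun m hm => ?_
  rw [← card_aperiodicOn]
  obtain ⟨⟨q, rfl⟩, -⟩ := Nat.mem_divisors.1 hm
  have hm0 : 0 < m := Nat.pos_of_mul_pos_right hn
  have hq0 : 0 < q := Nat.pos_of_mul_pos_left hn
  have hrootpow : ∀ K : Heap G, K.IsPyramid → ¬ K.IsPeriodic → root (K ^ q) = K := by
    intro K hK hKp
    obtain ⟨r1, r2, r3, r4⟩ := hroot _ (hK.pow hq0)
    obtain ⟨hK1, v, hv⟩ := isPyramid_iff.1 hK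
    obtain ⟨hR1, v', hv'⟩ := isPyramid_iff.1 r1
    have hvv : v = v' := by
      refine (hv'.pow (k (K ^ q))) v ?_
      rw [← r4]
      exact (hv.pow q).isFirst (hK.pow hq0).ne_one
    subst hvv
    exact root_unique hR1 hK1 hv' hv r2 hKp r3 r4.symm
  refine Finset.card_nbij' root (fun K => K ^ q) ?_ ?_ ?_ ?_
  · intro P hP
    simp only [Finset.coe_filter, Set.mem_ofPred_eq] at hP
    obtain ⟨⟨hs, hW⟩, hPyr⟩ := mem_pyramidsOn.1 hP.1
    obtain ⟨r1, r2, r3, r4⟩ := hroot P hPyr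
    refine mem_aperiodicOn.2 ⟨⟨⟨hP.2, fun a ha => hW a ?_⟩, r1⟩, r2⟩
    rw [r4, pieces_pow, Multiset.mem_nsmul]
    exact ⟨r3.ne', ha⟩
  · intro K hK
    obtain ⟨⟨⟨hs, hW⟩, hPyr⟩, hper⟩ := mem_aperiodicOn.1 hK
    simp only [Finset.coe_filter, Set.mem_ofPred_eq]
    refine ⟨mem_pyramidsOn.2 ⟨⟨by rw [size_pow, hs, mul_comm], fun a ha => hW a ?_⟩,
      hPyr.pow hq0⟩, ?_⟩
    · rw [pieces_pow] at ha
      exact Multiset.mem_of_mem_nsmul ha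
    · rw [hrootpow K hPyr hper, hs]
  · intro P hP
    simp only [Finset.coe_filter, Set.mem_ofPred_eq] at hP
    obtain ⟨⟨hs, hW⟩, hPyr⟩ := mem_pyramidsOn.1 hP.1
    obtain ⟨r1, r2, r3, r4⟩ := hroot P hPyr
    have hkq : k P = q := by
      have := congrArg size r4
      rw [hs, size_pow, hP.2, mul_comm] at this
      exact (Nat.eq_of_mul_eq_mul_right hm0 this).symm
    change root P ^ q = P
    rw [← hkq, ← r4]
  · intro K hK
    obtain ⟨⟨⟨hs, hW⟩, hPyr⟩, hper⟩ := mem_aperiodicOn.1 hK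
    exact hrootpow K hPyr hper

/-- Counts heaps with a marked piece in two ways: a marking is a factorization with a pyramid on the
right. -/
lemma mul_card_heapsOn (n : ℕ) : n * (heapsOn G W n).card =
    ∑ x ∈ Finset.HasAntidiagonal.antidiagonal n, (heapsOn G W x.1).card * (pyramidsOn G W x.2).card := by
  classical
  have hfin : ∀ H : Heap G, (markings G H).Finite := fun H =>
    Set.finite_of_encard_eq_coe (encard_markings H)
  have h1 : ((heapsOn G W n).biUnion fun H => (hfin H).toFinset).card =
      n * (heapsOn G W n).card := by
    rw [Finset.card_biUnion, Finset.sum_const_nat (m := n), mul_comm]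
    · intro H hH
      have := encard_markings H
      rw [← (hfin H).coe_toFinset, Set.encard_coe_eq_coe_finsetCard, (mem_heapsOn.1 hH).1] at this
      exact_mod_cast this
    · intro H _ H' _ hne
      refine Finset.disjoint_left.2 fun x hx hx' => hne ?_
      rw [← ((hfin H).mem_toFinset.1 hx).1, ← ((hfin H').mem_toFinset.1 hx').1]
  have h2 : ((heapsOn G W n).biUnion fun H => (hfin H).toFinset) =
      (Finset.HasAntidiagonal.antidiagonal n).biUnion fun x => heapsOn G W x.1 ×ˢ pyramidsOn G W x.2 := by
    ext ⟨U, P⟩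
    simp only [Finset.mem_biUnion, Set.Finite.mem_toFinset, Finset.mem_product, mem_heapsOn,
      mem_pyramidsOn, Finset.HasAntidiagonal.mem_antidiagonal, Prod.exists]
    constructor
    · rintro ⟨H, ⟨hs, hW⟩, rfl, hP⟩
      simp only [pieces_mul, Multiset.mem_add] at hW
      exact ⟨U.size, P.size, by simpa using hs, ⟨rfl, fun a ha => hW a (Or.inl ha)⟩,
        ⟨rfl, fun a ha => hW a (Or.inr ha)⟩, hP⟩
    · rintro ⟨i, j, hij, ⟨rfl, hU⟩, ⟨rfl, hP⟩, hPyr⟩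
      refine ⟨U * P, ⟨by simpa using hij, fun a ha => ?_⟩, rfl, hPyr⟩
      simp only [pieces_mul, Multiset.mem_add] at ha
      exact ha.elim (hU a) (hP a)
  rw [← h1, h2, Finset.card_biUnion]
  · simp only [Finset.card_product]
  · rintro ⟨i, j⟩ _ ⟨i', j'⟩ _ hne
    refine Finset.disjoint_left.2 fun x hx hx' => hne ?_
    rw [Finset.mem_product, mem_heapsOn, mem_pyramidsOn] at hx hx'
    rw [Prod.mk.injEq]
    exact ⟨hx.1.1.symm.trans hx'.1.1, hx.2.1.1.symm.trans hx'.2.1.1⟩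

/-! ### Inversion by stable sets -/

variable (G W) in
open Classical in
/-- The stable sets with `n` elements, all in `W`. -/
def stableOn (n : ℕ) : Finset (Finset V) :=
  {S ∈ W.powersetCard n | ∀ a ∈ S, ∀ b ∈ S, ¬ G.Adj a b}

lemma mem_stableOn {n : ℕ} {S : Finset V} :
    S ∈ stableOn G W n ↔ (S ⊆ W ∧ S.card = n) ∧ ∀ a ∈ S, ∀ b ∈ S, ¬ G.Adj a b := by
  simp [stableOn, Finset.mem_powersetCard]

/-- The generating functions of heaps and, with signs, of stable sets are inverse. -/
lemma sum_stableOn_mul_heapsOn (n : ℕ) :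
    ∑ x ∈ Finset.HasAntidiagonal.antidiagonal n,
      ((-1) ^ x.1 * (stableOn G W x.1).card * (heapsOn G W x.2).card : ℤ) =
      if n = 0 then 1 else 0 := by
  classical
  let F : Heap G → Finset V := fun H => {a | IsFirst a H}
  have hF : ∀ H : Heap G, F H = ∅ ↔ H = 1 := by
    intro H
    simp only [F, Finset.filter_eq_empty_iff, Finset.mem_univ, forall_true_left]
    constructor
    · intro h
      by_contra hne
      obtain ⟨a, ha⟩ := exists_isFirst hne
      exact h ha
    · rintro rfl a
      exact not_isFirst_one a
  -- The pairs (stable set `S`, heap) with product `H` correspond to the subsets `S` of the first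
  -- letters of `H`. Their alternating sum vanishes unless `H` has no first letter, that is, unless
  -- `H = 1`.
  have h1 : ∑ H ∈ heapsOn G W n, ∑ S ∈ (F H).powerset, (-1 : ℤ) ^ S.card =
      if n = 0 then 1 else 0 := by
    simp only [Finset.sum_powerset_neg_one_pow_card, hF]
    rw [Finset.sum_ite_eq' (heapsOn G W n) 1]
    refine if_congr ?_ rfl rfl
    simp [mem_heapsOn, eq_comm]
  rw [← h1, Finset.sum_sigma']
  have h2 : ∀ x ∈ Finset.HasAntidiagonal.antidiagonal n,
      ((-1) ^ x.1 * (stableOn G W x.1).card * (heapsOn G W x.2).card : ℤ) =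
      ∑ y ∈ stableOn G W x.1 ×ˢ heapsOn G W x.2, (-1 : ℤ) ^ y.1.card := by
    intro x _
    rw [Finset.sum_congr rfl (g := fun _ => (-1 : ℤ) ^ x.1), Finset.sum_const, Finset.card_product]
    · simp; ring
    · intro y hy
      rw [(mem_stableOn.1 (Finset.mem_product.1 hy).1).1.2]
  rw [Finset.sum_congr rfl h2, Finset.sum_sigma']
  refine Finset.sum_bij (fun y _ => ⟨ofWord G y.2.1.toList * y.2.2, y.2.1⟩) ?_ ?_ ?_ ?_
  · rintro ⟨⟨i, j⟩, S, H⟩ hy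
    simp only [Finset.mem_sigma, Finset.HasAntidiagonal.mem_antidiagonal, Finset.mem_product, mem_stableOn,
      mem_heapsOn, Finset.mem_powerset] at hy ⊢
    obtain ⟨hij, ⟨⟨hSW, hSc⟩, hSt⟩, hH, hHW⟩ := hy
    refine ⟨⟨?_, fun a ha => ?_⟩, fun a ha => ?_⟩
    · rw [size_mul, size_ofWord, Finset.length_toList, hSc, hH, hij]
    · rw [pieces_mul, pieces_ofWord, Multiset.mem_add, Multiset.mem_coe, Finset.mem_toList] at ha
      exact ha.elim (fun h => hSW h) (hHW a)
    · simp only [F, Finset.mem_filter, Finset.mem_univ, true_and]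
      exact (isFirst_of_pairwise S.nodup_toList (by simpa using hSt) (by simpa using ha)).mul _
  · rintro ⟨⟨i, j⟩, S, H⟩ hy ⟨⟨i', j'⟩, S', H'⟩ hy' heq
    simp only [Finset.mem_sigma, Finset.HasAntidiagonal.mem_antidiagonal, Finset.mem_product, mem_stableOn,
      mem_heapsOn] at hy hy'
    simp only [Sigma.mk.injEq, heq_eq_eq] at heq
    obtain ⟨h, rfl⟩ := heq
    obtain rfl := mul_left_cancel' h
    obtain ⟨-, ⟨⟨-, rfl⟩, -⟩, rfl, -⟩ := hy
    obtain ⟨-, ⟨⟨-, rfl⟩, -⟩, rfl, -⟩ := hy'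
    rfl
  · rintro ⟨H, S⟩ hy
    simp only [Finset.mem_sigma, mem_heapsOn, Finset.mem_powerset] at hy
    obtain ⟨⟨hH, hHW⟩, hS⟩ := hy
    have hS' : ∀ a ∈ S, IsFirst a H := fun a ha => by simpa [F] using hS ha
    obtain ⟨H', rfl⟩ := exists_eq_ofWord_mul (l := S.toList) S.nodup_toList (by simpa using hS')
    refine ⟨⟨(S.card, H'.size), S, H'⟩, ?_, rfl⟩
    simp only [pieces_mul, Multiset.mem_add, pieces_ofWord, Multiset.mem_coe,
      Finset.mem_toList] at hHW
    simp only [Finset.mem_sigma, Finset.HasAntidiagonal.mem_antidiagonal, Finset.mem_product, mem_stableOn,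
      mem_heapsOn]
    refine ⟨?_, ⟨⟨fun a ha => hHW a (Or.inl ha), trivial⟩, fun a ha b hb =>
      not_adj_of_isFirst (hS' a ha) (hS' b hb)⟩, trivial, fun a ha => hHW a (Or.inr ha)⟩
    rw [← hH, size_mul, size_ofWord, Finset.length_toList]
  · intros; rfl

end Lyndon

end Heap

end Heaps

end Kromatic

end

/-! ### Coefficients of p_λ and p̄_λ, and uniqueness of expansions. -/

noncomputable section

namespace Kromatic

section SymmetricFunctions

open MvPowerSeries Finset.HasAntidiagonal
open scoped MvPowerSeries.WithPiTopology

/-! ### Agreement of power series up to an exponent vector -/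

/-- The coefficients of `f` and `g` agree at all exponents `e ≤ d`. -/
def Agree {σ : Type*} (d : σ →₀ ℕ) (f g : MvPowerSeries σ ℚ) : Prop :=
  ∀ e ≤ d, coeff e f = coeff e g

namespace Agree

variable {σ : Type*} {d : σ →₀ ℕ} {f f' g g' h : MvPowerSeries σ ℚ}

lemma refl (f : MvPowerSeries σ ℚ) : Agree d f f := fun _ _ => rfl

lemma symm (h : Agree d f g) : Agree d g f := fun e he => (h e he).symm

lemma trans (h₁ : Agree d f g) (h₂ : Agree d g h) : Agree d f h :=
  fun e he => (h₁ e he).trans (h₂ e he)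

lemma add (h : Agree d f f') (h' : Agree d g g') : Agree d (f + g) (f' + g') :=
  fun e he => by rw [map_add, map_add, h e he, h' e he]

lemma sub (h : Agree d f f') (h' : Agree d g g') : Agree d (f - g) (f' - g') :=
  fun e he => by rw [map_sub, map_sub, h e he, h' e he]

lemma mul (h : Agree d f f') (h' : Agree d g g') : Agree d (f * g) (f' * g') := by
  classical
  intro e he
  rw [coeff_mul, coeff_mul]
  refine Finset.sum_congr rfl fun x hx => ?_
  rw [mem_antidiagonal] at hx
  rw [h x.1 (le_trans (hx ▸ le_self_add) he), h' x.2 (le_trans (hx ▸ le_add_self) he)]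

lemma prod {ι : Type*} {s : Finset ι} {F F' : ι → MvPowerSeries σ ℚ}
    (h : ∀ i ∈ s, Agree d (F i) (F' i)) : Agree d (∏ i ∈ s, F i) (∏ i ∈ s, F' i) := by
  classical
  induction s using Finset.induction_on with
  | empty => simpa using refl _
  | insert i s hi ih =>
    rw [Finset.prod_insert hi, Finset.prod_insert hi]
    exact (h i (by simp)).mul (ih fun j hj => h j (by simp [hj]))

end Agree

/-! ### Coefficients of power sums and of `p̄` -/

lemma coeff_X_pow_of_notMem {e : ℕ →₀ ℕ} {i k : ℕ} (hk : 0 < k) (hi : i ∉ e.support) :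
    coeff e (X i ^ k : MvPowerSeries ℕ ℚ) = 0 := by
  rw [coeff_X_pow, if_neg]
  rintro rfl
  simp [hk.ne'] at hi

lemma agree_X_pow_zero {d : ℕ →₀ ℕ} {i k : ℕ} (hk : 0 < k) (hi : i ∉ d.support) :
    Agree d (X i ^ k : MvPowerSeries ℕ ℚ) 0 := by
  intro e he
  rw [coeff_X_pow_of_notMem hk fun h => hi (Finsupp.support_mono he h), map_zero]

lemma hasSum_psum {k : ℕ} (hk : 0 < k) :
    HasSum (fun i : ℕ => (X i : MvPowerSeries ℕ ℚ) ^ k) (psum k) := by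
  refine Summable.hasSum (WithPiTopology.summable_iff_summable_coeff.2 fun d => ?_)
  exact summable_of_ne_finset_zero (s := d.support) fun i hi => coeff_X_pow_of_notMem hk hi

lemma agree_psum {k : ℕ} (hk : 0 < k) (d : ℕ →₀ ℕ) :
    Agree d (psum k) (∑ i ∈ d.support, X i ^ k) := by
  intro e he
  have h1 := WithPiTopology.hasSum_iff_hasSum_coeff.1 (hasSum_psum hk) e
  have h2 : HasSum (fun i : ℕ => coeff e ((X i : MvPowerSeries ℕ ℚ) ^ k))
      (∑ i ∈ d.support, coeff e ((X i : MvPowerSeries ℕ ℚ) ^ k)) :=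
    hasSum_sum_of_ne_finset_zero fun i hi => agree_X_pow_zero hk hi e he
  rw [h1.unique h2, map_sum]

lemma agree_prod_one_add {k : ℕ} (hk : 0 < k) {d : ℕ →₀ ℕ} {s : Finset ℕ} (hs : d.support ⊆ s) :
    Agree d (∏ i ∈ s, (1 + X i ^ k)) (∏ i ∈ d.support, (1 + X i ^ k)) := by
  rw [← Finset.prod_sdiff hs]
  have : Agree d (∏ i ∈ s \ d.support, (1 + X i ^ k)) (∏ i ∈ s \ d.support, 1) :=
    Agree.prod fun i hi => by
      simpa using (Agree.refl 1).add (agree_X_pow_zero hk (Finset.mem_sdiff.1 hi).2)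
  simpa using this.mul (Agree.refl (∏ i ∈ d.support, (1 + X i ^ k)))

lemma agree_pbar {k : ℕ} (hk : 0 < k) (d : ℕ →₀ ℕ) :
    Agree d (pbar k) (∏ i ∈ d.support, (1 + X i ^ k) - 1) := by
  -- The coefficient at `e` is constant along all finite products containing the variables of `e`,
  -- so it can be read off from those variables alone.
  let g : MvPowerSeries ℕ ℚ := fun e => coeff e (∏ i ∈ e.support, (1 + X i ^ k) : MvPowerSeries ℕ ℚ)
  have hg : HasProd (fun i : ℕ => (1 + X i ^ k : MvPowerSeries ℕ ℚ)) g := by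
    refine (WithPiTopology.tendsto_iff_coeff_tendsto _ _ _).2 fun e => ?_
    refine tendsto_const_nhds.congr' ?_
    rw [SummationFilter.unconditional_filter]
    filter_upwards [Filter.eventually_ge_atTop e.support] with s hs
    exact (agree_prod_one_add hk hs e le_rfl).symm
  rw [pbar, hg.tprod_eq]
  refine Agree.sub (fun e he => ?_) (Agree.refl 1)
  exact (agree_prod_one_add hk (Finsupp.support_mono he) e le_rfl).symm

lemma coeff_mul_psum {k : ℕ} (hk : 0 < k) (f : MvPowerSeries ℕ ℚ) (d : ℕ →₀ ℕ) :
    coeff d (f * psum k) =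
      ∑ i ∈ d.support, if k ≤ d i then coeff (d - Finsupp.single i k) f else 0 := by
  rw [((Agree.refl f).mul (agree_psum hk d)) d le_rfl, Finset.mul_sum, map_sum]
  refine Finset.sum_congr rfl fun i _ => ?_
  rw [X_pow_eq, coeff_mul_monomial, mul_one]
  simp only [Finsupp.single_le_iff]

/-- `∏ⱼ p_{sⱼ}` for a multiset `s`. -/
def psumM (s : Multiset ℕ) : MvPowerSeries ℕ ℚ := (s.map psum).prod

/-- `∏ⱼ p̄_{sⱼ}` for a multiset `s`. -/
def pbarM (s : Multiset ℕ) : MvPowerSeries ℕ ℚ := (s.map pbar).prod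

@[simp] lemma psumM_zero : psumM 0 = 1 := by simp [psumM]

@[simp] lemma pbarM_zero : pbarM 0 = 1 := by simp [pbarM]

lemma psumM_cons (k : ℕ) (s : Multiset ℕ) : psumM (k ::ₘ s) = psumM s * psum k := by
  simp [psumM, mul_comm]

lemma pbarM_cons (k : ℕ) (s : Multiset ℕ) : pbarM (k ::ₘ s) = pbarM s * pbar k := by
  simp [pbarM, mul_comm]

lemma coeff_psum_eq_zero {k : ℕ} (hk : 0 < k) {d : ℕ →₀ ℕ} (h : d.degree ≠ k) :
    coeff d (psum k) = 0 := by
  rw [agree_psum hk d d le_rfl, map_sum]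
  refine Finset.sum_eq_zero fun i _ => ?_
  rw [coeff_X_pow, if_neg]
  rintro rfl
  simp at h

lemma coeff_psumM_eq_zero {s : Multiset ℕ} (hs : ∀ k ∈ s, 0 < k) {d : ℕ →₀ ℕ}
    (h : d.degree ≠ s.sum) : coeff d (psumM s) = 0 := by
  induction s using Multiset.induction_on generalizing d with
  | empty =>
    rw [psumM_zero, coeff_one, if_neg]
    rintro rfl
    simp at h
  | cons k s ih =>
    rw [psumM_cons, coeff_mul]
    refine Finset.sum_eq_zero fun x hx => ?_
    rw [mem_antidiagonal] at hx
    by_cases h1 : x.1.degree = s.sum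
    · rw [coeff_psum_eq_zero (hs k (by simp)) (d := x.2), mul_zero]
      rintro rfl
      rw [← hx, map_add, h1, Multiset.sum_cons, add_comm] at h
      exact h rfl
    · rw [ih (fun j hj => hs j (by simp [hj])) h1, zero_mul]

lemma prod_one_add_X_pow (s : Finset ℕ) (k : ℕ) : (∏ i ∈ s, (1 + X i ^ k) : MvPowerSeries ℕ ℚ) =
    ∑ t ∈ s.powerset, monomial (∑ i ∈ t, Finsupp.single i k) 1 := by
  rw [Finset.prod_one_add]
  refine Finset.sum_congr rfl fun t ht => ?_
  clear ht
  induction t using Finset.induction_on with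
  | empty => simp
  | insert i t hi ih =>
    rw [Finset.prod_insert hi, Finset.sum_insert hi, ih, X_pow_eq, monomial_mul_monomial, one_mul]

/-- In degrees up to `k`, the series `p̄_k` agrees with `p_k`. -/
lemma coeff_pbar_eq {k : ℕ} (hk : 0 < k) {d : ℕ →₀ ℕ} (h : d.degree ≤ k) :
    coeff d (pbar k) = coeff d (psum k) := by
  rw [agree_pbar hk d d le_rfl, agree_psum hk d d le_rfl, prod_one_add_X_pow]
  -- The empty set cancels the `- 1`, singletons give p_k, and larger sets have degree at least `2 *
  -- k > k`.
  have hsplit : d.support.powerset = insert ∅ (d.support.map ⟨singleton, Finset.singleton_injective⟩ ∪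
      {t ∈ d.support.powerset | 1 < t.card}) := by
    ext t
    simp only [Finset.mem_powerset, Finset.mem_insert, Finset.mem_union, Finset.mem_map,
      Function.Embedding.coeFn_mk, Finset.mem_filter]
    constructor
    · intro ht
      rcases Nat.lt_trichotomy t.card 1 with h | h | h
      · left; exact Finset.card_eq_zero.1 (by omega)
      · right; left
        obtain ⟨a, rfl⟩ := Finset.card_eq_one.1 h
        exact ⟨a, by simpa using ht, rfl⟩
      · exact Or.inr (Or.inr ⟨ht, h⟩)
    · rintro (rfl | ⟨a, ha, rfl⟩ | ⟨ht, -⟩)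
      · simp
      · simpa using ha
      · exact ht
  rw [hsplit, Finset.sum_insert (by simp), Finset.sum_union]
  · simp only [Finset.sum_empty, Finset.sum_map, Function.Embedding.coeFn_mk, Finset.sum_singleton]
    rw [monomial_zero_one, add_sub_cancel_left, map_add, add_eq_left.2]
    · simp [X_pow_eq]
    · rw [map_sum]
      refine Finset.sum_eq_zero fun t ht => ?_
      rw [coeff_monomial, if_neg]
      rintro rfl
      have ht' := (Finset.mem_filter.1 ht).2
      rw [map_sum] at h
      simp only [Finsupp.degree_single, Finset.sum_const, smul_eq_mul] at h
      nlinarith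
  · rw [Finset.disjoint_left]
    intro t ht ht'
    obtain ⟨a, -, rfl⟩ := Finset.mem_map.1 ht
    simp at ht'

lemma coeff_pbar_eq_zero {k : ℕ} (hk : 0 < k) {d : ℕ →₀ ℕ} (h : d.degree < k) :
    coeff d (pbar k) = 0 := by
  rw [coeff_pbar_eq hk h.le, coeff_psum_eq_zero hk h.ne]

lemma coeff_pbarM_eq_zero {s : Multiset ℕ} (hs : ∀ k ∈ s, 0 < k) {d : ℕ →₀ ℕ}
    (h : d.degree < s.sum) : coeff d (pbarM s) = 0 := by
  induction s using Multiset.induction_on generalizing d with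
  | empty => simp at h
  | cons k s ih =>
    rw [pbarM_cons, coeff_mul]
    refine Finset.sum_eq_zero fun x hx => ?_
    rw [mem_antidiagonal] at hx
    by_cases h1 : x.1.degree < s.sum
    · rw [ih (fun j hj => hs j (by simp [hj])) h1, zero_mul]
    · rw [coeff_pbar_eq_zero (hs k (by simp)) (d := x.2), mul_zero]
      rw [← hx, map_add, Multiset.sum_cons] at h
      omega

lemma coeff_pbarM_eq {s : Multiset ℕ} (hs : ∀ k ∈ s, 0 < k) {d : ℕ →₀ ℕ} (h : d.degree ≤ s.sum) :
    coeff d (pbarM s) = coeff d (psumM s) := by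
  induction s using Multiset.induction_on generalizing d with
  | empty => simp
  | cons k s ih =>
    have hs' : ∀ j ∈ s, 0 < j := fun j hj => hs j (by simp [hj])
    have hk := hs k (by simp)
    rw [pbarM_cons, psumM_cons, coeff_mul, coeff_mul]
    refine Finset.sum_congr rfl fun x hx => ?_
    rw [mem_antidiagonal] at hx
    rw [← hx, map_add, Multiset.sum_cons] at h
    rcases lt_trichotomy x.1.degree s.sum with h1 | h1 | h1
    · rw [coeff_pbarM_eq_zero hs' h1, coeff_psumM_eq_zero hs' h1.ne, zero_mul, zero_mul]
    · rw [ih hs' h1.le, coeff_pbar_eq hk (by omega)]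
    · rw [coeff_pbar_eq_zero hk (d := x.2) (by omega), coeff_psum_eq_zero hk (d := x.2) (by omega),
        mul_zero, mul_zero]

/-! ### Linear independence of the power sum products -/

/-- The multiset of nonzero exponents. -/
def vals (d : ℕ →₀ ℕ) : Multiset ℕ := d.support.val.map d

lemma card_vals (d : ℕ →₀ ℕ) : Multiset.card (vals d) = d.support.card := by simp [vals]

lemma vals_add_single {d : ℕ →₀ ℕ} {v k : ℕ} (hv : v ∉ d.support) (hk : 0 < k) :
    vals (d + Finsupp.single v k) = k ::ₘ vals d := by
  have hsupp : (d + Finsupp.single v k).support = insert v d.support := by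
    ext i
    by_cases hi : i = v
    · subst hi; simp [hk.ne']
    · simp [hi]
  rw [vals, hsupp, Finset.insert_val_of_notMem hv, Multiset.map_cons, vals]
  congr 1
  · simp [Finsupp.notMem_support_iff.1 hv]
  · refine Multiset.map_congr rfl fun i hi => ?_
    have : i ≠ v := fun h => hv (h ▸ hi)
    simp [this.symm]

lemma exists_vals_eq {s : Multiset ℕ} (hs : ∀ k ∈ s, 0 < k) : ∃ d, vals d = s := by
  induction s using Multiset.induction_on with
  | empty => exact ⟨0, by simp [vals]⟩
  | cons k s ih =>
    obtain ⟨d, rfl⟩ := ih fun j hj => hs j (by simp [hj])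
    obtain ⟨v, hv⟩ := Infinite.exists_notMem_finset d.support
    exact ⟨d + Finsupp.single v k, vals_add_single hv (hs k (by simp))⟩

lemma sum_vals (d : ℕ →₀ ℕ) : (vals d).sum = d.degree := rfl

/-- A monomial of p_s comes from placing every part on some variable. It has at most as many
variables as parts, with equality only when the parts sit on distinct variables and so are the
exponents. -/
lemma vals_of_coeff_psumM_ne_zero {s : Multiset ℕ} (hs : ∀ k ∈ s, 0 < k) {d : ℕ →₀ ℕ}
    (h : coeff d (psumM s) ≠ 0) :
    Multiset.card (vals d) ≤ Multiset.card s ∧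
      (Multiset.card (vals d) = Multiset.card s → s = vals d) := by
  induction s using Multiset.induction_on generalizing d with
  | empty =>
    rw [psumM_zero, coeff_one] at h
    have hd : d = 0 := by by_contra h'; exact h (if_neg h')
    subst hd
    simp [vals]
  | cons k s ih =>
    have hk := hs k (by simp)
    rw [psumM_cons, coeff_mul_psum hk] at h
    obtain ⟨v, -, hv⟩ := Finset.exists_ne_zero_of_sum_ne_zero h
    have hkv : k ≤ d v := by by_contra h'; exact hv (if_neg h')
    rw [if_pos hkv] at hv
    obtain ⟨h1, h2⟩ := ih (fun j hj => hs j (by simp [hj])) hv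
    obtain ⟨d', rfl⟩ : ∃ d', d = d' + Finsupp.single v k :=
      ⟨d - Finsupp.single v k, (tsub_add_cancel_of_le (by simpa using hkv)).symm⟩
    rw [add_tsub_cancel_right] at h1 h2
    by_cases hvd : v ∈ d'.support
    · have hsupp : (d' + Finsupp.single v k).support ⊆ d'.support := by
        refine Finsupp.support_add.trans (Finset.union_subset subset_rfl ?_)
        exact Finsupp.support_single_subset.trans (by simpa using hvd)
      have := Finset.card_le_card hsupp
      rw [← card_vals, ← card_vals] at this
      rw [Multiset.card_cons]
      exact ⟨by omega, fun h => by omega⟩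
    · rw [vals_add_single hvd hk, Multiset.card_cons, Multiset.card_cons]
      exact ⟨by omega, fun h => by rw [h2 (by omega)]⟩

lemma coeff_psumM_nonneg {s : Multiset ℕ} (hs : ∀ k ∈ s, 0 < k) (d : ℕ →₀ ℕ) :
    0 ≤ coeff d (psumM s) := by
  induction s using Multiset.induction_on generalizing d with
  | empty => rw [psumM_zero, coeff_one]; positivity
  | cons k s ih =>
    rw [psumM_cons, coeff_mul_psum (hs k (by simp))]
    refine Finset.sum_nonneg fun i _ => ?_
    split_ifs
    · exact ih (fun j hj => hs j (by simp [hj])) _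
    · exact le_rfl

lemma coeff_psumM_vals_pos (s : Multiset ℕ) (d : ℕ →₀ ℕ) (h : vals d = s) :
    0 < coeff d (psumM s) := by
  have hpos : ∀ {d : ℕ →₀ ℕ}, ∀ k ∈ vals d, 0 < k := by
    intro d k hk
    obtain ⟨v, hv, rfl⟩ := Multiset.mem_map.1 hk
    exact Nat.pos_of_ne_zero (Finsupp.mem_support_iff.1 hv)
  induction s using Multiset.induction_on generalizing d with
  | empty =>
    have : d = 0 := by simpa [vals] using h
    subst this
    simp
  | cons k s ih =>
    have hk : k ∈ vals d := h ▸ Multiset.mem_cons_self k s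
    have hk0 := hpos k hk
    obtain ⟨v, hv, rfl⟩ := Multiset.mem_map.1 hk
    have hd : d = d.erase v + Finsupp.single v (d v) := by
      rw [add_comm, Finsupp.single_add_erase]
    have hsub : d - Finsupp.single v (d v) = d.erase v := by
      conv_lhs => rw [hd]
      simp
    have hvals : vals (d.erase v) = s := by
      have := vals_add_single (d := d.erase v) (v := v) (k := d v) (by simp) hk0
      rw [← hd, h] at this
      exact ((Multiset.cons_inj_right _).1 this).symm
    rw [psumM_cons, coeff_mul_psum hk0]
    refine Finset.sum_pos' (fun i _ => ?_) ⟨v, hv, ?_⟩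
    · split_ifs
      · exact coeff_psumM_nonneg (fun j hj => hpos (d := d) j (h ▸ Multiset.mem_cons_of_mem hj)) _
      · exact le_rfl
    · rw [if_pos le_rfl, hsub]
      exact ih _ hvals

lemma linearIndependent_psumM {n : ℕ} {c : n.Partition → ℚ}
    (h : ∀ d : ℕ →₀ ℕ, d.degree = n → ∑ μ : n.Partition, c μ * coeff d (psumM μ.parts) = 0)
    (μ : n.Partition) : c μ = 0 := by
  by_contra hμ
  -- With `μ` having the most parts, the monomial whose exponents are the parts of `μ` occurs in no
  -- other p_ν with nonzero coefficient.
  obtain ⟨μ, hμ, hmax⟩ := Finset.exists_max_image ({μ | c μ ≠ 0} : Finset n.Partition)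
    (fun μ => Multiset.card μ.parts) ⟨μ, by simpa using hμ⟩
  have hpos : ∀ (μ : n.Partition), ∀ k ∈ μ.parts, 0 < k := fun μ k hk => μ.parts_pos hk
  obtain ⟨d, hd⟩ := exists_vals_eq (hpos μ)
  have hdeg : d.degree = n := by rw [← sum_vals, hd, μ.parts_sum]
  have := h d hdeg
  rw [Finset.sum_eq_single μ] at this
  · rcases mul_eq_zero.1 this with h' | h'
    · simp [h'] at hμ
    · exact (coeff_psumM_vals_pos _ d hd).ne' h'
  · intro ν _ hν
    by_contra hne
    obtain ⟨h1, h2⟩ := mul_ne_zero_iff.1 hne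
    obtain ⟨h3, h4⟩ := vals_of_coeff_psumM_ne_zero (hpos ν) h2
    have h5 := hmax ν (by simpa using h1)
    rw [hd] at h3 h4
    exact hν (Nat.Partition.ext (h4 (le_antisymm h3 h5)))
  · simp

/-- Uniqueness of expansions in products whose lowest terms are those of the power sums. -/
lemma hasSum_unique {B : Multiset ℕ → MvPowerSeries ℕ ℚ}
    (hlow : ∀ s : Multiset ℕ, (∀ k ∈ s, 0 < k) → ∀ d : ℕ →₀ ℕ, d.degree ≤ s.sum →
      coeff d (B s) = coeff d (psumM s))
    {c c' : IntPartition → ℚ} {f : MvPowerSeries ℕ ℚ}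
    (h : HasSum (fun lam : IntPartition => c lam • B lam.2.parts) f)
    (h' : HasSum (fun lam : IntPartition => c' lam • B lam.2.parts) f) : c = c' := by
  have hpos : ∀ (lam : IntPartition), ∀ k ∈ lam.2.parts, 0 < k := fun lam k hk => lam.2.parts_pos hk
  have hzero : ∀ d : ℕ →₀ ℕ, HasSum
      (fun lam : IntPartition => (c lam - c' lam) * coeff d (B lam.2.parts)) 0 := by
    intro d
    have := (WithPiTopology.hasSum_iff_hasSum_coeff.1 h d).sub
      (WithPiTopology.hasSum_iff_hasSum_coeff.1 h' d)
    rw [sub_self] at this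
    have heq : (fun lam : IntPartition => (c lam - c' lam) * coeff d (B lam.2.parts)) =
        fun lam => coeff d (c lam • B lam.2.parts) - coeff d (c' lam • B lam.2.parts) := by
      funext lam
      rw [map_smul, map_smul, smul_eq_mul, smul_eq_mul, sub_mul]
    rwa [heq]
  -- In degree `n`, smaller partitions have dropped out by induction and larger ones start in higher
  -- degree. What remains is a linear relation among the p_μ with `μ` of size `n`.
  have key : ∀ n : ℕ, ∀ μ : n.Partition, c ⟨n, μ⟩ - c' ⟨n, μ⟩ = 0 := by
    intro n
    induction n using Nat.strong_induction_on with
    | _ n ih =>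
      refine linearIndependent_psumM fun d hd => ?_
      have h1 : HasSum (fun lam : IntPartition => (c lam - c' lam) * coeff d (B lam.2.parts))
          (∑ lam ∈ Finset.univ.map (Function.Embedding.sigmaMk n),
            (c lam - c' lam) * coeff d (B lam.2.parts)) := by
        refine hasSum_sum_of_ne_finset_zero fun lam hlam => ?_
        obtain ⟨m, μ⟩ := lam
        rcases lt_trichotomy m n with hm | rfl | hm
        · rw [ih m hm μ, zero_mul]
        · exact (hlam (by simp)).elim
        · rw [hlow _ (hpos ⟨m, μ⟩) d (by rw [μ.parts_sum]; omega),
            coeff_psumM_eq_zero (hpos ⟨m, μ⟩) (by rw [μ.parts_sum]; omega), mul_zero]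
      rw [Finset.sum_map] at h1
      rw [← h1.unique (hzero d)]
      refine Finset.sum_congr rfl fun μ _ => ?_
      change _ = (c ⟨n, μ⟩ - c' ⟨n, μ⟩) * coeff d (B μ.parts)
      rw [hlow _ (fun k hk => μ.parts_pos hk) d (by rw [μ.parts_sum]; omega)]
  funext ⟨n, μ⟩
  exact sub_eq_zero.1 (key n μ)

lemma HasPsumExpansion.unique {f : MvPowerSeries ℕ ℚ} {c c' : IntPartition → ℚ}
    (h : HasPsumExpansion f c) (h' : HasPsumExpansion f c') : c = c' :=
  hasSum_unique (B := psumM) (fun _ _ _ _ => rfl) h h'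

lemma HasPbarExpansion.unique {f : MvPowerSeries ℕ ℚ} {c c' : IntPartition → ℚ}
    (h : HasPbarExpansion f c) (h' : HasPbarExpansion f c') : c = c' :=
  hasSum_unique (B := pbarM) (fun _ hs _ hd => coeff_pbarM_eq hs hd) h h'

/-- `omega` is defined through a chosen expansion; uniqueness allows it to be computed from any
expansion. -/
lemma HasPsumExpansion.omega_eq {f g : MvPowerSeries ℕ ℚ} {c : IntPartition → ℚ}
    (h : HasPsumExpansion f c) (h' : HasPsumExpansion g fun lam =>
      (-1) ^ (lam.1 - Multiset.card lam.2.parts) * c lam) : omega f = g := by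
  have hex : ∃ c, HasPsumExpansion f c := ⟨c, h⟩
  rw [omega, dif_pos hex, hex.choose_spec.unique h]
  exact h'.tsum_eq

end SymmetricFunctions

end Kromatic

end

/-! ### Product series ∏ᵢ F(xᵢ) as exponentials of power sums. -/

noncomputable section

namespace Kromatic

section SymmetricFunctions

open MvPowerSeries Finset.HasAntidiagonal
open scoped MvPowerSeries.WithPiTopology Nat

/-! ### Power sum expansion of `∏ᵢ F(xᵢ)` -/

/-- The series `∏ᵢ F(xᵢ)`, where `F 0 = 1` is the constant coefficient of `F`. -/
def prodSeries (F : ℕ → ℚ) : MvPowerSeries ℕ ℚ := fun d => d.prod fun _ n => F n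

/-- The coefficient of `p_s` in `exp (∑ₖ aₖ pₖ)`. -/
def expCoeff (a : ℕ → ℚ) (s : Multiset ℕ) : ℚ :=
  (s.map a).prod / ((∏ k ∈ s.toFinset, (s.count k)! : ℕ) : ℚ)

lemma prod_factorial_count_cons (k : ℕ) (s : Multiset ℕ) :
    ∏ x ∈ (k ::ₘ s).toFinset, ((k ::ₘ s).count x)! =
      (k ::ₘ s).count k * ∏ x ∈ s.toFinset, (s.count x)! := by
  have h1 : ∏ x ∈ s.toFinset, (s.count x)! = ∏ x ∈ insert k s.toFinset, (s.count x)! := by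
    refine Finset.prod_subset (Finset.subset_insert _ _) fun x _ hx => ?_
    rw [Multiset.count_eq_zero_of_notMem (by simpa using hx), Nat.factorial_zero]
  have hk : k ∈ insert k s.toFinset := Finset.mem_insert_self _ _
  rw [h1, Multiset.toFinset_cons, ← Finset.mul_prod_erase _ _ hk, ← Finset.mul_prod_erase _ _ hk,
    Multiset.count_cons_self, Nat.factorial_succ, mul_assoc]
  congr 2
  refine Finset.prod_congr rfl fun x hx => ?_
  rw [Multiset.count_cons_of_ne (Finset.ne_of_mem_erase hx)]

lemma count_mul_expCoeff_cons (a : ℕ → ℚ) (k : ℕ) (s : Multiset ℕ) :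
    ((k ::ₘ s).count k : ℚ) * expCoeff a (k ::ₘ s) = a k * expCoeff a s := by
  rw [expCoeff, expCoeff, prod_factorial_count_cons, Multiset.map_cons, Multiset.prod_cons]
  have h1 : ((k ::ₘ s).count k : ℚ) ≠ 0 := by simp; positivity
  have h2 : ((∏ x ∈ s.toFinset, (s.count x)! : ℕ) : ℚ) ≠ 0 :=
    Nat.cast_ne_zero.2 (Finset.prod_ne_zero_iff.2 fun x _ => Nat.factorial_ne_zero _)
  rw [Nat.cast_mul]
  field_simp

lemma card_le_sum {s : Multiset ℕ} (hs : ∀ k ∈ s, 0 < k) : Multiset.card s ≤ s.sum := by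
  simpa using Multiset.card_nsmul_le_sum (s := s) (a := 1) fun k hk => hs k hk

lemma expCoeff_sign (a : ℕ → ℚ) {s : Multiset ℕ} (hs : ∀ k ∈ s, 0 < k) :
    expCoeff (fun k => (-1) ^ (k - 1) * a k) s =
      (-1) ^ (s.sum - Multiset.card s) * expCoeff a s := by
  have : (s.map fun k => (-1) ^ (k - 1) * a k).prod =
      (-1) ^ (s.sum - Multiset.card s) * (s.map a).prod := by
    induction s using Multiset.induction_on with
    | empty => simp
    | cons k s ih =>
      have hs' : ∀ j ∈ s, 0 < j := fun j hj => hs j (by simp [hj])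
      have hk := hs k (by simp)
      have := card_le_sum hs'
      rw [Multiset.map_cons, Multiset.prod_cons, ih hs', Multiset.map_cons, Multiset.prod_cons,
        Multiset.sum_cons, Multiset.card_cons,
        show k + s.sum - (Multiset.card s + 1) = (k - 1) + (s.sum - Multiset.card s) by omega, pow_add]
      ring
  rw [expCoeff, expCoeff, this, mul_div_assoc]

/-- The partitions of `n` as multisets. -/
def partsOf (n : ℕ) : Finset (Multiset ℕ) :=
  (Finset.univ : Finset n.Partition).map ⟨Nat.Partition.parts, fun _ _ => Nat.Partition.ext⟩

lemma mem_partsOf {n : ℕ} {s : Multiset ℕ} : s ∈ partsOf n ↔ s.sum = n ∧ ∀ k ∈ s, 0 < k := by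
  simp only [partsOf, Finset.mem_map, Finset.mem_univ, true_and]
  constructor
  · rintro ⟨μ, rfl⟩
    exact ⟨μ.parts_sum, fun k hk => μ.parts_pos hk⟩
  · rintro ⟨h1, h2⟩
    exact ⟨⟨s, fun {k} hk => h2 k hk, h1⟩, rfl⟩

/-- The part of degree `n` of `exp (∑ₖ aₖ pₖ)`. -/
def expPart (a : ℕ → ℚ) (n : ℕ) : MvPowerSeries ℕ ℚ := ∑ s ∈ partsOf n, expCoeff a s • psumM s

/-- The part of degree `n` of `prodSeries F`. -/
def prodPart (F : ℕ → ℚ) (n : ℕ) : MvPowerSeries ℕ ℚ :=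
  fun d => if d.degree = n then prodSeries F d else 0

/-- Euler's operator multiplies degree n by n, so this is D exp(A) = exp(A) · D A for A = ∑ a_k p_k,
where D p_k = k p_k. In coefficients, n is the sum of the parts of a partition, and each part is
removed in turn. -/
lemma smul_expPart (a : ℕ → ℚ) (n : ℕ) : (n : ℚ) • expPart a n =
    ∑ x ∈ antidiagonal n, (x.2 * a x.2 : ℚ) • (expPart a x.1 * psum x.2) := by
  have hL : (n : ℚ) • expPart a n = ∑ s ∈ partsOf n, ∑ k ∈ s.toFinset,
      (k * a k * expCoeff a (s.erase k)) • (psumM (s.erase k) * psum k) := by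
    rw [expPart, Finset.smul_sum]
    refine Finset.sum_congr rfl fun s hs => ?_
    have hn : (n : ℚ) = ∑ k ∈ s.toFinset, (s.count k : ℚ) * k := by
      rw [← (mem_partsOf.1 hs).1, Finset.sum_multiset_count]
      simp
    rw [smul_smul, hn, Finset.sum_mul, Finset.sum_smul]
    refine Finset.sum_congr rfl fun k hk => ?_
    obtain ⟨t, rfl⟩ := Multiset.exists_cons_of_mem (Multiset.mem_toFinset.1 hk)
    rw [Multiset.erase_cons_head, ← psumM_cons, mul_assoc (k : ℚ), ← count_mul_expCoeff_cons]
    congr 1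
    ring
  have hR : ∀ x ∈ antidiagonal n, (x.2 * a x.2 : ℚ) • (expPart a x.1 * psum x.2) =
      ∑ t ∈ partsOf x.1, (x.2 * a x.2 * expCoeff a t : ℚ) • (psumM t * psum x.2) := by
    intro x _
    rw [expPart, Finset.sum_mul, Finset.smul_sum]
    refine Finset.sum_congr rfl fun t _ => ?_
    rw [smul_mul_assoc, smul_smul]
  rw [hL, Finset.sum_congr rfl hR, Finset.sum_sigma', Finset.sum_sigma']
  -- The only indices outside the image have `x.2 = 0`, and the factor `x.2` kills them.
  refine Finset.sum_of_injOn (fun y => ⟨(n - y.2, y.2), y.1.erase y.2⟩) ?_ ?_ ?_ ?_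
  · rintro ⟨s, k⟩ hs ⟨s', k'⟩ hs' heq
    simp only [Finset.coe_sigma, Set.mem_sigma_iff, Finset.mem_coe, Multiset.mem_toFinset] at hs hs'
    simp only [Sigma.mk.injEq, Prod.mk.injEq, heq_eq_eq] at heq
    obtain ⟨⟨-, rfl⟩, h⟩ := heq
    rw [← Multiset.cons_erase hs.2, h, Multiset.cons_erase hs'.2]
  · rintro ⟨s, k⟩ hs
    simp only [Finset.coe_sigma, Set.mem_sigma_iff, Finset.mem_coe, Multiset.mem_toFinset] at hs
    simp only [Finset.coe_sigma, Set.mem_sigma_iff, Finset.mem_coe, mem_antidiagonal, mem_partsOf]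
    obtain ⟨hs1, hk⟩ := hs
    obtain ⟨h1, h2⟩ := mem_partsOf.1 hs1
    have h3 := Multiset.sum_erase hk
    exact ⟨by omega, by omega, fun j hj => h2 j (Multiset.mem_of_mem_erase hj)⟩
  · rintro ⟨⟨i, j⟩, t⟩ hx hne
    simp only [Finset.mem_sigma, mem_antidiagonal, mem_partsOf] at hx
    obtain ⟨hij, ht, htpos⟩ := hx
    rcases Nat.eq_zero_or_pos j with rfl | hj
    · simp
    · refine (hne ⟨⟨j ::ₘ t, j⟩, ?_, ?_⟩).elim
      · simp only [Finset.coe_sigma, Set.mem_sigma_iff, Finset.mem_coe, mem_partsOf,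
          Multiset.mem_toFinset, Multiset.sum_cons, Multiset.mem_cons, true_or, and_true]
        refine ⟨by omega, ?_⟩
        rintro k (rfl | hk)
        · exact hj
        · exact htpos k hk
      · have : n - j = i := by omega
        simp [this]
  · intros; rfl

/-- The hypothesis says t F' = F · B with B = ∑ b_k t^k. Euler's operator acts on ∏ᵢ F(xᵢ) one
variable at a time, and multiplies the product by ∑ᵢ B(xᵢ) = ∑ b_k p_k. -/
lemma smul_prodPart {F b : ℕ → ℚ} (h0 : F 0 = 1) (hb : b 0 = 0)
    (h : ∀ n : ℕ, n * F n = ∑ x ∈ antidiagonal n, F x.1 * b x.2) (n : ℕ) :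
    (n : ℚ) • prodPart F n = ∑ x ∈ antidiagonal n, b x.2 • (prodPart F x.1 * psum x.2) := by
  ext d
  rw [map_smul, map_sum]
  have hterm : ∀ x ∈ antidiagonal n, coeff d (b x.2 • (prodPart F x.1 * psum x.2)) =
      ∑ i ∈ d.support, if x.2 ≤ d i then
        b x.2 * coeff (d - Finsupp.single i x.2) (prodPart F x.1) else 0 := by
    intro x _
    rw [map_smul, smul_eq_mul]
    rcases Nat.eq_zero_or_pos x.2 with h | h
    · simp [h, hb]
    · rw [coeff_mul_psum h, Finset.mul_sum]
      refine Finset.sum_congr rfl fun i _ => ?_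
      rw [mul_ite, mul_zero]
  rw [Finset.sum_congr rfl hterm, Finset.sum_comm]
  have hdeg : ∀ (i j : ℕ), j ≤ d i → (d - Finsupp.single i j).degree + j = d.degree := by
    intro i j hj
    conv_rhs => rw [← tsub_add_cancel_of_le (Finsupp.single_le_iff.2 hj), map_add,
      Finsupp.degree_single]
  by_cases hd : d.degree = n
  · have hcoeff : coeff d (prodPart F n) = d.prod fun _ n => F n := if_pos hd
    rw [hcoeff, smul_eq_mul, ← hd, Finsupp.degree_apply, Nat.cast_sum, Finset.sum_mul]
    refine Finset.sum_congr rfl fun i hi => ?_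
    have hrest : ∀ j ≤ d i, (d - Finsupp.single i j).prod (fun _ n => F n) =
        F (d i - j) * ∏ l ∈ d.support.erase i, F (d l) := by
      intro j hj
      rw [Finsupp.prod_of_support_subset _ (s := d.support)
        (Finsupp.support_mono tsub_le_self) _ (fun _ _ => h0), ← Finset.mul_prod_erase _ _ hi]
      congr 1
      · simp
      · refine Finset.prod_congr rfl fun l hl => ?_
        simp [(Finset.ne_of_mem_erase hl).symm]
    have h1 : (d i : ℚ) * d.prod (fun _ n => F n) =
        ∑ x ∈ antidiagonal (d i), F x.1 * b x.2 * ∏ l ∈ d.support.erase i, F (d l) := by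
      rw [← Finset.sum_mul, ← h, Finsupp.prod, ← Finset.mul_prod_erase _ _ hi, mul_assoc]
    rw [h1]
    have hle : d i ≤ ∑ i ∈ d.support, d i := Finset.single_le_sum (f := fun i => d i) (by simp) hi
    -- The recursion for `F (d i)` splits `d i`, whereas the target splits the whole degree. The
    -- second entry is kept; entries exceeding `d i` contribute zero.
    refine Finset.sum_of_injOn (fun x => (∑ i ∈ d.support, d i - x.2, x.2)) ?_ ?_ ?_ ?_
    · rintro ⟨x, y⟩ hx ⟨x', y'⟩ hx' heq
      simp only [Finset.mem_coe, mem_antidiagonal, Prod.mk.injEq] at *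
      omega
    · rintro ⟨x, y⟩ hx
      simp only [Finset.mem_coe, mem_antidiagonal] at *
      omega
    · rintro ⟨x, y⟩ hx hne
      rw [if_neg]
      intro hy
      refine hne ⟨(d i - y, y), ?_, ?_⟩
      · simp only [Finset.mem_coe, mem_antidiagonal] at *
        omega
      · simp only [mem_antidiagonal] at hx
        simp only [Prod.mk.injEq, and_true]
        omega
    · rintro ⟨x, y⟩ hx
      rw [mem_antidiagonal] at hx
      dsimp only at hx ⊢
      have hy : y ≤ d i := by omega
      rw [if_pos hy]
      have hc : coeff (d - Finsupp.single i y) (prodPart F (∑ i ∈ d.support, d i - y)) =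
          (d - Finsupp.single i y).prod fun _ n => F n := by
        refine if_pos ?_
        have := hdeg i y hy
        rw [Finsupp.degree_apply d] at this
        omega
      rw [hc, hrest y hy, show d i - y = x by omega]
      ring
  · have hcoeff : coeff d (prodPart F n) = 0 := if_neg hd
    rw [hcoeff, smul_zero]
    symm
    refine Finset.sum_eq_zero fun i _ => Finset.sum_eq_zero fun x hx => ?_
    rw [mem_antidiagonal] at hx
    split_ifs with hle
    · have : coeff (d - Finsupp.single i x.2) (prodPart F x.1) = 0 := by
        refine if_neg fun h' => hd ?_
        have := hdeg i x.2 hle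
        omega
      rw [this, mul_zero]
    · rfl

/-- Both sides satisfy the same recursion with the same value in degree 0, and n is invertible in ℚ
for n > 0. -/
lemma expPart_eq_prodPart {F b : ℕ → ℚ} (h0 : F 0 = 1) (hb : b 0 = 0)
    (h : ∀ n : ℕ, n * F n = ∑ x ∈ antidiagonal n, F x.1 * b x.2) (n : ℕ) :
    expPart (fun k => b k / k) n = prodPart F n := by
  induction n using Nat.strong_induction_on with
  | _ n ih =>
    rcases Nat.eq_zero_or_pos n with rfl | hn
    · have h1 : partsOf 0 = {0} := by
        ext s
        rw [mem_partsOf, Finset.mem_singleton]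
        constructor
        · rintro ⟨h1, h2⟩
          have := card_le_sum h2
          exact Multiset.card_eq_zero.1 (by omega)
        · rintro rfl; simp
      rw [expPart, h1, Finset.sum_singleton, psumM_zero]
      ext d
      have hd : coeff d (prodPart F 0) = if d.degree = 0 then d.prod fun _ n => F n else 0 := rfl
      rw [hd, map_smul, coeff_one]
      simp only [Finsupp.degree_eq_zero_iff]
      split_ifs with hd0
      · subst hd0; simp [expCoeff]
      · simp
    · have hn0 : (n : ℚ) ≠ 0 := by positivity
      refine smul_right_injective _ hn0 ?_
      change (n : ℚ) • _ = (n : ℚ) • _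
      rw [smul_expPart, smul_prodPart h0 hb h]
      refine Finset.sum_congr rfl fun x hx => ?_
      rw [mem_antidiagonal] at hx
      rcases Nat.eq_zero_or_pos x.2 with hx2 | hx2
      · simp [hx2, hb]
      · have : (x.2 : ℚ) ≠ 0 := by positivity
        rw [ih x.1 (by omega), mul_div_cancel₀ _ this]

theorem hasPsumExpansion_prodSeries {F b : ℕ → ℚ} (h0 : F 0 = 1) (hb : b 0 = 0)
    (h : ∀ n : ℕ, n * F n = ∑ x ∈ antidiagonal n, F x.1 * b x.2) :
    HasPsumExpansion (prodSeries F) fun lam => expCoeff (fun k => b k / k) lam.2.parts := by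
  refine WithPiTopology.hasSum_iff_hasSum_coeff.2 fun d => ?_
  have h1 : coeff d (prodSeries F) =
      ∑ lam ∈ Finset.univ.map (Function.Embedding.sigmaMk (β := Nat.Partition) d.degree),
        coeff d (expCoeff (fun k => b k / k) lam.2.parts • psumPart lam) := by
    have h2 : coeff d (prodSeries F) = coeff d (prodPart F d.degree) := (if_pos rfl).symm
    rw [h2, ← expPart_eq_prodPart h0 hb h, expPart, partsOf, Finset.sum_map, Finset.sum_map, map_sum]
    rfl
  rw [h1]
  refine hasSum_sum_of_ne_finset_zero fun lam hlam => ?_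
  obtain ⟨m, μ⟩ := lam
  have hm : d.degree ≠ m := by rintro rfl; exact hlam (by simp)
  rw [map_smul]
  have := coeff_psumM_eq_zero (s := μ.parts) (fun k hk => μ.parts_pos hk) (d := d)
    (by rwa [μ.parts_sum])
  change _ • coeff d (psumM μ.parts) = 0
  rw [this, smul_zero]

end SymmetricFunctions

end Kromatic

end

/-! ### The product formula for the generating function of heaps. -/

noncomputable section

namespace Kromatic

section GeneratingFunctions

open Finset.HasAntidiagonal PowerSeries

/-! ### Generating functions in one variable -/

/-- The operator `t d/dt`. -/
def theta (f : PowerSeries ℚ) : PowerSeries ℚ := PowerSeries.mk fun n => n * coeff n f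

@[simp] lemma coeff_theta (f : PowerSeries ℚ) (n : ℕ) : coeff n (theta f) = n * coeff n f := by
  simp [theta]

lemma theta_mul (f g : PowerSeries ℚ) : theta (f * g) = theta f * g + f * theta g := by
  ext n
  rw [coeff_theta, coeff_mul, map_add, coeff_mul, coeff_mul, Finset.mul_sum, ← Finset.sum_add_distrib]
  refine Finset.sum_congr rfl fun x hx => ?_
  rw [← mem_antidiagonal.1 hx, coeff_theta, coeff_theta]
  push_cast
  ring

@[simp] lemma theta_one : theta 1 = 0 := by
  ext n
  rw [coeff_theta, coeff_one]
  split_ifs with h <;> simp [h]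

/-- Agreement of the coefficients up to degree `N`. -/
abbrev AgreeTo (N : ℕ) (f g : PowerSeries ℚ) : Prop := Agree (Finsupp.single () N) f g

lemma agreeTo_iff {N : ℕ} {f g : PowerSeries ℚ} :
    AgreeTo N f g ↔ ∀ n ≤ N, coeff n f = coeff n g := by
  constructor
  · intro h n hn
    exact h _ (Finsupp.single_le_single.2 hn)
  · intro h e he
    obtain ⟨n, rfl⟩ : ∃ n, e = Finsupp.single () n := ⟨e (), by ext; simp⟩
    exact h n (Finsupp.single_le_single.1 he)

/-- The series `∑_{j ≥ 1} t ^ (j m)`. -/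
def multiples (m : ℕ) : PowerSeries ℚ := PowerSeries.mk fun n => if n ≠ 0 ∧ m ∣ n then 1 else 0

lemma one_sub_X_pow_mul_multiples {m : ℕ} (hm : 0 < m) :
    (1 - X ^ m) * multiples m = (X ^ m : PowerSeries ℚ) := by
  ext n
  rw [sub_mul, one_mul, map_sub, coeff_X_pow_mul', coeff_X_pow]
  simp only [multiples, coeff_mk]
  rcases lt_trichotomy n m with h | rfl | h
  · have h1 : ¬ (n ≠ 0 ∧ m ∣ n) := fun h' => by
      have := Nat.le_of_dvd (Nat.pos_of_ne_zero h'.1) h'.2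
      omega
    rw [if_neg h1, if_neg (by omega), if_neg (by omega), sub_zero]
  · rw [if_pos ⟨by omega, dvd_rfl⟩, if_pos le_rfl, if_pos rfl, Nat.sub_self]
    simp
  · have h1 : (n - m ≠ 0 ∧ m ∣ n - m) ↔ (n ≠ 0 ∧ m ∣ n) := by
      refine and_congr (by omega) (Nat.dvd_sub_iff_left h.le dvd_rfl)
    rw [if_pos h.le, if_neg (by omega : ¬ n = m)]
    simp only [h1, sub_self]

lemma theta_one_sub_X_pow {m : ℕ} (hm : 0 < m) :
    theta (1 - X ^ m) = -((1 - X ^ m) * ((m : ℚ) • multiples m)) := by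
  rw [mul_smul_comm, one_sub_X_pow_mul_multiples hm]
  ext n
  rw [coeff_theta, map_sub, coeff_one, coeff_X_pow, map_neg, map_smul, coeff_X_pow]
  by_cases h : n = m
  · subst h; simp [hm.ne']
  · by_cases h0 : n = 0
    · simp [h0]; omega
    · simp [h, h0]

lemma theta_prod_one_sub {ι : Type*} (s : Finset ι) (m : ι → ℕ) (hm : ∀ i ∈ s, 0 < m i) :
    theta (∏ i ∈ s, (1 - X ^ m i)) =
      -((∏ i ∈ s, (1 - X ^ m i)) * ∑ i ∈ s, (m i : ℚ) • multiples (m i)) := by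
  classical
  induction s using Finset.induction_on with
  | empty => simp
  | insert i s hi ih =>
    rw [Finset.prod_insert hi, Finset.sum_insert hi, theta_mul, ih fun j hj => hm j (by simp [hj]),
      theta_one_sub_X_pow (hm i (by simp))]
    ring

/-- Repeated use of (1 - y)(1 + y) = 1 - y². In the limit 1/(1 - t^m) = ∏ⱼ (1 + t^(m 2^j)), which is
where the powers of two in the theorem come from. -/
lemma one_sub_mul_prod_one_add (m N : ℕ) :
    (1 - X ^ m) * ∏ j ∈ Finset.range N, (1 + X ^ (m * 2 ^ j)) =
      (1 - X ^ (m * 2 ^ N) : PowerSeries ℚ) := by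
  induction N with
  | zero => simp
  | succ N ih =>
    rw [Finset.prod_range_succ, ← mul_assoc, ih, pow_succ 2 N, ← mul_assoc m, pow_mul X _ 2]
    ring

lemma agreeTo_one_sub {N k : ℕ} (hk : N < k) : AgreeTo N (1 - X ^ k) 1 := by
  rw [agreeTo_iff]
  intro n hn
  rw [map_sub, coeff_X_pow, if_neg (by omega), sub_zero]

end GeneratingFunctions

section Heaps

open Finset.HasAntidiagonal

variable {V : Type*}

lemma Heap.IsLyndon.size_pos [LinearOrder V] {G : SimpleGraph V} {L : Heap G} (hL : L.IsLyndon) :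
    0 < L.size :=
  Heap.size_pos hL.1.ne_one

variable [Fintype V] (G : SimpleGraph V) (W : Finset V)

namespace Heap

lemma heapsOn_zero : heapsOn G W 0 = {1} := by
  ext H
  rw [mem_heapsOn, Finset.mem_singleton, size_eq_zero]
  constructor
  · exact fun h => h.1
  · rintro rfl; simp

lemma pyramidsOn_zero : pyramidsOn G W 0 = ∅ := by
  refine Finset.eq_empty_of_forall_notMem fun H hH => ?_
  obtain ⟨⟨h, -⟩, hP⟩ := mem_pyramidsOn.1 hH
  exact hP.ne_one (size_eq_zero.1 h)

/-- The generating function of heaps on `W`. -/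
def heapSeries : PowerSeries ℚ := PowerSeries.mk fun n => ((heapsOn G W n).card : ℚ)

/-- The generating function of pyramids on `W`. -/
def pyramidSeries : PowerSeries ℚ := PowerSeries.mk fun n => ((pyramidsOn G W n).card : ℚ)

/-- The signed generating function of stable sets in `W`. -/
def stableSeries : PowerSeries ℚ := PowerSeries.mk fun n => (-1) ^ n * ((stableOn G W n).card : ℚ)

lemma theta_heapSeries : theta (heapSeries G W) = heapSeries G W * pyramidSeries G W := by
  ext n
  rw [coeff_theta, PowerSeries.coeff_mul]
  simp only [heapSeries, pyramidSeries, PowerSeries.coeff_mk]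
  exact_mod_cast mul_card_heapsOn (G := G) (W := W) n

lemma stableSeries_mul_heapSeries : stableSeries G W * heapSeries G W = 1 := by
  ext n
  rw [PowerSeries.coeff_mul, PowerSeries.coeff_one]
  simp only [heapSeries, stableSeries, PowerSeries.coeff_mk]
  exact_mod_cast sum_stableOn_mul_heapsOn (G := G) (W := W) n

/-- Inverse series have opposite logarithmic derivatives. -/
lemma theta_stableSeries : theta (stableSeries G W) = -(stableSeries G W * pyramidSeries G W) := by
  have h1 := stableSeries_mul_heapSeries G W
  have h2 := congrArg theta h1
  rw [theta_mul, theta_heapSeries, theta_one] at h2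
  linear_combination (stableSeries G W) * h2 -
    (theta (stableSeries G W) + stableSeries G W * pyramidSeries G W) * h1

/-- The previous identity after t ↦ -t, in the form required by `hasPsumExpansion_prodSeries`. The
sign change from the pyramid numbers is exactly the one that ω will undo. -/
lemma mul_card_stableOn (n : ℕ) : (n * ((stableOn G W n).card : ℚ) : ℚ) =
    ∑ x ∈ antidiagonal n, ((stableOn G W x.1).card : ℚ) *
      (-((-1) ^ x.2 * ((pyramidsOn G W x.2).card : ℚ))) := by
  have h := congrArg (PowerSeries.coeff n) (theta_stableSeries G W)
  rw [coeff_theta, map_neg, PowerSeries.coeff_mul] at h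
  simp only [stableSeries, pyramidSeries, PowerSeries.coeff_mk] at h
  have hsq : ((-1 : ℚ) ^ n) * (-1) ^ n = 1 := by rw [← mul_pow]; simp
  have h' := congrArg (fun x => (-1 : ℚ) ^ n * x) h
  rw [show (-1 : ℚ) ^ n * (n * ((-1) ^ n * ((stableOn G W n).card : ℚ))) =
    ((-1 : ℚ) ^ n * (-1) ^ n) * (n * ((stableOn G W n).card : ℚ)) by ring, hsq, one_mul] at h'
  rw [h', ← Finset.sum_neg_distrib, Finset.mul_sum]
  refine Finset.sum_congr rfl fun x hx => ?_
  rw [← mem_antidiagonal.1 hx, pow_add]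
  have hx1 : ((-1 : ℚ) ^ x.1) * (-1) ^ x.1 = 1 := by rw [← mul_pow]; simp
  linear_combination (-(-1) ^ x.2 * ((stableOn G W x.1).card : ℚ) *
    ((pyramidsOn G W x.2).card : ℚ)) * hx1

variable [LinearOrder V]

open Classical in
/-- The Lyndon heaps on `W` with at most `N` pieces. -/
def lyndonUpTo (N : ℕ) : Finset (Heap G) := (Finset.range (N + 1)).biUnion (lyndonOn G W)

variable {G W} in
lemma mem_lyndonUpTo {N : ℕ} {L : Heap G} :
    L ∈ lyndonUpTo G W N ↔ L.IsLyndon ∧ L.size ≤ N ∧ ∀ a ∈ L.pieces, a ∈ W := by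
  simp only [lyndonUpTo, Finset.mem_biUnion, Finset.mem_range, mem_lyndonOn]
  constructor
  · rintro ⟨m, hm, ⟨rfl, hW⟩, hL⟩
    exact ⟨hL, by omega, hW⟩
  · rintro ⟨hL, hm, hW⟩
    exact ⟨L.size, by omega, ⟨rfl, hW⟩, hL⟩

lemma agreeTo_pyramidSeries (N : ℕ) : AgreeTo N (pyramidSeries G W)
    (∑ L ∈ lyndonUpTo G W N, (L.size : ℚ) • multiples L.size) := by
  classical
  rw [agreeTo_iff]
  intro n hn
  rw [map_sum]
  simp only [pyramidSeries, PowerSeries.coeff_mk, map_smul, multiples, smul_eq_mul, mul_ite, mul_one,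
    mul_zero]
  rcases Nat.eq_zero_or_pos n with rfl | hpos
  · simp [pyramidsOn_zero]
  have hdiv : n.divisors ⊆ Finset.range (N + 1) := by
    intro m hm
    rw [Finset.mem_range]
    have := Nat.divisor_le hm
    omega
  rw [lyndonUpTo, Finset.sum_biUnion, card_pyramidsOn hpos, Nat.cast_sum]
  · refine (Finset.sum_subset_zero_on_sdiff hdiv (fun m hm => ?_) fun m hm => ?_)
    · refine Finset.sum_eq_zero fun L hL => ?_
      rw [(mem_lyndonOn.1 hL).1.1, if_neg]
      rintro ⟨-, h⟩
      exact (Finset.mem_sdiff.1 hm).2 (Nat.mem_divisors.2 ⟨h, hpos.ne'⟩)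
    · rw [Finset.sum_congr rfl (g := fun _ => (m : ℚ))]
      · rw [Finset.sum_const, nsmul_eq_mul, Nat.cast_mul, mul_comm]
      · intro L hL
        rw [(mem_lyndonOn.1 hL).1.1, if_pos ⟨hpos.ne', (Nat.mem_divisors.1 hm).1⟩]
  · intro m _ m' _ hne
    refine Finset.disjoint_left.2 fun L hL hL' => hne ?_
    rw [← (mem_lyndonOn.1 hL).1.1, ← (mem_lyndonOn.1 hL').1.1]

/-- The logarithmic derivatives of the two factors cancel up to degree `N`, so the product is
constant there, with constant term 1. -/
lemma agreeTo_prod_one_sub_mul (N : ℕ) :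
    AgreeTo N ((∏ L ∈ lyndonUpTo G W N, (1 - PowerSeries.X ^ L.size)) * heapSeries G W) 1 := by
  set F : PowerSeries ℚ := ∏ L ∈ lyndonUpTo G W N, (1 - PowerSeries.X ^ L.size) with hF
  have hpos : ∀ L ∈ lyndonUpTo G W N, 0 < L.size := fun L hL => (mem_lyndonUpTo.1 hL).1.size_pos
  have htheta : AgreeTo N (theta (F * heapSeries G W)) 0 := by
    have h1 : theta (F * heapSeries G W) = F * heapSeries G W *
        (pyramidSeries G W - ∑ L ∈ lyndonUpTo G W N, (L.size : ℚ) • multiples L.size) := by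
      rw [theta_mul, theta_heapSeries, hF, theta_prod_one_sub _ _ hpos]
      ring
    rw [h1]
    have := (Agree.refl (d := Finsupp.single () N) (F * heapSeries G W)).mul
      ((agreeTo_pyramidSeries G W N).sub
        (Agree.refl (∑ L ∈ lyndonUpTo G W N, (L.size : ℚ) • multiples L.size)))
    rwa [sub_self, mul_zero] at this
  rw [agreeTo_iff] at htheta ⊢
  intro n hn
  rcases Nat.eq_zero_or_pos n with rfl | hn0
  · have hF0 : PowerSeries.constantCoeff F = 1 := by
      rw [hF, map_prod]
      refine Finset.prod_eq_one fun L hL => ?_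
      simp [(hpos L hL).ne']
    have hh : PowerSeries.constantCoeff (heapSeries G W) = 1 := by
      rw [← PowerSeries.coeff_zero_eq_constantCoeff_apply]
      simp [heapSeries, heapsOn_zero]
    rw [PowerSeries.coeff_zero_eq_constantCoeff_apply, map_mul, hF0, hh]
    simp
  · have := htheta n hn
    rw [coeff_theta, map_zero] at this
    have hn' : (n : ℚ) ≠ 0 := by positivity
    rw [(mul_eq_zero.1 this).resolve_left hn', PowerSeries.coeff_one, if_neg (by omega)]

open Classical in
/-- The pairs of a Lyndon heap `L` on `W` with at most `N` pieces and a part `|L| 2 ^ j`, `j ≤ N`. -/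
def atoms (N : ℕ) : Finset (ℕ × Heap G) :=
  (lyndonUpTo G W N ×ˢ Finset.range (N + 1)).image fun x => (x.1.size * 2 ^ x.2, x.1)

variable {G W} in
lemma mem_atoms {N : ℕ} {x : ℕ × Heap G} : x ∈ atoms G W N ↔ x.2.IsLyndon ∧ x.2.size ≤ N ∧
    (∀ a ∈ x.2.pieces, a ∈ W) ∧ ∃ j ≤ N, x.2.size * 2 ^ j = x.1 := by
  obtain ⟨k, L⟩ := x
  simp only [atoms, Finset.mem_image, Finset.mem_product, mem_lyndonUpTo, Finset.mem_range,
    Prod.exists, Prod.mk.injEq]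
  constructor
  · rintro ⟨L', j, ⟨⟨h1, h2, h3⟩, hj⟩, h4, rfl⟩
    exact ⟨h1, h2, h3, j, by omega, h4⟩
  · rintro ⟨h1, h2, h3, j, hj, h4⟩
    exact ⟨L, j, ⟨⟨h1, h2, h3⟩, by omega⟩, h4, rfl⟩

variable {G W} in
lemma pos_of_mem_atoms {N : ℕ} {x : ℕ × Heap G} (hx : x ∈ atoms G W N) : 0 < x.1 := by
  obtain ⟨h1, -, -, j, -, hj⟩ := mem_atoms.1 hx
  rw [← hj]
  have := h1.size_pos
  positivity

theorem agreeTo_heapSeries (N : ℕ) :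
    AgreeTo N (heapSeries G W) (∏ x ∈ atoms G W N, (1 + PowerSeries.X ^ x.1)) := by
  classical
  have h1 : (∏ L ∈ lyndonUpTo G W N, (1 - PowerSeries.X ^ L.size)) *
      (∏ x ∈ atoms G W N, (1 + PowerSeries.X ^ x.1)) =
      (∏ L ∈ lyndonUpTo G W N, (1 - PowerSeries.X ^ (L.size * 2 ^ (N + 1))) : PowerSeries ℚ) := by
    rw [atoms, Finset.prod_image, Finset.prod_product, ← Finset.prod_mul_distrib]
    · exact Finset.prod_congr rfl fun L _ => one_sub_mul_prod_one_add L.size (N + 1)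
    · rintro ⟨L, j⟩ hx ⟨L', j'⟩ - h
      simp only [Prod.mk.injEq] at h
      obtain ⟨h1, rfl⟩ := h
      have hL := (mem_lyndonUpTo.1 (Finset.mem_product.1 hx).1).1.size_pos
      have h2 : 2 ^ j = 2 ^ j' := Nat.eq_of_mul_eq_mul_left hL h1
      rw [Nat.pow_right_injective le_rfl h2]
  -- The telescoped remainders begin in degree `L.size * 2 ^ (N + 1) > N`, so they are invisible up
  -- to degree `N`.
  have h2 : AgreeTo N (∏ L ∈ lyndonUpTo G W N, (1 - PowerSeries.X ^ (L.size * 2 ^ (N + 1)))) 1 := by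
    have := Agree.prod (d := Finsupp.single () N) (s := lyndonUpTo G W N)
      (F := fun L => (1 - PowerSeries.X ^ (L.size * 2 ^ (N + 1)) : PowerSeries ℚ)) (F' := fun _ => 1)
      fun L hL => agreeTo_one_sub ?_
    · simpa using this
    · have hL := (mem_lyndonUpTo.1 hL).1.size_pos
      have := Nat.lt_two_pow_self (n := N + 1)
      nlinarith
  have h3 := (Agree.refl (d := Finsupp.single () N) (heapSeries G W)).mul h2
  have h4 := (agreeTo_prod_one_sub_mul G W N).mul
    (Agree.refl (∏ x ∈ atoms G W N, (1 + PowerSeries.X ^ x.1 : PowerSeries ℚ)))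
  rw [mul_one, ← h1] at h3
  rw [one_mul] at h4
  refine h3.symm.trans ?_
  convert h4 using 1
  ring

end Heap

end Heaps

end Kromatic

end

/-! ### Inclusion and exclusion, ω(X̄_G), and its p̄-expansion. -/

noncomputable section

namespace Kromatic

section Assembly

open Finset.HasAntidiagonal Heap
open scoped MvPowerSeries.WithPiTopology

/-! ### Inclusion and exclusion -/

lemma sum_sign_superset {V : Type*} [Fintype V] [DecidableEq V] (U : Finset V) :
    (∑ W : Finset V, if U ⊆ W then (-1 : ℚ) ^ Wᶜ.card else 0) =
      if U = Finset.univ then 1 else 0 := by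
  have h1 : (∑ W : Finset V, if U ⊆ W then (-1 : ℚ) ^ Wᶜ.card else 0) =
      ∑ W : Finset V, if W ⊆ Uᶜ then (-1 : ℚ) ^ W.card else 0 := by
    refine Fintype.sum_equiv (Equiv.mk compl compl compl_compl compl_compl) _ _ fun W => ?_
    simp only [Equiv.coe_fn_mk, Finset.compl_subset_compl]
  have h2 := Finset.sum_powerset_neg_one_pow_card (x := Uᶜ)
  rw [h1, ← Finset.sum_filter]
  have h3 : ({W | W ⊆ Uᶜ} : Finset (Finset V)) = Uᶜ.powerset := by ext; simp
  rw [h3]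
  have h4 : (Uᶜ = ∅) ↔ U = Finset.univ := Finset.compl_eq_empty_iff U
  simp only [h4] at h2
  exact_mod_cast h2

/-- Used in both directions: to impose that all vertices are colored, and at the end to impose that
all vertices are used by the Lyndon heaps. -/
lemma sum_sign_filter {V ι : Type*} [Fintype V] [DecidableEq V] (s : Finset ι) (U : ι → Finset V)
    (f : ι → ℚ) : ∑ W : Finset V, (-1 : ℚ) ^ Wᶜ.card * ∑ x ∈ s with U x ⊆ W, f x =
      ∑ x ∈ s with U x = Finset.univ, f x := by
  simp only [Finset.sum_filter, Finset.mul_sum]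
  rw [Finset.sum_comm]
  refine Finset.sum_congr rfl fun x _ => ?_
  have := congrArg (· * f x) (sum_sign_superset (U x))
  simp only [Finset.sum_mul, ite_mul, zero_mul, one_mul] at this
  rw [← this]
  refine Finset.sum_congr rfl fun W _ => ?_
  split_ifs <;> simp

/-! ### The Kromatic symmetric function by inclusion and exclusion -/

section Colorings

variable {V : Type*} [Fintype V] (G : SimpleGraph V)

lemma colorWeight_apply [DecidableEq V] (κ : V → Finset ℕ) (i : ℕ) :
    colorWeight κ i = ({v | i ∈ κ v} : Finset V).card := by
  rw [colorWeight, Finsupp.finsetSum_apply, Finset.card_filter]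
  refine Finset.sum_congr rfl fun v _ => ?_
  rw [Finsupp.finsetSum_apply]
  simp [Finsupp.single_apply]

lemma subset_support_colorWeight (κ : V → Finset ℕ) (v : V) : κ v ⊆ (colorWeight κ).support := by
  classical
  intro i hi
  rw [Finsupp.mem_support_iff, colorWeight_apply]
  exact (Finset.card_pos.2 ⟨v, by simpa using hi⟩).ne'

open Classical in
/-- The set colorings of weight `d`, with empty color sets allowed. -/
def colorings (d : ℕ →₀ ℕ) : Finset (V → Finset ℕ) :=
  {κ ∈ Fintype.piFinset fun _ : V => d.support.powerset |
    (∀ u v, G.Adj u v → Disjoint (κ u) (κ v)) ∧ colorWeight κ = d}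

variable {G} in
lemma mem_colorings {d : ℕ →₀ ℕ} {κ : V → Finset ℕ} :
    κ ∈ colorings G d ↔ (∀ u v, G.Adj u v → Disjoint (κ u) (κ v)) ∧ colorWeight κ = d := by
  simp only [colorings, Finset.mem_filter, Fintype.mem_piFinset, Finset.mem_powerset,
    and_iff_right_iff_imp]
  rintro ⟨-, rfl⟩
  exact subset_support_colorWeight κ

open Classical in
/-- The vertices that get a color. -/
def colored (κ : V → Finset ℕ) : Finset V := {v | (κ v).Nonempty}

-- A set coloring is recovered from its color classes: for each color `i`, an arbitrary stable set
-- of size `d i` in `W`. The classes of different colors are unrelated, which gives the product.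
open Classical in
lemma card_colorings (W : Finset V) (d : ℕ →₀ ℕ) :
    ({κ ∈ colorings G d | colored κ ⊆ W}.card : ℚ) =
      prodSeries (fun n => ((stableOn G W n).card : ℚ)) d := by
  have hR : prodSeries (fun n => ((stableOn G W n).card : ℚ)) d =
      ((Fintype.piFinset fun i : d.support => stableOn G W (d i)).card : ℚ) := by
    rw [Fintype.card_piFinset, Nat.cast_prod, prodSeries, Finsupp.prod,
      ← Finset.prod_coe_sort d.support fun i => ((stableOn G W (d i)).card : ℚ)]
  rw [hR, Nat.cast_inj]
  have hmem : ∀ (S : d.support → Finset V) (i : ℕ) (v : V),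
      i ∈ (({j | v ∈ S j} : Finset d.support).map (Function.Embedding.subtype _)) ↔
        ∃ h : i ∈ d.support, v ∈ S ⟨i, h⟩ := by
    intro S i v
    simp only [Finset.mem_map, Finset.mem_filter, Finset.mem_univ, true_and, Subtype.exists,
      Function.Embedding.subtype_apply]
    constructor
    · rintro ⟨j, hj, hv, rfl⟩; exact ⟨hj, hv⟩
    · rintro ⟨h, hv⟩; exact ⟨i, h, hv, rfl⟩
  refine Finset.card_nbij' (fun κ i => ({v | (i : ℕ) ∈ κ v} : Finset V))
    (fun S v => ({j | v ∈ S j} : Finset d.support).map (Function.Embedding.subtype _)) ?_ ?_ ?_ ?_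
  · intro κ hκ
    simp only [Finset.coe_filter, Set.mem_ofPred_eq, mem_colorings] at hκ
    obtain ⟨⟨h1, h2⟩, h3⟩ := hκ
    simp only [Finset.mem_coe, Fintype.mem_piFinset, mem_stableOn]
    rintro ⟨i, hi⟩
    refine ⟨⟨fun v hv => h3 ?_, ?_⟩, fun a ha b hb hab => ?_⟩
    · simp only [colored, Finset.mem_filter, Finset.mem_univ, true_and] at hv ⊢
      exact ⟨i, hv⟩
    · rw [← colorWeight_apply, h2]
    · simp only [Finset.mem_filter, Finset.mem_univ, true_and] at ha hb
      exact Finset.disjoint_left.1 (h1 a b hab) ha hb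
  · intro S hS
    simp only [Finset.mem_coe, Fintype.mem_piFinset, mem_stableOn] at hS
    simp only [Finset.coe_filter, Set.mem_ofPred_eq, mem_colorings]
    refine ⟨⟨fun u v huv => ?_, ?_⟩, fun v hv => ?_⟩
    · rw [Finset.disjoint_left]
      intro i hu hv
      rw [hmem] at hu hv
      obtain ⟨h, hu⟩ := hu
      obtain ⟨_, hv⟩ := hv
      exact (hS ⟨i, h⟩).2 u hu v hv huv
    · ext i
      rw [colorWeight_apply]
      simp only [hmem]
      by_cases h : i ∈ d.support
      · rw [← (hS ⟨i, h⟩).1.2]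
        congr 1
        ext v
        simp [h]
      · simp only [h, IsEmpty.exists_iff, Finset.filter_false, Finset.card_empty]
        exact (Finsupp.notMem_support_iff.1 h).symm
    · simp only [colored, Finset.mem_filter, Finset.mem_univ, true_and] at hv
      obtain ⟨i, hi⟩ := hv
      obtain ⟨h, hv⟩ := (hmem S i v).1 hi
      exact (hS ⟨i, h⟩).1.1 hv
  · intro κ hκ
    simp only [Finset.coe_filter, Set.mem_ofPred_eq, mem_colorings] at hκ
    funext v
    ext i
    rw [hmem]
    simp only [Finset.mem_filter, Finset.mem_univ, true_and]
    refine ⟨fun h => h.2, fun h => ⟨?_, h⟩⟩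
    rw [← hκ.1.2]
    exact subset_support_colorWeight κ v h
  · intro S hS
    funext i
    ext v
    simp only [Finset.mem_filter, Finset.mem_univ, true_and, hmem]
    exact ⟨fun h => h.2, fun h => ⟨i.2, h⟩⟩

theorem kromatic_eq_sum [DecidableEq V] : kromatic G = ∑ W : Finset V, (-1 : ℚ) ^ Wᶜ.card •
    prodSeries (fun n => ((stableOn G W n).card : ℚ)) := by
  classical
  ext d
  rw [map_sum]
  have h1 : MvPowerSeries.coeff d (kromatic G) =
      ∑ κ ∈ colorings G d with colored κ = Finset.univ, (1 : ℚ) := by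
    have hset : {κ : V → Finset ℕ | IsProperSetColoring G κ ∧ colorWeight κ = d} =
        ({κ ∈ colorings G d | colored κ = Finset.univ} : Finset (V → Finset ℕ)) := by
      ext κ
      simp only [IsProperSetColoring, colored, Finset.coe_filter, mem_colorings, Set.mem_ofPred_eq,
        Finset.eq_univ_iff_forall, Finset.mem_filter, Finset.mem_univ, true_and]
      tauto
    change (({κ : V → Finset ℕ | IsProperSetColoring G κ ∧ colorWeight κ = d}.ncard : ℕ) : ℚ) = _
    rw [hset, Set.ncard_coe_finset]
    simp
  rw [h1, ← sum_sign_filter]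
  refine Finset.sum_congr rfl fun W _ => ?_
  rw [map_smul, smul_eq_mul]
  congr 1
  change _ = prodSeries (fun n => ((stableOn G W n).card : ℚ)) d
  rw [← card_colorings, Finset.sum_const, nsmul_eq_mul, mul_one, Nat.cast_inj]
  congr!

end Colorings

/-! ### The involution -/

section Omega

variable {V : Type*} [Fintype V] [DecidableEq V] (G : SimpleGraph V)

lemma HasPsumExpansion.sum_smul {ι : Type*} {s : Finset ι} {r : ι → ℚ} {f : ι → MvPowerSeries ℕ ℚ}
    {c : ι → IntPartition → ℚ} (h : ∀ i ∈ s, HasPsumExpansion (f i) (c i)) :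
    HasPsumExpansion (∑ i ∈ s, r i • f i) fun lam => ∑ i ∈ s, r i * c i lam := by
  have := hasSum_sum fun i hi => (h i hi).const_smul (r i)
  unfold HasPsumExpansion
  convert this using 2 with lam
  rw [Finset.sum_smul]
  simp only [mul_smul]

/-- The logarithmic derivatives of the stable set and heap series have coefficients `b' W k` and `b
W k`, related by the sign (-1)^(k-1). That is the effect of ω on p_k. -/
theorem omega_kromatic : omega (kromatic G) = ∑ W : Finset V, (-1 : ℚ) ^ Wᶜ.card •
    prodSeries (fun n => ((heapsOn G W n).card : ℚ)) := by
  let b : Finset V → ℕ → ℚ := fun W k => ((pyramidsOn G W k).card : ℚ)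
  let b' : Finset V → ℕ → ℚ := fun W k => -((-1) ^ k * b W k)
  have hb0 : ∀ W, b W 0 = 0 := fun W => by simp [b, pyramidsOn_zero]
  have h1 : ∀ W ∈ (Finset.univ : Finset (Finset V)),
      HasPsumExpansion (prodSeries fun n => ((stableOn G W n).card : ℚ))
        fun lam => expCoeff (fun k => b' W k / k) lam.2.parts := by
    intro W _
    refine hasPsumExpansion_prodSeries ?_ (by simp [b', hb0]) (mul_card_stableOn G W)
    have : stableOn G W 0 = {∅} := by
      ext S
      rw [mem_stableOn, Finset.mem_singleton]
      constructor
      · exact fun h => Finset.card_eq_zero.1 h.1.2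
      · rintro rfl; simp
    simp [this]
  have h2 : ∀ W ∈ (Finset.univ : Finset (Finset V)),
      HasPsumExpansion (prodSeries fun n => ((heapsOn G W n).card : ℚ))
        fun lam => (-1) ^ (lam.1 - Multiset.card lam.2.parts) *
          expCoeff (fun k => b' W k / k) lam.2.parts := by
    intro W _
    have h3 := hasPsumExpansion_prodSeries (F := fun n => ((heapsOn G W n).card : ℚ)) (b := b W)
      (by simp [heapsOn_zero]) (hb0 W) (fun n => by
        simp only [b]
        exact_mod_cast mul_card_heapsOn (G := G) (W := W) n)
    convert h3 using 2 with lam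
    have h4 := expCoeff_sign (fun k => b' W k / k) (s := lam.2.parts) fun k hk => lam.2.parts_pos hk
    rw [lam.2.parts_sum] at h4
    rw [← h4]
    congr 1
    funext k
    rcases Nat.eq_zero_or_pos k with rfl | hk
    · simp
    · obtain ⟨k, rfl⟩ : ∃ k', k = k' + 1 := ⟨k - 1, by omega⟩
      have hsq : ((-1 : ℚ) ^ k) * (-1) ^ k = 1 := by rw [← mul_pow]; simp
      simp only [b', Nat.add_sub_cancel, pow_succ]
      linear_combination (b W (k + 1) / ((k + 1 : ℕ) : ℚ)) * hsq
  rw [kromatic_eq_sum]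
  refine HasPsumExpansion.omega_eq (HasPsumExpansion.sum_smul h1) ?_
  convert HasPsumExpansion.sum_smul (r := fun W : Finset V => (-1 : ℚ) ^ Wᶜ.card) h2 using 2 with lam
  rw [Finset.mul_sum]
  refine Finset.sum_congr rfl fun W _ => ?_
  ring

end Omega

/-! ### The expansion in the `p̄` -/

section Pbar

open MvPowerSeries

/-- Each variable occurs in a single factor, so the exponents are chosen independently. -/
lemma coeff_prod_sum_X_pow {ι : Type*} (P : Finset ι) (w : ι → ℕ) (s : Finset ℕ) (d : ℕ →₀ ℕ)
    (hd : d.support ⊆ s) : coeff d (∏ i ∈ s, ∑ t ∈ P, (X i : MvPowerSeries ℕ ℚ) ^ w t) =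
      ∏ i ∈ s, ({t ∈ P | w t = d i}.card : ℚ) := by
  have key : ∀ d : ℕ →₀ ℕ, coeff d (∏ i ∈ s, ∑ t ∈ P, (X i : MvPowerSeries ℕ ℚ) ^ w t) =
      if d.support ⊆ s then ∏ i ∈ s, ({t ∈ P | w t = d i}.card : ℚ) else 0 := by
    clear hd d
    induction s using Finset.induction_on with
    | empty => intro d; simp [coeff_one]
    | insert j s hj ih =>
      intro d
      rw [Finset.prod_insert hj, mul_comm, Finset.mul_sum, map_sum, Finset.prod_insert hj]
      have hterm : ∀ t ∈ P, coeff d ((∏ i ∈ s, ∑ t ∈ P, (X i : MvPowerSeries ℕ ℚ) ^ w t) * X j ^ w t) =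
          if w t = d j then (if d.support ⊆ insert j s then
            ∏ i ∈ s, ({t ∈ P | w t = d i}.card : ℚ) else 0) else 0 := by
        intro t _
        rw [X_pow_eq, coeff_mul_monomial, mul_one, ih]
        simp only [Finsupp.single_le_iff]
        by_cases hle : w t ≤ d j
        · rw [if_pos hle]
          by_cases heq : w t = d j
          · rw [if_pos heq]
            have hiff : (d - Finsupp.single j (w t)).support ⊆ s ↔ d.support ⊆ insert j s := by
              have : (d - Finsupp.single j (w t)).support = d.support.erase j := by
                ext i
                by_cases hij : i = j
                · subst hij; simp [heq]
                · simp [hij]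
              rw [this, ← Finset.subset_insert_iff]
            refine if_congr hiff (Finset.prod_congr rfl fun i hi => ?_) rfl
            have hij : j ≠ i := fun h => hj (h ▸ hi)
            simp [hij]
          · rw [if_neg heq, if_neg]
            intro h
            refine hj (h ?_)
            simp only [Finsupp.mem_support_iff, Finsupp.coe_tsub, Pi.sub_apply,
              Finsupp.single_eq_same]
            omega
        · rw [if_neg hle, if_neg (by omega)]
      rw [Finset.sum_congr rfl hterm, ← Finset.sum_filter, Finset.sum_const, nsmul_eq_mul]
      split_ifs <;> simp
  rw [key d, if_pos hd]

variable {V : Type*} [Fintype V] [LinearOrder V] (G : SimpleGraph V)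

/-- Substitutes the variables into the factorization of the heap series and exchanges the two
products: over the variables, each atom gives 1 + p̄_k. Truncation at `N` is exact here because no
exponent of `d` exceeds `N`. -/
lemma coeff_prodSeries_heapsOn (W : Finset V) {d : ℕ →₀ ℕ} {N : ℕ} (hN : d.degree ≤ N) :
    coeff d (prodSeries fun n => ((heapsOn G W n).card : ℚ)) =
      ∑ T ∈ (atoms G W N).powerset, coeff d (pbarM (T.val.map Prod.fst)) := by
  have hle : ∀ i, d i ≤ N := fun i => (Finsupp.le_degree i d).trans hN
  have h1 : ∀ n ≤ N, ((heapsOn G W n).card : ℚ) =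
      ({T ∈ (atoms G W N).powerset | ∑ x ∈ T, x.1 = n}.card : ℚ) := by
    intro n hn
    have h := agreeTo_iff.1 (agreeTo_heapSeries G W N) n hn
    rw [heapSeries, PowerSeries.coeff_mk, Finset.prod_one_add, map_sum] at h
    rw [h, Finset.card_filter, Nat.cast_sum]
    refine Finset.sum_congr rfl fun T _ => ?_
    rw [Finset.prod_pow_eq_pow_sum, PowerSeries.coeff_X_pow]
    simp only [eq_comm, Nat.cast_ite, Nat.cast_one, Nat.cast_zero]
  have h2 : coeff d (prodSeries fun n => ((heapsOn G W n).card : ℚ)) =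
      coeff d (∏ i ∈ d.support, ∏ x ∈ atoms G W N, (1 + X i ^ x.1) : MvPowerSeries ℕ ℚ) := by
    simp only [Finset.prod_one_add, Finset.prod_pow_eq_pow_sum]
    rw [coeff_prod_sum_X_pow _ _ _ _ subset_rfl]
    exact Finset.prod_congr rfl fun i _ => h1 _ (hle i)
  rw [h2, Finset.prod_comm]
  have h3 : Agree d (∏ x ∈ atoms G W N, ∏ i ∈ d.support, (1 + X i ^ x.1) : MvPowerSeries ℕ ℚ)
      (∏ x ∈ atoms G W N, (1 + pbar x.1)) := by
    refine Agree.prod fun x hx => ?_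
    have := (Agree.refl 1).add (agree_pbar (pos_of_mem_atoms hx) d).symm
    rwa [add_sub_cancel] at this
  rw [h3 d le_rfl, Finset.prod_one_add, map_sum]
  refine Finset.sum_congr rfl fun T _ => ?_
  rw [pbarM, Multiset.map_map]
  rfl

/-- The vertices used by the heaps of `T`. -/
def used (T : Finset (ℕ × Heap G)) : Finset V := {v | ∃ x ∈ T, v ∈ x.2.pieces}

lemma filter_used_subset (W : Finset V) (N : ℕ) :
    {T ∈ (atoms G Finset.univ N).powerset | used G T ⊆ W} = (atoms G W N).powerset := by
  ext T
  simp only [Finset.mem_filter, Finset.mem_powerset, used, Finset.subset_iff, mem_atoms,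
    Finset.mem_univ, true_and, forall_exists_index, and_imp]
  constructor
  · rintro ⟨h1, h2⟩ x hx
    obtain ⟨h3, h4, -, h5⟩ := h1 hx
    exact ⟨h3, h4, fun a ha => h2 x hx ha, h5⟩
  · intro h
    refine ⟨fun x hx => ?_, fun v x hx hv => (h hx).2.2.1 v hv⟩
    obtain ⟨h3, h4, -, h5⟩ := h hx
    exact ⟨h3, h4, fun _ _ => trivial, h5⟩

lemma coeff_omega_kromatic {d : ℕ →₀ ℕ} {N : ℕ} (hN : d.degree ≤ N) :
    coeff d (omega (kromatic G)) =
      ∑ T ∈ (atoms G Finset.univ N).powerset with used G T = Finset.univ,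
        coeff d (pbarM (T.val.map Prod.fst)) := by
  rw [omega_kromatic, map_sum, ← sum_sign_filter]
  refine Finset.sum_congr rfl fun W _ => ?_
  rw [map_smul, smul_eq_mul, coeff_prodSeries_heapsOn G W hN, filter_used_subset]

/-- Lyndon heap coverings as finite sets. -/
def coverings (N : ℕ) (s : Multiset ℕ) : Finset (Finset (ℕ × Heap G)) :=
  {T ∈ {T ∈ (atoms G Finset.univ N).powerset | used G T = Finset.univ} | T.val.map Prod.fst = s}

/-- Distinctness of the heaps on equal parts means that no pair is repeated, so coverings are sets
of atoms. -/
lemma nodup_of_nodup_filter {α β : Type*} [DecidableEq α] {M : Multiset (α × β)}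
    (h : ∀ k : α, ((M.filter fun x => x.1 = k).map Prod.snd).Nodup) : M.Nodup := by
  rw [Multiset.nodup_iff_le]
  intro a ha
  have h1 := Multiset.map_le_map (f := Prod.snd) (Multiset.filter_le_filter (fun x => x.1 = a.1) ha)
  have h2 := Multiset.nodup_of_le h1 (h a.1)
  simp at h2

lemma lyndonCoverings_eq (lam : IntPartition) {N : ℕ} (hN : lam.1 ≤ N) :
    lyndonCoverings G lam = Finset.val '' (coverings G N lam.2.parts : Set (Finset (ℕ × Heap G))) := by
  ext M
  simp only [lyndonCoverings, Set.mem_ofPred_eq, coverings, Finset.coe_filter, Set.mem_image,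
    Finset.mem_filter, Finset.mem_powerset]
  constructor
  · rintro ⟨h1, h2, h3, h4⟩
    have hnd := nodup_of_nodup_filter h4
    refine ⟨⟨M, hnd⟩, ⟨⟨fun x hx => ?_, ?_⟩, h1⟩, rfl⟩
    · have hxM : x ∈ M := hx
      obtain ⟨hL, j, hj⟩ := h2 x hxM
      -- A part is at most |λ| ≤ `N`; this bounds the size of the heap, and also `j` because `j < 2
      -- ^ j`. So every covering consists of truncated atoms.
      have hle : x.1 ≤ N := by
        refine le_trans ?_ hN
        rw [← lam.2.parts_sum]
        exact Multiset.le_sum_of_mem (h1 ▸ Multiset.mem_map_of_mem _ hxM)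
      have hpos := hL.size_pos
      have h2j := Nat.lt_two_pow_self (n := j)
      exact mem_atoms.2 ⟨hL, by nlinarith, fun _ _ => Finset.mem_univ _, j, by nlinarith, hj⟩
    · rw [Finset.eq_univ_iff_forall]
      intro v
      obtain ⟨x, hx, hv⟩ := h3 v
      simp only [used, Finset.mem_filter, Finset.mem_univ, true_and]
      exact ⟨x, hx, hv⟩
  · rintro ⟨T, ⟨⟨h1, h2⟩, h3⟩, rfl⟩
    refine ⟨h3, fun x hx => ?_, fun v => ?_, fun k => ?_⟩
    · obtain ⟨hL, -, -, j, -, hj⟩ := mem_atoms.1 (h1 hx)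
      exact ⟨hL, j, hj⟩
    · have := Finset.eq_univ_iff_forall.1 h2 v
      simp only [used, Finset.mem_filter, Finset.mem_univ, true_and] at this
      exact this
    · refine Multiset.Nodup.map_on ?_ (T.nodup.filter _)
      intro x hx y hy hxy
      rw [Multiset.mem_filter] at hx hy
      exact Prod.ext (hx.2.trans hy.2.symm) hxy

lemma finite_lyndonCoverings (lam : IntPartition) : (lyndonCoverings G lam).Finite := by
  rw [lyndonCoverings_eq G lam le_rfl]
  exact (Finset.finite_toSet _).image _

lemma ncard_lyndonCoverings (lam : IntPartition) {N : ℕ} (hN : lam.1 ≤ N) :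
    (lyndonCoverings G lam).ncard = (coverings G N lam.2.parts).card := by
  rw [lyndonCoverings_eq G lam hN, Set.ncard_image_of_injective _ Finset.val_injective,
    Set.ncard_coe_finset]

theorem hasPbarExpansion_omega_kromatic : HasPbarExpansion (omega (kromatic G))
    fun lam => ((lyndonCoverings G lam).ncard : ℚ) := by
  refine WithPiTopology.hasSum_iff_hasSum_coeff.2 fun d => ?_
  have h1 : coeff d (omega (kromatic G)) =
      ∑ lam ∈ (Finset.range (d.degree + 1)).sigma fun n => (Finset.univ : Finset n.Partition),
        coeff d (((lyndonCoverings G lam).ncard : ℚ) • pbarPart lam) := by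
    rw [coeff_omega_kromatic G le_rfl]
    have hterm : ∀ lam ∈ (Finset.range (d.degree + 1)).sigma
        fun n => (Finset.univ : Finset n.Partition),
        coeff d (((lyndonCoverings G lam).ncard : ℚ) • pbarPart lam) =
        ∑ T ∈ (atoms G Finset.univ d.degree).powerset with used G T = Finset.univ,
          if T.val.map Prod.fst = lam.2.parts then coeff d (pbarM (T.val.map Prod.fst)) else 0 := by
      intro lam hlam
      rw [Finset.mem_sigma, Finset.mem_range] at hlam
      rw [ncard_lyndonCoverings G lam (N := d.degree) (by omega), map_smul, ← Finset.sum_filter,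
        ← coverings, Finset.sum_congr rfl (g := fun _ => coeff d (pbarPart lam)), Finset.sum_const,
        nsmul_eq_mul, smul_eq_mul]
      intro T hT
      rw [(Finset.mem_filter.1 hT).2]
      rfl
    -- Each set `T` of atoms belongs to the one partition formed by its first components. If that
    -- partition is larger than `d.degree`, it is absent from the range, but then its p̄ product has
    -- no term at `d`.
    rw [Finset.sum_congr rfl hterm, Finset.sum_comm]
    refine Finset.sum_congr rfl fun T hT => ?_
    have hpos : ∀ k ∈ T.val.map Prod.fst, 0 < k := by
      intro k hk
      obtain ⟨x, hx, rfl⟩ := Multiset.mem_map.1 hk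
      exact pos_of_mem_atoms (Finset.mem_powerset.1 (Finset.mem_filter.1 hT).1 hx)
    by_cases hdeg : (T.val.map Prod.fst).sum ≤ d.degree
    · let lam₀ : IntPartition := ⟨_, ⟨T.val.map Prod.fst, fun {k} hk => hpos k hk, rfl⟩⟩
      rw [Finset.sum_eq_single lam₀, if_pos rfl]
      · rintro ⟨n, μ⟩ - hne
        refine if_neg fun h => hne ?_
        obtain ⟨p, hp, rfl⟩ := μ
        dsimp only at h
        subst h
        rfl
      · intro hnot
        refine (hnot ?_).elim
        rw [Finset.mem_sigma, Finset.mem_range]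
        exact ⟨Nat.lt_succ_of_le hdeg, Finset.mem_univ _⟩
    · rw [coeff_pbarM_eq_zero hpos (by omega)]
      simp
  rw [h1]
  refine hasSum_sum_of_ne_finset_zero fun lam hlam => ?_
  have hdeg : d.degree < lam.2.parts.sum := by
    rw [lam.2.parts_sum]
    simpa using hlam
  rw [map_smul]
  change _ • coeff d (pbarM lam.2.parts) = 0
  rw [coeff_pbarM_eq_zero (fun k hk => lam.2.parts_pos hk) hdeg, smul_zero]

end Pbar

end Assembly

end Kromatic

end

/-- The `p̄`-expansion of `ω(X̄_G)` exists and is unique, the coefficient of `p̄_λ` is the (finite)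
number of Lyndon heap coverings attached to `λ`, and hence `ω(X̄_G)` is `p̄`-positive. -/
theorem theorem1p3 {V : Type*} [Fintype V] [LinearOrder V] (G : SimpleGraph V) :
    (∀ lam : Kromatic.IntPartition, (Kromatic.lyndonCoverings G lam).Finite) ∧
    (∀ c : Kromatic.IntPartition → ℚ,
      Kromatic.HasPbarExpansion (Kromatic.omega (Kromatic.kromatic G)) c ↔
        ∀ lam, c lam = ((Kromatic.lyndonCoverings G lam).ncard : ℚ)) ∧
    Kromatic.IsPbarPositive (Kromatic.omega (Kromatic.kromatic G)) := by
  have h := Kromatic.hasPbarExpansion_omega_kromatic G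
  refine ⟨Kromatic.finite_lyndonCoverings G, fun c => ⟨fun hc lam => ?_, fun hc => ?_⟩, _, h,
    fun lam => Nat.cast_nonneg _⟩
  · rw [hc.unique h]
  · rwa [funext hc]
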